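/- Let $n\ge 1$, let $(X,\mu)$ be a standard Borel probability space and let $\Phi=(T^z)_{z\in\mathbb Z^n}$ be a measurable $\mu$-preserving action of $\mathbb Z^n$ on $X$. Definitions. The partial mixing constant $\alpha(\Phi)$ is the maximal $\alpha\in[0,1]$ such that $\liminf_{z\to\infty}\mu(A\cap T^zB)\ge\alpha\,\mu(A)\mu(B)$ for all measurable $A,B$. The local rank $\beta(\Phi)$ is the maximal number $\beta$ for which there are finite measurable partitions $\xi_j=\{T^zB_j : z\in Q_j\}\cup\{C_j^1,\dots,C_j^{m_j}\}$ of $X$, with rectangles $Q_j=\prod_{i=1}^n\{0,\dots,h_j^{(i)}-1\}$, such that $\mu\big(\bigsqcup_{z\in Q_j}T^zB_j\big)\to\beta$ and every measurable set $A$ is approximated by $\xi_j$-measurable sets $A_j$, that is, $\mu(A\triangle A_j)\to0$. A self-joining is a measure $\nu$ on $X\times X$ with both marginals $\mu$ that is invariant under all $T^z\times T^z$; it is ergodic if this diagonal action is ergodic with respect to $\nu$; joinings of $k$ copies of $\Phi$ are defined in the same way on $X^k$. The diagonal measure is $\Delta=(x\mapsto(x,x))_*\mu$. A Markov operator on $L^2(\mu)$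 is a positive operator $P$ with $P1=P^*1=1$; the Markov centralizer of $\Phi$ is the set of Markov operators that commute with all operators $T^zf=f\circ T^z$. Theorem 3. Suppose that $\alpha(\Phi)+\beta(\Phi)>1$. Then: 1. The ergodic self-joinings of $\Phi$ form finitely many classes for the equivalence $\nu\sim\nu'$ iff $\nu=(\mathrm{Id}\times T^z)\nu'$ for some $z\in\mathbb Z^n$. 2. Every ergodic self-joining $\nu\ne\mu\times\mu$ is the graph of a finite-valued map: there are $N\ge1$ and measurable $f_1,\dots,f_N:X\to X$, with $f_1(x),\dots,f_N(x)$ distinct for $\mu$-almost every $x$, such that $\nu=\frac1N\sum_{i=1}^N(x\mapsto(x,f_i(x)))_*\mu$. 3. $\Phi$ has finite joining rank: there is an $r$ such that every ergodic joining of $r+1$ copies of $\Phi$ has two distinct coordinates whose joint law is $\mu\times\mu$ or $(\mathrm{Id}\times T^z)\Delta$ for some $z\in\mathbb Z^n$. 4. The Markov centralizer is generated by the action together with finitely many Markov operators: there are $P_1,\dots,P_m$ in the Markov centralizer such that an operator $Q$ belongs to the Markov centralizer if and only if $Q=\sum_{i\le m,\,z\in\mathbb Z^n}c_{i,z}T^zP_i$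 (norm convergent) for some $c_{i,z}\ge0$ with $\sum_{i,z}c_{i,z}=1$. -/

import Mathlib

open MeasureTheory Filter Topology
open scoped ENNReal

noncomputable section

namespace ZnAction

/-- The acting group `ℤⁿ`. -/
abbrev Zn (n : ℕ) : Type := Fin n → ℤ

section Rank

variable {n : ℕ} {X : Type*} [MeasurableSpace X] [AddAction (Zn n) X]

/-- The rectangle `{0,…,h₁-1} × … × {0,…,hₙ-1}` in `ℤⁿ`. -/
def box (h : Fin n → ℕ) : Set (Zn n) := {z | ∀ i, 0 ≤ z i ∧ z i < (h i : ℤ)}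

/-- The set `T^z B`. -/
def translate (z : Zn n) (B : Set X) : Set X := (fun x => z +ᵥ x) '' B

variable (n X) in
/-- A finite partition of `X` into the levels `T^z B` (`z` in a rectangle) of a tower
and finitely many further measurable sets `C¹,…,Cᵐ`. -/
structure TowerPartition where
  /-- the base `B` of the tower -/
  base : Set X
  /-- the side lengths of the rectangle -/
  height : Fin n → ℕ
  /-- the number of remaining sets -/
  restCard : ℕ
  /-- the remaining sets -/
  rest : Fin restCard → Set X
  measurableSet_base : MeasurableSet base
  measurableSet_rest : ∀ i, MeasurableSet (rest i)
  levels_disjoint : ∀ z ∈ box height, ∀ w ∈ box height, z ≠ w →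
    Disjoint (translate z base) (translate w base)
  rest_disjoint : ∀ i j, i ≠ j → Disjoint (rest i) (rest j)
  levels_rest_disjoint : ∀ z ∈ box height, ∀ i, Disjoint (translate z base) (rest i)
  cover : (⋃ z ∈ box height, translate z base) ∪ (⋃ i, rest i) = Set.univ

/-- The tower `U = ⨆_z T^z B`. -/
def TowerPartition.tower (ξ : TowerPartition n X) : Set X :=
  ⋃ z ∈ box ξ.height, translate z ξ.base

/-- `A` is a union of elements of the partition. -/
def TowerPartition.IsPartitionSet (ξ : TowerPartition n X) (A : Set X) : Prop :=
  ∃ L ⊆ box ξ.height, ∃ S : Set (Fin ξ.restCard),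
    A = (⋃ z ∈ L, translate z ξ.base) ∪ (⋃ i ∈ S, ξ.rest i)

/-- `ξ_j → ε`: every measurable set is approximated by `ξ_j`-measurable sets. -/
def Approximating (μ : Measure X) (ξ : ℕ → TowerPartition n X) : Prop :=
  ∀ A : Set X, MeasurableSet A → ∃ A' : ℕ → Set X, (∀ j, (ξ j).IsPartitionSet (A' j)) ∧
    Tendsto (fun j => μ (symmDiff A (A' j))) atTop (𝓝 0)

variable (n) in
/-- The local rank `β(Φ)`. -/
def localRank (μ : Measure X) : ℝ :=
  sSup {b : ℝ | ∃ ξ : ℕ → TowerPartition n X, Approximating μ ξ ∧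
    Tendsto (fun j => μ.real (ξ j).tower) atTop (𝓝 b)}

variable (n) in
/-- The partial mixing constant `α(Φ)` (it is `0` if the action is not partially mixing);
`z → ∞` in `ℤⁿ` is the cofinite filter. -/
def mixingConstant (μ : Measure X) : ℝ :=
  sSup {a : ℝ | 0 ≤ a ∧ a ≤ 1 ∧ ∀ A B : Set X, MeasurableSet A → MeasurableSet B →
    ENNReal.ofReal a * μ A * μ B ≤ liminf (fun z : Zn n => μ (A ∩ translate z B)) cofinite}

end Rank

section Joinings

variable {n : ℕ} {X : Type*} [MeasurableSpace X] [AddAction (Zn n) X]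

variable (n) in
/-- `ν` is an ergodic self-joining of order two: both marginals are `μ`, and `ν` is invariant
and ergodic for the diagonal action of `ℤⁿ` on `X × X`. -/
structure IsErgodicSelfJoining (μ : Measure X) (ν : Measure (X × X)) : Prop where
  map_fst : ν.map Prod.fst = μ
  map_snd : ν.map Prod.snd = μ
  ergodic : ErgodicVAdd (Zn n) (X × X) ν

/-- The measure `(Id × T^z) ν`. -/
def shift (z : Zn n) (ν : Measure (X × X)) : Measure (X × X) :=
  ν.map (fun p => (p.1, z +ᵥ p.2))

/-- The diagonal joining `Δ`. -/
def diagonal (μ : Measure X) : Measure (X × X) := μ.map (fun x => (x, x))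

/-- `ν` is the (uniformly weighted) graph over `μ` of the map `x ↦ {f₁(x),…,f_N(x)}`
with exactly `N` values. -/
def IsFiniteValuedGraph (μ : Measure X) (ν : Measure (X × X)) : Prop :=
  ∃ N : ℕ, 0 < N ∧ ∃ f : Fin N → X → X, (∀ i, Measurable (f i)) ∧
    (∀ᵐ x ∂μ, Function.Injective (fun i => f i x)) ∧
    ν = (N : ℝ≥0∞)⁻¹ • ∑ i, μ.map (fun x => (x, f i x))

variable (n) in
/-- `lam` is an ergodic self-joining of order `k` (for the diagonal action on `X^k`). -/
structure IsErgodicSelfJoiningOfOrder (k : ℕ) (μ : Measure X) (lam : Measure (Fin k → X)) :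
    Prop where
  map_eval : ∀ i, lam.map (fun x => x i) = μ
  ergodic : ErgodicVAdd (Zn n) (Fin k → X) lam

variable (n) in
/-- Finite joining rank: for some `r`, every ergodic joining of `r + 1` copies of the action has
two distinct coordinates whose joint law is `μ × μ` or an off-diagonal measure
`(Id × T^z) Δ`. -/
def HasFiniteJoiningRank (μ : Measure X) : Prop :=
  ∃ r : ℕ, ∀ lam : Measure (Fin (r + 1) → X), IsErgodicSelfJoiningOfOrder n (r + 1) μ lam →
    ∃ i j, i ≠ j ∧ (lam.map (fun x => (x i, x j)) = μ.prod μ ∨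
      ∃ z : Zn n, lam.map (fun x => (x i, x j)) = shift z (diagonal μ))

end Joinings

section Markov

variable {n : ℕ} {X : Type*} [MeasurableSpace X]

/-- Markov operators on `L²(μ)`: positive operators `P` with `P 1 = 1` and `P* 1 = 1`. -/
structure IsMarkov (μ : Measure X) [IsProbabilityMeasure μ]
    (P : Lp ℝ 2 μ →L[ℝ] Lp ℝ 2 μ) : Prop where
  nonneg : ∀ f, 0 ≤ f → 0 ≤ P f
  map_one : P (Lp.const 2 μ 1) = Lp.const 2 μ 1
  adjoint_one : ContinuousLinearMap.adjoint P (Lp.const 2 μ 1) = Lp.const 2 μ 1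

variable [AddAction (Zn n) X] [MeasurableConstVAdd (Zn n) X]

/-- The operator `f ↦ f ∘ T^z` on `L²(μ)`. -/
def koopman (μ : Measure X) [VAddInvariantMeasure (Zn n) X μ] (z : Zn n) :
    Lp ℝ 2 μ →L[ℝ] Lp ℝ 2 μ :=
  (Lp.compMeasurePreservingₗᵢ ℝ (fun x : X => z +ᵥ x)
    (measurePreserving_vadd z μ)).toContinuousLinearMap

variable (n) in
/-- The Markov centralizer: Markov operators that commute with the action. -/
def markovCentralizer (μ : Measure X) [IsProbabilityMeasure μ]
    [VAddInvariantMeasure (Zn n) X μ] : Set (Lp ℝ 2 μ →L[ℝ] Lp ℝ 2 μ) :=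
  {P | IsMarkov μ P ∧ ∀ z : Zn n, P ∘L koopman μ z = koopman μ z ∘L P}

end Markov

end ZnAction

end

/-! Fix a partial mixing constant `a` and towers of limiting measure `b` with `a + b > 1`.
Everything rests on one fact (`exists_not_mutuallySingular`, packaged as `HasClosePairs`): there is
a `K` such that among any `K` random points with law `μ` and invariant pairwise laws, two have a
joint law that is not singular to `μ × μ` or not singular to some off-diagonal measure `(Id ×
T^k)Δ`.

The reason is a conflict between two estimates. Call two levels of a tower close if their indices
differ by a vector `k` at most `1/M` of the rectangle. On products of close levels, an invariant
joining agrees, up to the approximation by partition sets, with a combination of the measures `(Id ×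
T^k)Δ`, each restricted to the points of the tower that `T^k` keeps inside it
(`measureReal_strip_inter`). For large `M` these restrictions have mass definitely greater than `1 -
a`. For all but finitely many `k`, partial mixing leaves at most about `1 - a` of the mass of `(Id ×
T^k)Δ` outside a given set of almost full product measure, so the restriction meets that set in
definite mass. Each remaining `k` is handled by singularity to its own off-diagonal measure. Hence a
joining singular to all of these measures gives vanishing mass to close levels
(`eventually_strip_lt`). But `K` points have on average about `K b` members in the tower, and more
than `M^n` points of the tower always contain two in close levels.

Now disintegrate a self-joining as `ν = μ ⊗ κ` and take many copies of the second coordinate,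
conditionally independent over the first. If the fibres have no atoms, two copies almost surely
never lie on one orbit. Ramsey's theorem then yields large pairwise independent families on each of
finitely many invariant pieces, and a function of the first coordinate cannot correlate equally with
all of their members; so `ν = μ × μ` (`compProd_eq_prod_of_noAtoms`). If `ν` is ergodic and
different from `μ × μ`, the invariant function `κ x {y}` is a positive constant, and the fibres are
uniform on `N` points.

The same construction with different ergodic joinings over a common first coordinate produces two
whose points satisfy `y' = T^z y` with positive probability, and these joinings are shifts of each
other (`exists_eq_shift`). Finite joining rank is the basic fact together with the principle that
two ergodic measures are singular or equal. Finally there are only countably many ergodic joinings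
and every joining has an ergodic component, so every joining is a countable convex combination of
ergodic ones; joinings correspond to Markov operators commuting with the action. -/

noncomputable section

namespace ZnAction

/-! ### Invariant and ergodic measures: rigidity and singularity -/

section Ergodic

set_option linter.unusedSectionVars false

variable {G α β : Type*} [AddGroup G] [MeasurableSpace α] [AddAction G α]
  [MeasurableConstVAdd G α] [MeasurableSpace β] [AddAction G β] [MeasurableConstVAdd G β]

theorem measure_zero_or_compl_zero {s : Set α} {μ : Measure α} (h : EventuallyConst s (ae μ)) :
    μ s = 0 ∨ μ sᶜ = 0 := by
  rw [eventuallyConst_set] at h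
  rcases h with h | h
  · right; exact h
  · left; exact measure_mono_null (fun x hx => not_not.2 hx) h

variable (G) in
/-- Measurable functions that are a.e. invariant under an ergodic action are a.e. constant. -/
theorem ae_const_of_ae_invariant {Y : Type*} [MeasurableSpace Y]
    [MeasurableSpace.CountablySeparated Y] [Nonempty Y] {μ : Measure α} [ErgodicVAdd G α μ]
    {f : α → Y} (hf : Measurable f) (hinv : ∀ g : G, (fun x => f (g +ᵥ x)) =ᵐ[μ] f) :
    ∃ c, f =ᵐ[μ] fun _ => c := by
  refine exists_eventuallyEq_const_of_forall_separating MeasurableSet fun U hU => ?_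
  have := aeconst_of_forall_preimage_vadd_ae_eq G (μ := μ) (s := f ⁻¹' U)
    (hf hU).nullMeasurableSet fun g => by
      filter_upwards [hinv g] with x hx
      change (f (g +ᵥ x) ∈ U) = (f x ∈ U)
      rw [hx]
  rw [eventuallyConst_set] at this
  exact this

theorem vaddInvariantMeasure_of_map {ρ : Measure α} (h : ∀ g : G, ρ.map (g +ᵥ ·) = ρ) :
    VAddInvariantMeasure G α ρ :=
  ⟨fun g s hs => by
    conv_rhs => rw [← h g, Measure.map_apply (measurable_const_vadd g) hs]⟩

theorem vaddInvariantMeasure_restrict {ρ : Measure α} [VAddInvariantMeasure G α ρ] {E : Set α}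
    (hinv : ∀ g : G, (g +ᵥ ·) ⁻¹' E =ᵐ[ρ] E) :
    VAddInvariantMeasure G α (ρ.restrict E) := by
  refine ⟨fun g s hs => ?_⟩
  rw [Measure.restrict_apply (measurable_const_vadd g hs), Measure.restrict_apply hs,
    ← measure_preimage_vadd ρ g (s ∩ E), Set.preimage_inter]
  refine measure_congr ?_
  exact (EventuallyEq.refl _ _).inter (hinv g).symm

-- The density of an invariant measure with respect to another is an invariant function, hence
-- constant by ergodicity.
variable (G) in
theorem eq_smul_of_absolutelyContinuous {ρ μ : Measure α} [IsProbabilityMeasure μ]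
    [ErgodicVAdd G α μ] [IsFiniteMeasure ρ] [VAddInvariantMeasure G α ρ] (h : ρ ≪ μ) :
    ρ = ρ Set.univ • μ := by
  obtain ⟨c, hc⟩ := ae_const_of_ae_invariant G (μ := μ) (Measure.measurable_rnDeriv ρ μ)
    fun g => MeasurePreserving.rnDeriv_comp_aeEq (measurePreserving_vadd g ρ)
      (measurePreserving_vadd g μ)
  have h1 : ρ = c • μ := by
    conv_lhs => rw [← Measure.withDensity_rnDeriv_eq ρ μ h]
    rw [withDensity_congr_ae hc, withDensity_const]
  have h2 : ρ Set.univ = c := by rw [h1]; simp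
  rw [h2, ← h1]

variable (G) in
/-- The set carrying the part of `ρ` which is absolutely continuous with respect to `σ`. -/
theorem exists_invariant_absolutelyContinuous_part (ρ σ : Measure α) [IsFiniteMeasure ρ]
    [IsFiniteMeasure σ] [VAddInvariantMeasure G α ρ] [VAddInvariantMeasure G α σ] :
    ∃ E, MeasurableSet E ∧ σ Eᶜ = 0 ∧ ρ.restrict E ≪ σ ∧
      ∀ g : G, (g +ᵥ ·) ⁻¹' E =ᵐ[ρ] E := by
  obtain ⟨S, hS, h1, h2⟩ := ρ.mutuallySingular_singularPart σ
  refine ⟨S, hS, h2, ?_, ?_⟩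
  · have : ρ.restrict S = (σ.withDensity (ρ.rnDeriv σ)).restrict S := by
      conv_lhs => rw [ρ.haveLebesgueDecomposition_add σ]
      rw [Measure.restrict_add, Measure.restrict_eq_zero.2 h1, zero_add]
    rw [this]
    exact Measure.restrict_le_self.absolutelyContinuous.trans (withDensity_absolutelyContinuous _ _)
  · have hac : ρ.restrict S ≪ σ := by
      have : ρ.restrict S = (σ.withDensity (ρ.rnDeriv σ)).restrict S := by
        conv_lhs => rw [ρ.haveLebesgueDecomposition_add σ]
        rw [Measure.restrict_add, Measure.restrict_eq_zero.2 h1, zero_add]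
      rw [this]
      exact Measure.restrict_le_self.absolutelyContinuous.trans
        (withDensity_absolutelyContinuous _ _)
    -- The complement of `S` is `σ`-null, and so is its preimage under `g`; absolute continuity on
    -- `S` makes that preimage `ρ`-null inside `S`. The reverse inclusion is the same fact for `-g`,
    -- pulled back by `g`.
    have key : ∀ g : G, ρ (S \ (g +ᵥ ·) ⁻¹' S) = 0 := fun g => by
      have hm : MeasurableSet ((g +ᵥ · : α → α) ⁻¹' S)ᶜ := (measurable_const_vadd g hS).compl
      have := hac (s := ((g +ᵥ ·) ⁻¹' S)ᶜ) (by
        rw [← Set.preimage_compl]; exact measure_preimage_vadd_null h2 g)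
      rw [Measure.restrict_apply hm] at this
      rwa [Set.inter_comm] at this
    intro g
    refine EventuallyLE.antisymm (ae_le_set.2 ?_) (ae_le_set.2 (key g))
    have := measure_preimage_vadd_null (key (-g)) g
    rw [Set.preimage_sdiff, Set.preimage_preimage] at this
    simpa using this

theorem measure_ne_zero_of_not_mutuallySingular {ρ σ : Measure α} (h : ¬ ρ ⟂ₘ σ) {E : Set α}
    (hE : MeasurableSet E) (h2 : σ Eᶜ = 0) : ρ E ≠ 0 := fun h0 => h ⟨E, hE, h0, h2⟩

variable (G) in
/-- An ergodic measure that is not singular to an invariant measure is a multiple of a part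
of it. -/
theorem exists_restrict_eq_smul {ρ σ : Measure α} [IsFiniteMeasure ρ] [IsProbabilityMeasure σ]
    [VAddInvariantMeasure G α ρ] [ErgodicVAdd G α σ] :
    ∃ E, MeasurableSet E ∧ σ Eᶜ = 0 ∧ ρ.restrict E = ρ E • σ ∧
      ∀ g : G, (g +ᵥ ·) ⁻¹' E =ᵐ[ρ] E := by
  obtain ⟨E, hE, h1, h2, h3⟩ := exists_invariant_absolutelyContinuous_part G ρ σ
  refine ⟨E, hE, h1, ?_, h3⟩
  have := vaddInvariantMeasure_restrict h3
  simpa using eq_smul_of_absolutelyContinuous G h2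

-- The part of `ρ` absolutely continuous with respect to `σ` sits on an invariant set, which is
-- `ρ`-null or full. This upgrades every "not singular" obtained later to an equality.
variable (G) in
theorem eq_of_ergodic_of_not_mutuallySingular {ρ σ : Measure α} [IsProbabilityMeasure ρ]
    [IsProbabilityMeasure σ] [ErgodicVAdd G α ρ] [ErgodicVAdd G α σ] (h : ¬ ρ ⟂ₘ σ) : ρ = σ := by
  obtain ⟨E, hE, h1, h2, h3⟩ := exists_restrict_eq_smul G (ρ := ρ) (σ := σ)
  have h4 := measure_ne_zero_of_not_mutuallySingular h hE h1
  have h5 := (measure_zero_or_compl_zero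
    (aeconst_of_forall_preimage_vadd_ae_eq G hE.nullMeasurableSet h3)).resolve_left h4
  have h6 : ρ E = 1 := (prob_compl_eq_zero_iff hE).1 h5
  rw [h6, one_smul] at h2
  rw [← h2]
  exact (Measure.restrict_eq_self_of_ae_mem h5).symm

variable (G) in
theorem ergodicVAdd_map {μ : Measure α} [ErgodicVAdd G α μ] {f : α → β} (hf : Measurable f)
    (hsmul : ∀ (g : G) a, f (g +ᵥ a) = g +ᵥ f a) : ErgodicVAdd G β (μ.map f) := by
  have := vaddInvariantMeasure_map μ f hsmul hf
  refine ⟨fun {s} hs h => ?_⟩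
  have h1 := aeconst_of_forall_preimage_vadd_ae_eq G (μ := μ) (s := f ⁻¹' s)
    (hf hs).nullMeasurableSet fun g => by
      have := (ae_eq_comp hf.aemeasurable (h g))
      filter_upwards [this] with x hx
      change (f (g +ᵥ x) ∈ s) = (f x ∈ s)
      rw [hsmul]
      exact hx
  rw [eventuallyConst_set] at h1 ⊢
  exact h1.imp (fun h => (ae_map_iff hf.aemeasurable hs).2 h)
    fun h => (ae_map_iff hf.aemeasurable hs.compl).2 h

end Ergodic

/-! ### Approximation in `X × X` by finite unions of rectangles -/

section Grid

variable {X : Type*} [MeasurableSpace X]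

/-- A union of products of cells of a finite measurable partition. -/
def IsGrid (R : Set (X × X)) : Prop :=
  ∃ (N : ℕ) (p : X → Fin N) (S : Set (Fin N × Fin N)), Measurable p ∧
    R = {q | (p q.1, p q.2) ∈ S}

theorem IsGrid.measurableSet {R : Set (X × X)} (hR : IsGrid R) : MeasurableSet R := by
  obtain ⟨N, p, S, hp, rfl⟩ := hR
  have : Measurable fun q : X × X => (p q.1, p q.2) := by fun_prop
  exact this (Set.toFinite S).measurableSet

theorem IsGrid.compl {R : Set (X × X)} (hR : IsGrid R) : IsGrid Rᶜ := by
  obtain ⟨N, p, S, hp, rfl⟩ := hR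
  exact ⟨N, p, Sᶜ, hp, rfl⟩

theorem IsGrid.union {R R' : Set (X × X)} (hR : IsGrid R) (hR' : IsGrid R') :
    IsGrid (R ∪ R') := by
  obtain ⟨N, p, S, hp, rfl⟩ := hR
  obtain ⟨N', p', S', hp', rfl⟩ := hR'
  refine ⟨N * N', fun x => finProdFinEquiv (p x, p' x),
    {q | ((finProdFinEquiv.symm q.1).1, (finProdFinEquiv.symm q.2).1) ∈ S ∨
      ((finProdFinEquiv.symm q.1).2, (finProdFinEquiv.symm q.2).2) ∈ S'}, ?_, ?_⟩
  · exact (measurable_of_finite _).comp (hp.prodMk hp')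
  · ext q
    simp only [Set.mem_union, Set.mem_ofPred_eq, Equiv.symm_apply_apply]

open Classical in
theorem isGrid_prod {A B : Set X} (hA : MeasurableSet A) (hB : MeasurableSet B) :
    IsGrid (A ×ˢ B) := by
  -- A two-bit code of `x`: the high bit is membership in `A`, the low bit membership in `B`. One
  -- partition must serve both coordinates.
  refine ⟨4, fun x => if x ∈ A then (if x ∈ B then 3 else 2) else (if x ∈ B then 1 else 0),
    {q | (q.1 = 2 ∨ q.1 = 3) ∧ (q.2 = 1 ∨ q.2 = 3)}, ?_, ?_⟩
  · exact Measurable.ite hA (Measurable.ite hB measurable_const measurable_const)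
      (Measurable.ite hB measurable_const measurable_const)
  · ext ⟨x, y⟩
    simp only [Set.mem_prod, Set.mem_ofPred_eq]
    by_cases h1 : x ∈ A <;> by_cases h2 : x ∈ B <;> by_cases h3 : y ∈ A <;>
      by_cases h4 : y ∈ B <;> simp [h1, h2, h3, h4]

theorem isSetRing_isGrid : IsSetRing {R : Set (X × X) | IsGrid R} where
  empty_mem := by simpa using isGrid_prod (X := X) (A := ∅) (B := ∅) .empty .empty
  union_mem _ _ h1 h2 := h1.union h2
  sdiff_mem s t h1 h2 := by
    have : IsGrid (sᶜ ∪ t)ᶜ := (h1.compl.union h2).compl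
    simpa [Set.compl_union, Set.sdiff_eq] using this

theorem generateFrom_isGrid :
    (inferInstance : MeasurableSpace (X × X)) = MeasurableSpace.generateFrom {R | IsGrid R} := by
  apply le_antisymm
  · rw [← generateFrom_prod]
    refine MeasurableSpace.generateFrom_mono ?_
    rintro _ ⟨A, hA, B, hB, rfl⟩
    exact isGrid_prod hA hB
  · exact MeasurableSpace.generateFrom_le fun R hR => hR.measurableSet

/-- Grids form a ring generating the product σ-algebra. They are the right test sets because partial
mixing and approximation by towers both control finitely many subsets of `X` at a time. -/
theorem exists_isGrid_symmDiff_lt (θ : Measure (X × X)) [IsFiniteMeasure θ] {E : Set (X × X)}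
    (hE : MeasurableSet E) {ε : ℝ} (hε : 0 < ε) :
    ∃ R, IsGrid R ∧ θ.real (symmDiff R E) < ε := by
  obtain ⟨R, hR, h⟩ := exists_measure_symmDiff_lt_of_generateFrom_isSetRing (μ := θ)
    (isSetRing_isGrid (X := X)) ⟨{Set.univ}, Set.countable_singleton _, by
      simpa using isGrid_prod (X := X) MeasurableSet.univ MeasurableSet.univ, by simp⟩
    generateFrom_isGrid hE (ENNReal.ofReal_pos.2 hε)
  exact ⟨R, hR, (ENNReal.lt_ofReal_iff_toReal_lt (measure_ne_top _ _)).1 h⟩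

/-- Mutually singular measures are separated by grids. -/
theorem exists_isGrid_of_mutuallySingular {ν σ : Measure (X × X)} [IsFiniteMeasure ν]
    [IsFiniteMeasure σ] (h : ν ⟂ₘ σ) {ε : ℝ} (hε : 0 < ε) :
    ∃ R, IsGrid R ∧ ν.real R < ε ∧ σ.real Rᶜ < ε := by
  obtain ⟨E, hE, h1, h2⟩ := h
  obtain ⟨R, hR, h3⟩ := exists_isGrid_symmDiff_lt (ν + σ) hE hε
  rw [measureReal_add_apply] at h3
  have h4 : ν.real R ≤ ν.real (symmDiff R E) := by
    calc ν.real R ≤ ν.real (symmDiff R E ∪ E) := measureReal_mono fun q hq => by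
          by_cases hqE : q ∈ E
          · exact Or.inr hqE
          · exact Or.inl (Or.inl ⟨hq, hqE⟩)
      _ ≤ ν.real (symmDiff R E) + ν.real E := measureReal_union_le _ _
      _ = _ := by simp [Measure.real, h1]
  have h5 : σ.real Rᶜ ≤ σ.real (symmDiff R E) := by
    calc σ.real Rᶜ ≤ σ.real (symmDiff R E ∪ Eᶜ) := measureReal_mono fun q hq => by
          by_cases hqE : q ∈ E
          · exact Or.inl (Or.inr ⟨hqE, hq⟩)
          · exact Or.inr hqE
      _ ≤ σ.real (symmDiff R E) + σ.real Eᶜ := measureReal_union_le _ _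
      _ = _ := by simp [Measure.real, h2]
  have h6 := measureReal_nonneg (μ := ν) (s := symmDiff R E)
  have h7 := measureReal_nonneg (μ := σ) (s := symmDiff R E)
  exact ⟨R, hR, by linarith, by linarith⟩

open Classical in
theorem measureReal_grid (θ : Measure (X × X)) [IsFiniteMeasure θ] {N : ℕ} {p : X → Fin N}
    (hp : Measurable p) (S : Set (Fin N × Fin N)) :
    θ.real {q | (p q.1, p q.2) ∈ S} =
      ∑ s ∈ S.toFinset, θ.real ((p ⁻¹' {s.1}) ×ˢ (p ⁻¹' {s.2})) := by
  rw [← measureReal_biUnion_finset]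
  · congr 1
    ext q
    simp only [Set.mem_ofPred_eq, Set.mem_toFinset, Set.mem_iUnion, Set.mem_prod,
      Set.mem_preimage, Set.mem_singleton_iff, exists_prop]
    constructor
    · intro h
      exact ⟨_, h, rfl, rfl⟩
    · rintro ⟨⟨s, t⟩, h, rfl, rfl⟩
      exact h
  · intro s _ t _ hst
    rw [Function.onFun, Set.disjoint_left]
    rintro q ⟨h1, h2⟩ ⟨h3, h4⟩
    simp only [Set.mem_preimage, Set.mem_singleton_iff] at h1 h2 h3 h4
    exact hst (Prod.ext (h1.symm.trans h3) (h2.symm.trans h4))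
  · intro s _
    exact (hp (measurableSet_singleton _)).prod (hp (measurableSet_singleton _))

end Grid

/-! ### Partial mixing on sets and on grids -/

section Mixing

set_option linter.unusedSectionVars false

variable {n : ℕ} {X : Type*} [MeasurableSpace X] [AddAction (Zn n) X]
  [MeasurableConstVAdd (Zn n) X]

variable (n) in
/-- Partial mixing with constant `a`. -/
def PartiallyMixing (μ : Measure X) (a : ℝ) : Prop :=
  ∀ A B : Set X, MeasurableSet A → MeasurableSet B → ∀ ε > 0, ∀ᶠ z : Zn n in cofinite,
    a * μ.real A * μ.real B - ε < μ.real (A ∩ (z +ᵥ ·) ⁻¹' B)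

theorem translate_eq_preimage (z : Zn n) (B : Set X) : translate z B = (-z +ᵥ ·) ⁻¹' B := by
  ext x
  simp only [translate, Set.mem_image, Set.mem_preimage]
  constructor
  · rintro ⟨y, hy, rfl⟩
    simpa using hy
  · intro h
    exact ⟨_, h, by simp⟩

theorem measurableSet_translate (z : Zn n) {B : Set X} (hB : MeasurableSet B) :
    MeasurableSet (translate z B) := by
  rw [translate_eq_preimage]
  exact measurable_const_vadd _ hB

theorem partiallyMixing_of_liminf {μ : Measure X} [IsFiniteMeasure μ] {a : ℝ} (ha : 0 ≤ a)
    (h : ∀ A B : Set X, MeasurableSet A → MeasurableSet B →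
      ENNReal.ofReal a * μ A * μ B ≤ liminf (fun z : Zn n => μ (A ∩ translate z B)) cofinite) :
    PartiallyMixing n μ a := by
  intro A B hA hB ε hε
  have h1 : ∀ᶠ z : Zn n in cofinite,
      a * μ.real A * μ.real B - ε < μ.real (A ∩ translate z B) := by
    have h0 : ENNReal.ofReal a * μ A * μ B = ENNReal.ofReal (a * μ.real A * μ.real B) := by
      rw [ENNReal.ofReal_mul (by positivity), ENNReal.ofReal_mul ha]
      simp [Measure.real]
    by_cases hneg : a * μ.real A * μ.real B - ε < 0
    · exact Eventually.of_forall fun z => hneg.trans_le measureReal_nonneg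
    push Not at hneg
    have h2 : ENNReal.ofReal (a * μ.real A * μ.real B - ε) <
        liminf (fun z : Zn n => μ (A ∩ translate z B)) cofinite := by
      refine lt_of_lt_of_le ?_ (h A B hA hB)
      rw [h0]
      exact (ENNReal.ofReal_lt_ofReal_iff (by linarith)).2 (by linarith)
    filter_upwards [eventually_lt_of_lt_liminf h2] with z hz
    exact (ENNReal.ofReal_lt_iff_lt_toReal hneg (measure_ne_top _ _)).1 hz
  -- `T^z B` is the preimage of `B` under `T^{-z}`; the cofinite filter does not see the sign.
  have h2 : Tendsto (fun z : Zn n => -z) cofinite cofinite := neg_injective.tendsto_cofinite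
  filter_upwards [h2.eventually h1] with z hz
  rwa [translate_eq_preimage, neg_neg] at hz

/-- Partial mixing is applied to each of the finitely many cells, with the error divided equally.
The cofinite exceptional set depends on `R`, so finitely many `z` need a separate argument later. -/
theorem PartiallyMixing.eventually_grid {μ : Measure X} [IsProbabilityMeasure μ] {a : ℝ}
    (h : PartiallyMixing n μ a) {R : Set (X × X)} (hR : IsGrid R) {ε : ℝ} (hε : 0 < ε) :
    ∀ᶠ z : Zn n in cofinite, a * (μ.prod μ).real R - ε < (shift z (diagonal μ)).real R := by
  classical
  obtain ⟨N, p, S, hp, rfl⟩ := hR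
  have hm : ∀ z : Zn n, Measurable fun x : X => (x, z +ᵥ x) := fun z =>
    measurable_id.prodMk (measurable_const_vadd z)
  have hsh : ∀ z : Zn n, shift z (diagonal μ) = μ.map fun x => (x, z +ᵥ x) := fun z => by
    rw [shift, diagonal, Measure.map_map]
    · rfl
    · exact measurable_fst.prodMk ((measurable_const_vadd z).comp measurable_snd)
    · exact measurable_id.prodMk measurable_id
  have key : ∀ᶠ z : Zn n in cofinite, ∀ s ∈ S.toFinset,
      a * μ.real (p ⁻¹' {s.1}) * μ.real (p ⁻¹' {s.2}) - ε / (S.toFinset.card + 1) <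
        μ.real (p ⁻¹' {s.1} ∩ (z +ᵥ ·) ⁻¹' (p ⁻¹' {s.2})) := by
    rw [eventually_all_finset]
    intro s _
    exact h _ _ (hp (measurableSet_singleton _)) (hp (measurableSet_singleton _)) _ (by positivity)
  filter_upwards [key] with z hz
  rw [hsh]
  have : IsFiniteMeasure (μ.map fun x => (x, z +ᵥ x)) := Measure.isFiniteMeasure_map _ _
  rw [measureReal_grid _ hp, measureReal_grid _ hp, Finset.mul_sum]
  have h1 : ∑ s ∈ S.toFinset, (a * μ.real (p ⁻¹' {s.1}) * μ.real (p ⁻¹' {s.2}) -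
      ε / (S.toFinset.card + 1)) ≤
      ∑ s ∈ S.toFinset, μ.real (p ⁻¹' {s.1} ∩ (z +ᵥ ·) ⁻¹' (p ⁻¹' {s.2})) :=
    Finset.sum_le_sum fun s hs => (hz s hs).le
  rw [Finset.sum_sub_distrib, Finset.sum_const, nsmul_eq_mul] at h1
  have h2 : (S.toFinset.card : ℝ) * (ε / (S.toFinset.card + 1)) < ε := by
    rw [mul_div_assoc', div_lt_iff₀ (by positivity)]
    nlinarith
  have h3 : ∀ s ∈ S.toFinset, (μ.map fun x => (x, z +ᵥ x)).real
      ((p ⁻¹' {s.1}) ×ˢ (p ⁻¹' {s.2})) =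
      μ.real (p ⁻¹' {s.1} ∩ (z +ᵥ ·) ⁻¹' (p ⁻¹' {s.2})) := fun s _ => by
    rw [map_measureReal_apply (hm z) ((hp (measurableSet_singleton _)).prod
      (hp (measurableSet_singleton _)))]
    rfl
  rw [Finset.sum_congr rfl h3]
  have h4 : ∀ s ∈ S.toFinset, a * (μ.prod μ).real ((p ⁻¹' {s.1}) ×ˢ (p ⁻¹' {s.2})) =
      a * μ.real (p ⁻¹' {s.1}) * μ.real (p ⁻¹' {s.2}) := fun s _ => by
    rw [measureReal_prod_prod, mul_assoc]
  rw [Finset.sum_congr rfl h4]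
  linarith

end Mixing

instance measurableConstVAddProd {G α β : Type*} [VAdd G α] [VAdd G β] [MeasurableSpace α]
    [MeasurableSpace β] [MeasurableConstVAdd G α] [MeasurableConstVAdd G β] :
    MeasurableConstVAdd G (α × β) :=
  ⟨fun g => ((measurable_const_vadd g).comp measurable_fst).prodMk
    ((measurable_const_vadd g).comp measurable_snd)⟩

/-! ### Weak mixing from partial mixing -/

section WeakMixing

variable {n : ℕ} {X : Type*} [MeasurableSpace X] [AddAction (Zn n) X]
  [MeasurableConstVAdd (Zn n) X]

instance vaddInvariantMeasureProd (μ : Measure X) [SFinite μ] [VAddInvariantMeasure (Zn n) X μ] :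
    VAddInvariantMeasure (Zn n) (X × X) (μ.prod μ) :=
  vaddInvariantMeasure_of_map fun g =>
    ((measurePreserving_vadd g μ).prod (measurePreserving_vadd g μ)).map_eq

theorem neBot_cofinite (hn : 1 ≤ n) : (cofinite : Filter (Zn n)).NeBot := by
  have : Nonempty (Fin n) := ⟨⟨0, hn⟩⟩
  infer_instance

theorem mul_lower_bound {x y p q δ : ℝ} (hx : p - δ ≤ x) (hy : q - δ ≤ y) (hx0 : 0 ≤ x)
    (hx1 : x ≤ 1) (hq0 : 0 ≤ q) (hq1 : q ≤ 1) (hδ : 0 ≤ δ) : p * q - 2 * δ ≤ x * y := by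
  nlinarith [mul_le_mul_of_nonneg_left hy hx0, mul_le_mul_of_nonneg_right hx hq0,
    mul_le_mul_of_nonneg_right hx1 hδ, mul_le_mul_of_nonneg_right hq1 hδ]

/-- The product action is partially mixing with constant `a ^ 2`: the set is a disjoint union of
rectangles recording the cells of `q` and of `z +ᵥ q`, and each rectangle has measure a product of
two factors controlled by partial mixing. -/
theorem PartiallyMixing.exists_grid {μ : Measure X} [IsProbabilityMeasure μ] (hn : 1 ≤ n) {a : ℝ}
    (ha : 0 ≤ a) (ha1 : a ≤ 1) (h : PartiallyMixing n μ a) {R : Set (X × X)} (hR : IsGrid R)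
    {ε : ℝ} (hε : 0 < ε) :
    ∃ z : Zn n, a ^ 2 * ((μ.prod μ).real R * (μ.prod μ).real Rᶜ) - ε ≤
      (μ.prod μ).real (R ∩ (z +ᵥ ·) ⁻¹' Rᶜ) := by
  classical
  obtain ⟨N, p, S, hp, rfl⟩ := hR
  set A : Fin N → Set X := fun s => p ⁻¹' {s} with hA
  have hAm : ∀ s, MeasurableSet (A s) := fun s => hp (measurableSet_singleton _)
  set δ : ℝ := ε / (2 * ((S.toFinset ×ˢ Sᶜ.toFinset).card + 1)) with hδ
  have hδ0 : 0 < δ := by positivity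
  have key : ∀ᶠ z : Zn n in cofinite, ∀ q : Fin N × Fin N,
      a * μ.real (A q.1) * μ.real (A q.2) - δ < μ.real (A q.1 ∩ (z +ᵥ ·) ⁻¹' (A q.2)) := by
    rw [eventually_all]
    exact fun q => h _ _ (hAm _) (hAm _) _ hδ0
  have := neBot_cofinite hn
  obtain ⟨z, hz⟩ := key.exists
  refine ⟨z, ?_⟩
  have hset : {q : X × X | (p q.1, p q.2) ∈ S} ∩ (z +ᵥ ·) ⁻¹' {q : X × X | (p q.1, p q.2) ∈ S}ᶜ =
      ⋃ u ∈ S.toFinset ×ˢ Sᶜ.toFinset,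
        (A u.1.1 ∩ (z +ᵥ ·) ⁻¹' (A u.2.1)) ×ˢ (A u.1.2 ∩ (z +ᵥ ·) ⁻¹' (A u.2.2)) := by
    ext q
    simp only [hA, Set.mem_inter_iff, Set.mem_preimage, Set.mem_compl_iff, Set.mem_ofPred_eq,
      Set.mem_iUnion, Set.mem_prod, Finset.mem_product, Set.mem_toFinset, exists_prop,
      Set.mem_singleton_iff]
    constructor
    · intro ⟨h1, h2⟩
      exact ⟨((p q.1, p q.2), (p (z +ᵥ q.1), p (z +ᵥ q.2))), ⟨h1, h2⟩, ⟨rfl, rfl⟩, rfl, rfl⟩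
    · rintro ⟨⟨⟨s, t⟩, s', t'⟩, ⟨h1, h2⟩, ⟨rfl, rfl⟩, rfl, rfl⟩
      exact ⟨h1, h2⟩
  rw [hset, measureReal_biUnion_finset]
  rotate_left
  · intro u _ v _ huv
    rw [Function.onFun, Set.disjoint_left]
    rintro q ⟨⟨h1, h2⟩, h3, h4⟩ ⟨⟨h5, h6⟩, h7, h8⟩
    simp only [hA, Set.mem_preimage, Set.mem_singleton_iff] at h1 h2 h3 h4 h5 h6 h7 h8
    exact huv (Prod.ext (Prod.ext (h1.symm.trans h5) (h3.symm.trans h7))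
      (Prod.ext (h2.symm.trans h6) (h4.symm.trans h8)))
  · intro u _
    exact ((hAm _).inter (measurable_const_vadd z (hAm _))).prod
      ((hAm _).inter (measurable_const_vadd z (hAm _)))
  have hcompl : {q : X × X | (p q.1, p q.2) ∈ S}ᶜ = {q : X × X | (p q.1, p q.2) ∈ Sᶜ} := rfl
  rw [hcompl, measureReal_grid _ hp, measureReal_grid _ hp, Finset.sum_mul_sum,
    ← Finset.sum_product', Finset.mul_sum]
  have hle : ∀ u ∈ S.toFinset ×ˢ Sᶜ.toFinset,
      a ^ 2 * ((μ.prod μ).real ((p ⁻¹' {u.1.1}) ×ˢ (p ⁻¹' {u.1.2})) *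
        (μ.prod μ).real ((p ⁻¹' {u.2.1}) ×ˢ (p ⁻¹' {u.2.2}))) - 2 * δ ≤
      (μ.prod μ).real ((A u.1.1 ∩ (z +ᵥ ·) ⁻¹' (A u.2.1)) ×ˢ
        (A u.1.2 ∩ (z +ᵥ ·) ⁻¹' (A u.2.2))) := by
    intro u _
    rw [measureReal_prod_prod, measureReal_prod_prod, measureReal_prod_prod]
    have := mul_lower_bound (hz (u.1.1, u.2.1)).le (hz (u.1.2, u.2.2)).le measureReal_nonneg
      measureReal_le_one (by positivity)
      (mul_le_one₀ (mul_le_one₀ ha1 measureReal_nonneg measureReal_le_one) measureReal_nonneg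
        measureReal_le_one) hδ0.le
    refine le_trans (le_of_eq ?_) this
    simp only [hA]
    ring
  have hsum := Finset.sum_le_sum hle
  rw [Finset.sum_sub_distrib, Finset.sum_const, nsmul_eq_mul] at hsum
  have h2 : ((S.toFinset ×ˢ Sᶜ.toFinset).card : ℝ) * (2 * δ) ≤ ε := by
    have : 2 * δ = ε / ((S.toFinset ×ˢ Sᶜ.toFinset).card + 1) := by rw [hδ]; field_simp
    rw [this, mul_div_assoc', div_le_iff₀ (by positivity)]
    nlinarith
  refine (le_of_eq ?_).trans ((sub_le_sub_left h2 _).trans hsum)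
  congr!

/-- Partially mixing actions are weakly mixing. -/
theorem PartiallyMixing.ergodic_prod {μ : Measure X} [IsProbabilityMeasure μ]
    [VAddInvariantMeasure (Zn n) X μ] (hn : 1 ≤ n) {a : ℝ} (ha : 0 < a) (ha1 : a ≤ 1)
    (h : PartiallyMixing n μ a) : ErgodicVAdd (Zn n) (X × X) (μ.prod μ) := by
  refine ⟨fun {E} hE hinv => ?_⟩
  set θ := μ.prod μ
  by_contra hcon
  have h1 : 0 < θ.real E := by
    refine ENNReal.toReal_pos (fun h0 => hcon ?_) (by finiteness)
    rw [eventuallyConst_set]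
    exact Or.inr (measure_eq_zero_iff_ae_notMem.1 h0)
  have h2 : 0 < θ.real Eᶜ := by
    refine ENNReal.toReal_pos (fun h0 => hcon ?_) (by finiteness)
    rw [eventuallyConst_set]
    exact Or.inl (mem_ae_iff.2 h0)
  -- A grid within `c / 8` of `E` is almost invariant, so at most `c / 4` leaves it under `z`.
  -- Mixing forces at least `c - c / 4 - c / 8` to leave.
  set c := a ^ 2 * (θ.real E * θ.real Eᶜ) with hc
  have hc0 : 0 < c := by positivity
  obtain ⟨R, hR, hRE⟩ := exists_isGrid_symmDiff_lt θ hE (ε := c / 8) (by positivity)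
  obtain ⟨z, hz⟩ := h.exists_grid hn ha.le ha1 hR (ε := c / 8) (by positivity)
  have hinv0 : θ.real (E ∩ (z +ᵥ ·) ⁻¹' Eᶜ) = 0 := by
    have : θ (E \ (z +ᵥ ·) ⁻¹' E) = 0 := ae_le_set.1 (hinv z).symm.le
    rw [Measure.real, Set.preimage_compl, ← Set.sdiff_eq, this]
    rfl
  have hup : θ.real (R ∩ (z +ᵥ ·) ⁻¹' Rᶜ) ≤ c / 4 := by
    calc θ.real (R ∩ (z +ᵥ ·) ⁻¹' Rᶜ) ≤
        θ.real ((symmDiff R E ∪ (z +ᵥ ·) ⁻¹' (symmDiff R E)) ∪ (E ∩ (z +ᵥ ·) ⁻¹' Eᶜ)) := by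
          refine measureReal_mono ?_
          rintro q ⟨hq1, hq2⟩
          by_cases hqE : q ∈ E
          · by_cases hqE' : (z +ᵥ q) ∈ E
            · exact Or.inl (Or.inr (Or.inr ⟨hqE', hq2⟩))
            · exact Or.inr ⟨hqE, hqE'⟩
          · exact Or.inl (Or.inl (Or.inl ⟨hq1, hqE⟩))
      _ ≤ (θ.real (symmDiff R E) + θ.real ((z +ᵥ ·) ⁻¹' (symmDiff R E))) +
          θ.real (E ∩ (z +ᵥ ·) ⁻¹' Eᶜ) :=
        (measureReal_union_le _ _).trans (by gcongr; exact measureReal_union_le _ _)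
      _ ≤ c / 4 := by
        rw [hinv0]
        have : θ.real ((z +ᵥ ·) ⁻¹' (symmDiff R E)) = θ.real (symmDiff R E) := by
          simp only [Measure.real, measure_preimage_vadd]
        rw [this]; linarith
  have h3 : |θ.real R - θ.real E| ≤ c / 8 := by
    refine (abs_measureReal_sub_le_measureReal_symmDiff hR.measurableSet.nullMeasurableSet
      hE.nullMeasurableSet).trans hRE.le
  have h4 : |θ.real Rᶜ - θ.real Eᶜ| ≤ c / 8 := by
    rw [probReal_compl_eq_one_sub hR.measurableSet, probReal_compl_eq_one_sub hE, abs_sub_comm]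
    simpa using h3
  have h5 := mul_lower_bound (by linarith [(abs_le.1 h3).1] :
    θ.real E - c / 8 ≤ θ.real R) (by linarith [(abs_le.1 h4).1] :
    θ.real Eᶜ - c / 8 ≤ θ.real Rᶜ) measureReal_nonneg measureReal_le_one measureReal_nonneg
    measureReal_le_one (by positivity) (p := θ.real E)
  have h6 : a ^ 2 ≤ 1 := by nlinarith
  have h7 : a ^ 2 * (θ.real E * θ.real Eᶜ - 2 * (c / 8)) ≤ a ^ 2 * (θ.real R * θ.real Rᶜ) :=
    mul_le_mul_of_nonneg_left h5 (by positivity)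
  nlinarith

theorem PartiallyMixing.ergodic {μ : Measure X} [IsProbabilityMeasure μ]
    [VAddInvariantMeasure (Zn n) X μ] (hn : 1 ≤ n) {a : ℝ} (ha : 0 < a) (ha1 : a ≤ 1)
    (h : PartiallyMixing n μ a) : ErgodicVAdd (Zn n) X μ := by
  have := h.ergodic_prod hn ha ha1
  have h1 := ergodicVAdd_map (Zn n) (μ := μ.prod μ) measurable_fst fun g q => rfl
  rwa [← Measure.fst, Measure.fst_prod] at h1

end WeakMixing

/-! ### Rectangles in `ℤⁿ` and their overlaps under small shifts -/

section Boxes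

variable {n : ℕ}

/-- The rectangle as a finite set. -/
def boxFinset (h : Fin n → ℕ) : Finset (Zn n) := Fintype.piFinset fun i => Finset.Ico 0 (h i : ℤ)

theorem mem_boxFinset {h : Fin n → ℕ} {z : Zn n} : z ∈ boxFinset h ↔ z ∈ box h := by
  simp [boxFinset, box]

/-- The part of the rectangle that stays inside when shifted by `k`. -/
def overlap (h : Fin n → ℕ) (k : Zn n) : Finset (Zn n) :=
  (boxFinset h).filter fun z => z + k ∈ boxFinset h

theorem mem_overlap {h : Fin n → ℕ} {k z : Zn n} :
    z ∈ overlap h k ↔ z ∈ box h ∧ z + k ∈ box h := by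
  simp [overlap, mem_boxFinset]

/-- The vectors that are `M` times shorter than the rectangle. -/
def smallVectors (M : ℕ) (h : Fin n → ℕ) : Finset (Zn n) :=
  (Fintype.piFinset fun i => Finset.Icc (-(h i : ℤ)) (h i)).filter fun k => ∀ i, |k i| * M ≤ h i

theorem mem_smallVectors {M : ℕ} (hM : 1 ≤ M) {h : Fin n → ℕ} {k : Zn n} :
    k ∈ smallVectors M h ↔ ∀ i, |k i| * M ≤ h i := by
  simp only [smallVectors, Finset.mem_filter, Fintype.mem_piFinset, Finset.mem_Icc,
    and_iff_right_iff_imp]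
  intro hk i
  have h1 : |k i| ≤ h i := by
    have := hk i
    have h2 : |k i| * 1 ≤ |k i| * M := by gcongr; exact_mod_cast hM
    linarith
  exact abs_le.1 h1

/-- In each coordinate an interval of length `h i` meets its shift by `k i` in at least `h i - |k i|
≥ (1 - 1/M) h i` points; the bound is the product over coordinates. -/
theorem card_overlap_ge {M : ℕ} (hM : 1 ≤ M) {h : Fin n → ℕ} {k : Zn n}
    (hk : k ∈ smallVectors M h) :
    (1 - 1 / (M : ℝ)) ^ n * (boxFinset h).card ≤ (overlap h k).card := by
  rw [mem_smallVectors hM] at hk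
  have hsub : (Fintype.piFinset fun i => Finset.Ico (max 0 (-k i)) (min (h i : ℤ) (h i - k i))) ⊆
      overlap h k := by
    intro z hz
    simp only [Fintype.mem_piFinset, Finset.mem_Ico] at hz
    rw [mem_overlap]
    refine ⟨fun i => ?_, fun i => ?_⟩
    · have := hz i
      omega
    · have := hz i
      simp only [Pi.add_apply]
      omega
  have h1 : ((Fintype.piFinset fun i =>
      Finset.Ico (max 0 (-k i)) (min (h i : ℤ) (h i - k i))).card : ℝ) ≤ (overlap h k).card := by
    exact_mod_cast Finset.card_le_card hsub
  refine le_trans ?_ h1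
  have h0 : (1 - 1 / (M : ℝ)) ^ n = ∏ _i : Fin n, (1 - 1 / (M : ℝ)) := by simp
  rw [boxFinset, Fintype.card_piFinset, Fintype.card_piFinset, Nat.cast_prod, Nat.cast_prod, h0,
    ← Finset.prod_mul_distrib]
  have hM0 : (0 : ℝ) < M := by exact_mod_cast hM
  have hM1 : (1 : ℝ) ≤ M := by exact_mod_cast hM
  refine Finset.prod_le_prod (fun i _ => ?_) fun i _ => ?_
  · have : 1 / (M : ℝ) ≤ 1 := by rw [div_le_one hM0]; exact hM1
    have : (0 : ℝ) ≤ 1 - 1 / M := by linarith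
    positivity
  · simp only [Int.card_Ico]
    have h2 : ((h i : ℤ) - |k i| : ℤ) ≤
        ((min (h i : ℤ) (h i - k i) - max 0 (-k i)).toNat : ℤ) := by
      rcases abs_cases (k i) with ⟨h3, h4⟩ | ⟨h3, h4⟩ <;> omega
    have h3 : ((h i : ℝ) - |(k i : ℝ)|) ≤
        ((min (h i : ℤ) (h i - k i) - max 0 (-k i)).toNat : ℝ) := by exact_mod_cast h2
    refine le_trans ?_ h3
    have h4 : |(k i : ℝ)| * M ≤ h i := by exact_mod_cast hk i
    have h5 : |(k i : ℝ)| ≤ 1 / M * h i := by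
      rw [one_div, inv_mul_eq_div, le_div_iff₀ hM0]
      exact h4
    simp only [sub_zero, Int.toNat_natCast]
    linarith

end Boxes

/-! ### Towers, strips of close levels, and joinings on them -/

section Towers

set_option linter.unusedSectionVars false

variable {n : ℕ} {X : Type*} [MeasurableSpace X] [AddAction (Zn n) X]
  [MeasurableConstVAdd (Zn n) X]

namespace TowerPartition

/-- The levels of a tower. -/
def level (ξ : TowerPartition n X) (z : Zn n) : Set X := translate z ξ.base

theorem measurableSet_level (ξ : TowerPartition n X) (z : Zn n) : MeasurableSet (ξ.level z) :=
  measurableSet_translate z ξ.measurableSet_base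

theorem mem_level {ξ : TowerPartition n X} {z : Zn n} {x : X} :
    x ∈ ξ.level z ↔ -z +ᵥ x ∈ ξ.base := by
  rw [level, translate_eq_preimage]; rfl

theorem vadd_mem_level {ξ : TowerPartition n X} {z k : Zn n} {x : X} (hx : x ∈ ξ.level z) :
    k +ᵥ x ∈ ξ.level (z + k) := by
  rw [mem_level] at hx ⊢
  rw [vadd_vadd]
  simpa using hx

theorem pairwise_disjoint_level (ξ : TowerPartition n X) :
    (box ξ.height).PairwiseDisjoint ξ.level :=
  fun z hz w hw hzw => ξ.levels_disjoint z hz w hw hzw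

theorem tower_eq (ξ : TowerPartition n X) : ξ.tower = ⋃ z ∈ boxFinset ξ.height, ξ.level z := by
  simp only [tower, mem_boxFinset]; rfl

/-- The points of the tower that stay in it when moved by `k`. -/
def core (ξ : TowerPartition n X) (k : Zn n) : Set X := ⋃ z ∈ overlap ξ.height k, ξ.level z

/-- The union of the products of close levels. -/
def strip (ξ : TowerPartition n X) (M : ℕ) : Set (X × X) :=
  ⋃ q ∈ (smallVectors M ξ.height).sigma (overlap ξ.height), ξ.level q.2 ×ˢ ξ.level (q.2 + q.1)

theorem measurableSet_strip (ξ : TowerPartition n X) (M : ℕ) : MeasurableSet (ξ.strip M) :=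
  Finset.measurableSet_biUnion _ fun q _ =>
    (ξ.measurableSet_level q.2).prod (ξ.measurableSet_level _)

theorem mem_strip {ξ : TowerPartition n X} {M : ℕ} (hM : 1 ≤ M) {z w : Zn n}
    (hz : z ∈ box ξ.height) (hw : w ∈ box ξ.height) (h : ∀ i, |w i - z i| * M ≤ ξ.height i)
    {x y : X} (hx : x ∈ ξ.level z) (hy : y ∈ ξ.level w) : (x, y) ∈ ξ.strip M := by
  simp only [strip, Set.mem_iUnion, Finset.mem_sigma, exists_prop]
  refine ⟨⟨w - z, z⟩, ⟨(mem_smallVectors hM).2 h, mem_overlap.2 ⟨hz, ?_⟩⟩, hx, ?_⟩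
  · simpa using hw
  · simpa using hy

theorem strip_disjoint (ξ : TowerPartition n X) (M : ℕ) :
    (((smallVectors M ξ.height).sigma (overlap ξ.height) : Finset (Σ _ : Zn n, Zn n)) :
      Set (Σ _ : Zn n, Zn n)).PairwiseDisjoint
      fun q => ξ.level q.2 ×ˢ ξ.level (q.2 + q.1) := by
  rintro ⟨k, z⟩ h1 ⟨k', z'⟩ h2 hne
  simp only [Finset.coe_sigma, Set.mem_sigma_iff, Finset.mem_coe, mem_overlap] at h1 h2
  rw [Function.onFun, Set.disjoint_prod]
  by_cases hz : z = z'
  · subst hz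
    right
    refine ξ.pairwise_disjoint_level h1.2.2 h2.2.2 fun h => hne ?_
    have := add_left_cancel h
    subst this
    rfl
  · exact Or.inl (ξ.pairwise_disjoint_level h1.2.1 h2.2.1 hz)

theorem IsPartitionSet.measurableSet {ξ : TowerPartition n X} {A : Set X}
    (hA : ξ.IsPartitionSet A) : MeasurableSet A := by
  obtain ⟨L, _, S, rfl⟩ := hA
  exact (MeasurableSet.biUnion (Set.to_countable L) fun z _ => ξ.measurableSet_level z).union
    (MeasurableSet.biUnion (Set.to_countable S) fun i _ => ξ.measurableSet_rest i)

theorem IsPartitionSet.subset_or_disjoint {ξ : TowerPartition n X} {A : Set X}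
    (hA : ξ.IsPartitionSet A) {z : Zn n} (hz : z ∈ box ξ.height) :
    ξ.level z ⊆ A ∨ Disjoint (ξ.level z) A := by
  obtain ⟨L, hL, S, rfl⟩ := hA
  by_cases h : z ∈ L
  · exact Or.inl ((Set.subset_biUnion_of_mem (u := ξ.level) h).trans Set.subset_union_left)
  · right
    rw [Set.disjoint_union_right, Set.disjoint_iUnion₂_right, Set.disjoint_iUnion₂_right]
    refine ⟨fun w hw => ξ.pairwise_disjoint_level hz (hL hw) ?_,
      fun i _ => ξ.levels_rest_disjoint z hz i⟩
    rintro rfl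
    exact h hw

theorem measureReal_level (ξ : TowerPartition n X) (μ : Measure X)
    [VAddInvariantMeasure (Zn n) X μ] (z : Zn n) : μ.real (ξ.level z) = μ.real ξ.base := by
  rw [level, translate_eq_preimage, Measure.real, Measure.real, measure_preimage_vadd]

theorem measureReal_core_inter (ξ : TowerPartition n X) (μ : Measure X) [IsFiniteMeasure μ]
    (k : Zn n) {G : Set X} (hG : MeasurableSet G) :
    μ.real (ξ.core k ∩ G) = ∑ z ∈ overlap ξ.height k, μ.real (ξ.level z ∩ G) := by
  rw [core, Set.iUnion₂_inter, measureReal_biUnion_finset]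
  · intro z hz w hw hzw
    exact (ξ.pairwise_disjoint_level (mem_overlap.1 hz).1 (mem_overlap.1 hw).1 hzw).mono
      Set.inter_subset_left Set.inter_subset_left
  · exact fun z _ => (ξ.measurableSet_level z).inter hG

theorem measureReal_core (ξ : TowerPartition n X) (μ : Measure X) [IsFiniteMeasure μ]
    [VAddInvariantMeasure (Zn n) X μ] (k : Zn n) :
    μ.real (ξ.core k) = (overlap ξ.height k).card * μ.real ξ.base := by
  have := ξ.measureReal_core_inter μ k MeasurableSet.univ
  simpa [measureReal_level] using this

theorem measureReal_tower (ξ : TowerPartition n X) (μ : Measure X) [IsFiniteMeasure μ]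
    [VAddInvariantMeasure (Zn n) X μ] :
    μ.real ξ.tower = (boxFinset ξ.height).card * μ.real ξ.base := by
  rw [tower_eq, measureReal_biUnion_finset]
  · simp [measureReal_level]
  · exact fun z hz w hw hzw =>
      ξ.pairwise_disjoint_level (mem_boxFinset.1 hz) (mem_boxFinset.1 hw) hzw
  · exact fun z _ => ξ.measurableSet_level z

theorem measureReal_core_ge (ξ : TowerPartition n X) (μ : Measure X) [IsFiniteMeasure μ]
    [VAddInvariantMeasure (Zn n) X μ] {M : ℕ} (hM : 1 ≤ M) {k : Zn n}
    (hk : k ∈ smallVectors M ξ.height) :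
    (1 - 1 / (M : ℝ)) ^ n * μ.real ξ.tower ≤ μ.real (ξ.core k) := by
  rw [measureReal_core, measureReal_tower, ← mul_assoc]
  exact mul_le_mul_of_nonneg_right (card_overlap_ge hM hk) measureReal_nonneg

/-- The density of a joining on the products of levels that differ by `k`. -/
def coef (ξ : TowerPartition n X) (μ : Measure X) (ν : Measure (X × X)) (k : Zn n) : ℝ :=
  ν.real (ξ.base ×ˢ ξ.level k) / μ.real ξ.base

theorem coef_nonneg (ξ : TowerPartition n X) (μ : Measure X) (ν : Measure (X × X)) (k : Zn n) :
    0 ≤ ξ.coef μ ν k := by unfold coef; positivity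

/-- Invariance of `ν` under the diagonal action moves the base to level `z`, so the mass depends
only on the difference `k`. It is `coef` times the mass that `(Id × T^k)Δ` gives to the same
product. -/
theorem coef_mul (ξ : TowerPartition n X) {μ : Measure X} (ν : Measure (X × X))
    [VAddInvariantMeasure (Zn n) (X × X) ν] (h : μ.real ξ.base ≠ 0) (z k : Zn n) :
    ν.real (ξ.level z ×ˢ ξ.level (z + k)) = ξ.coef μ ν k * μ.real ξ.base := by
  rw [coef, div_mul_cancel₀ _ h]
  have : ξ.level z ×ˢ ξ.level (z + k) = (-z +ᵥ ·) ⁻¹' (ξ.base ×ˢ ξ.level k) := by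
    ext q
    simp only [Set.mem_prod, mem_level, Set.mem_preimage]
    rw [neg_add_rev, ← vadd_vadd]
    rfl
  rw [this, Measure.real, Measure.real, measure_preimage_vadd]

/-- The measure `ν` on a rectangle of partition sets, restricted to close levels. -/
theorem measureReal_strip_inter (ξ : TowerPartition n X) {μ : Measure X} [IsFiniteMeasure μ]
    [VAddInvariantMeasure (Zn n) X μ] (ν : Measure (X × X)) [IsFiniteMeasure ν]
    [VAddInvariantMeasure (Zn n) (X × X) ν] (h : μ.real ξ.base ≠ 0) (M : ℕ) {A C : Set X}
    (hA : ξ.IsPartitionSet A) (hC : ξ.IsPartitionSet C) :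
    ν.real (ξ.strip M ∩ A ×ˢ C) = ∑ k ∈ smallVectors M ξ.height,
      ξ.coef μ ν k * μ.real (ξ.core k ∩ (A ∩ (k +ᵥ ·) ⁻¹' C)) := by
  rw [strip, Set.iUnion₂_inter, measureReal_biUnion_finset, Finset.sum_sigma]
  rotate_left
  · exact fun q hq r hr hqr => (ξ.strip_disjoint M hq hr hqr).mono
      Set.inter_subset_left Set.inter_subset_left
  · exact fun q _ => ((ξ.measurableSet_level q.2).prod (ξ.measurableSet_level _)).inter
      (hA.measurableSet.prod hC.measurableSet)
  refine Finset.sum_congr rfl fun k _ => ?_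
  rw [ξ.measureReal_core_inter μ k
    (hA.measurableSet.inter (measurable_const_vadd k hC.measurableSet)), Finset.mul_sum]
  refine Finset.sum_congr rfl fun z hz => ?_
  rw [mem_overlap] at hz
  simp only [Set.prod_inter_prod]
  -- A level is contained in or disjoint from a partition set, so on each product of levels both
  -- sides are full or zero; this is why the formula is exact.
  rcases hA.subset_or_disjoint hz.1 with h1 | h1
  · rcases hC.subset_or_disjoint hz.2 with h2 | h2
    · have h3 : ξ.level z ∩ (A ∩ (k +ᵥ ·) ⁻¹' C) = ξ.level z :=
        Set.inter_eq_left.2 fun x hx => ⟨h1 hx, h2 (vadd_mem_level hx)⟩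
      rw [Set.inter_eq_left.2 h1, Set.inter_eq_left.2 h2, h3, measureReal_level,
        ξ.coef_mul ν h]
    · have h3 : ξ.level z ∩ (A ∩ (k +ᵥ ·) ⁻¹' C) = ∅ := by
        ext x
        simp only [Set.mem_inter_iff, Set.mem_preimage, Set.mem_empty_iff_false, iff_false]
        rintro ⟨hx, _, hx'⟩
        exact Set.disjoint_left.1 h2 (vadd_mem_level hx) hx'
      rw [h2.inter_eq, h3]
      simp
  · have h3 : ξ.level z ∩ (A ∩ (k +ᵥ ·) ⁻¹' C) = ∅ := by
      rw [← Set.inter_assoc, h1.inter_eq, Set.empty_inter]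
    rw [h1.inter_eq, h3]
    simp

theorem isPartitionSet_univ (ξ : TowerPartition n X) : ξ.IsPartitionSet Set.univ :=
  ⟨box ξ.height, subset_rfl, Set.univ, by simpa using ξ.cover.symm⟩

theorem measureReal_strip (ξ : TowerPartition n X) {μ : Measure X} [IsFiniteMeasure μ]
    [VAddInvariantMeasure (Zn n) X μ] (ν : Measure (X × X)) [IsFiniteMeasure ν]
    [VAddInvariantMeasure (Zn n) (X × X) ν] (h : μ.real ξ.base ≠ 0) (M : ℕ) :
    ν.real (ξ.strip M) = ∑ k ∈ smallVectors M ξ.height, ξ.coef μ ν k * μ.real (ξ.core k) := by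
  simpa using ξ.measureReal_strip_inter ν h M ξ.isPartitionSet_univ ξ.isPartitionSet_univ

end TowerPartition

end Towers

/-! ### Domination of restricted off-diagonal measures by the joining -/

section Strips

set_option linter.unusedSectionVars false

variable {n : ℕ} {X : Type*} [MeasurableSpace X] [AddAction (Zn n) X]
  [MeasurableConstVAdd (Zn n) X]

theorem shift_diagonal (μ : Measure X) (z : Zn n) :
    shift z (diagonal μ) = μ.map fun x => (x, z +ᵥ x) := by
  rw [shift, diagonal, Measure.map_map]
  · rfl
  · exact measurable_fst.prodMk ((measurable_const_vadd z).comp measurable_snd)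
  · exact measurable_id.prodMk measurable_id

theorem measurable_graph (z : Zn n) : Measurable fun x : X => (x, z +ᵥ x) :=
  measurable_id.prodMk (measurable_const_vadd z)

namespace TowerPartition

/-- On grids that are approximated by partition sets, the off-diagonal parts are almost dominated
by the joining. -/
theorem sum_coef_mul_le (ξ : TowerPartition n X) {μ : Measure X} [IsProbabilityMeasure μ]
    [VAddInvariantMeasure (Zn n) X μ] (ν : Measure (X × X)) [IsProbabilityMeasure ν]
    [VAddInvariantMeasure (Zn n) (X × X) ν] (h1 : ν.map Prod.fst = μ) (h2 : ν.map Prod.snd = μ)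
    (h : μ.real ξ.base ≠ 0) (M : ℕ) {N : ℕ} {p : X → Fin N} (hp : Measurable p)
    (S : Set (Fin N × Fin N)) {A : Fin N → Set X} (hA : ∀ s, ξ.IsPartitionSet (A s)) {e : ℝ}
    (he : ∀ s, μ.real (symmDiff (p ⁻¹' {s}) (A s)) ≤ e) (he0 : 0 ≤ e) :
    ∑ k ∈ smallVectors M ξ.height, ξ.coef μ ν k *
        μ.real (ξ.core k ∩ {x | (p x, p (k +ᵥ x)) ∈ S}) ≤
      ν.real {q | (p q.1, p q.2) ∈ S} +
        N ^ 2 * ((1 + ∑ k ∈ smallVectors M ξ.height, ξ.coef μ ν k) * (2 * e)) := by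
  classical
  set W := smallVectors M ξ.height
  set B : Fin N → Set X := fun s => p ⁻¹' {s} with hB
  have hBm : ∀ s, MeasurableSet (B s) := fun s => hp (measurableSet_singleton _)
  have hAm : ∀ s, MeasurableSet (A s) := fun s => (hA s).measurableSet
  -- one rectangle, the joining
  have hν : ∀ s t, ν.real (ξ.strip M ∩ A s ×ˢ A t) ≤ ν.real (ξ.strip M ∩ B s ×ˢ B t) + 2 * e := by
    intro s t
    have : ξ.strip M ∩ A s ×ˢ A t ⊆ (ξ.strip M ∩ B s ×ˢ B t) ∪
        ((Prod.fst ⁻¹' (symmDiff (B s) (A s))) ∪ (Prod.snd ⁻¹' (symmDiff (B t) (A t)))) := by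
      rintro ⟨x, y⟩ ⟨hxy, hx, hy⟩
      by_cases hx' : x ∈ B s
      · by_cases hy' : y ∈ B t
        · exact Or.inl ⟨hxy, hx', hy'⟩
        · exact Or.inr (Or.inr (Or.inr ⟨hy, hy'⟩))
      · exact Or.inr (Or.inl (Or.inr ⟨hx, hx'⟩))
    refine (measureReal_mono this).trans ((measureReal_union_le _ _).trans ?_)
    have h3 := measureReal_union_le (μ := ν) (Prod.fst ⁻¹' (symmDiff (B s) (A s)))
      (Prod.snd ⁻¹' (symmDiff (B t) (A t)))
    have h4 : ν.real (Prod.fst ⁻¹' (symmDiff (B s) (A s))) ≤ e := by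
      rw [← map_measureReal_apply measurable_fst ((hBm s).symmDiff (hAm s)), h1]
      exact he s
    have h5 : ν.real (Prod.snd ⁻¹' (symmDiff (B t) (A t))) ≤ e := by
      rw [← map_measureReal_apply measurable_snd ((hBm t).symmDiff (hAm t)), h2]
      exact he t
    linarith
  -- one rectangle, the off-diagonal measures
  have hμ : ∀ s t k, μ.real (ξ.core k ∩ (B s ∩ (k +ᵥ ·) ⁻¹' (B t))) ≤
      μ.real (ξ.core k ∩ (A s ∩ (k +ᵥ ·) ⁻¹' (A t))) + 2 * e := by
    intro s t k
    have : ξ.core k ∩ (B s ∩ (k +ᵥ ·) ⁻¹' (B t)) ⊆ (ξ.core k ∩ (A s ∩ (k +ᵥ ·) ⁻¹' (A t))) ∪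
        (symmDiff (B s) (A s) ∪ (k +ᵥ ·) ⁻¹' (symmDiff (B t) (A t))) := by
      rintro x ⟨hk, hx, hy⟩
      by_cases hx' : x ∈ A s
      · by_cases hy' : k +ᵥ x ∈ A t
        · exact Or.inl ⟨hk, hx', hy'⟩
        · exact Or.inr (Or.inr (Or.inl ⟨hy, hy'⟩))
      · exact Or.inr (Or.inl (Or.inl ⟨hx, hx'⟩))
    refine (measureReal_mono this).trans ((measureReal_union_le _ _).trans ?_)
    have h3 := measureReal_union_le (μ := μ) (symmDiff (B s) (A s))
      ((k +ᵥ ·) ⁻¹' (symmDiff (B t) (A t)))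
    have h5 : μ.real ((k +ᵥ ·) ⁻¹' (symmDiff (B t) (A t))) ≤ e := by
      rw [Measure.real, measure_preimage_vadd]
      exact he t
    linarith [he s]
  have hrect : ∀ s t, ∑ k ∈ W, ξ.coef μ ν k * μ.real (ξ.core k ∩ (B s ∩ (k +ᵥ ·) ⁻¹' (B t))) ≤
      ν.real (ξ.strip M ∩ B s ×ˢ B t) + (1 + ∑ k ∈ W, ξ.coef μ ν k) * (2 * e) := by
    intro s t
    have h3 : ∑ k ∈ W, ξ.coef μ ν k * μ.real (ξ.core k ∩ (B s ∩ (k +ᵥ ·) ⁻¹' (B t))) ≤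
        ∑ k ∈ W, (ξ.coef μ ν k * μ.real (ξ.core k ∩ (A s ∩ (k +ᵥ ·) ⁻¹' (A t))) +
          ξ.coef μ ν k * (2 * e)) := by
      refine Finset.sum_le_sum fun k _ => ?_
      rw [← mul_add]
      exact mul_le_mul_of_nonneg_left (hμ s t k) (ξ.coef_nonneg μ ν k)
    rw [Finset.sum_add_distrib, ← ξ.measureReal_strip_inter ν h M (hA s) (hA t),
      ← Finset.sum_mul] at h3
    linarith [hν s t]
  -- sum over the cells of the grid
  have hsum := Finset.sum_le_sum fun (u : Fin N × Fin N) (_ : u ∈ S.toFinset) => hrect u.1 u.2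
  rw [Finset.sum_comm, Finset.sum_add_distrib, Finset.sum_const, nsmul_eq_mul] at hsum
  have hL : ∀ k, μ.real (ξ.core k ∩ {x | (p x, p (k +ᵥ x)) ∈ S}) =
      ∑ u ∈ S.toFinset, μ.real (ξ.core k ∩ (B u.1 ∩ (k +ᵥ ·) ⁻¹' (B u.2))) := by
    intro k
    have hms : MeasurableSet {x | (p x, p (k +ᵥ x)) ∈ S} :=
      (hp.prodMk (hp.comp (measurable_const_vadd k))) (Set.toFinite S).measurableSet
    have hg := measureReal_grid ((μ.restrict (ξ.core k)).map fun x => (x, k +ᵥ x)) hp S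
    rw [map_measureReal_apply (measurable_graph k)
      (IsGrid.measurableSet ⟨N, p, S, hp, rfl⟩)] at hg
    have h6 : (fun x : X => (x, k +ᵥ x)) ⁻¹' {q | (p q.1, p q.2) ∈ S} =
      {x | (p x, p (k +ᵥ x)) ∈ S} := rfl
    rw [h6, measureReal_restrict_apply hms, Set.inter_comm] at hg
    rw [hg]
    refine Finset.sum_congr (by congr!) fun u _ => ?_
    rw [map_measureReal_apply (measurable_graph k) ((hBm _).prod (hBm _)),
      measureReal_restrict_apply ((measurable_graph k) ((hBm _).prod (hBm _))), Set.inter_comm]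
    rfl
  have hR : ∑ u ∈ S.toFinset, ν.real (ξ.strip M ∩ B u.1 ×ˢ B u.2) ≤
      ν.real {q | (p q.1, p q.2) ∈ S} := by
    have hg := measureReal_grid (ν.restrict (ξ.strip M)) hp S
    have h7 : ∀ u ∈ S.toFinset, ν.real (ξ.strip M ∩ B u.1 ×ˢ B u.2) =
        (ν.restrict (ξ.strip M)).real (B u.1 ×ˢ B u.2) := fun u _ => by
      rw [measureReal_restrict_apply ((hBm _).prod (hBm _)), Set.inter_comm]
    rw [Finset.sum_congr rfl h7]
    refine le_trans (le_of_eq ?_) (measureReal_mono (μ := ν)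
      (Set.inter_subset_left (t := ξ.strip M)))
    rw [← measureReal_restrict_apply (IsGrid.measurableSet ⟨N, p, S, hp, rfl⟩), hg]
  have hcard : (S.toFinset.card : ℝ) ≤ N ^ 2 := by
    have : S.toFinset.card ≤ N * N := by
      simpa using Finset.card_le_univ S.toFinset
    calc (S.toFinset.card : ℝ) ≤ ((N * N : ℕ) : ℝ) := by exact_mod_cast this
      _ = N ^ 2 := by push_cast; ring
  have hfin : ∑ k ∈ W, ξ.coef μ ν k * μ.real (ξ.core k ∩ {x | (p x, p (k +ᵥ x)) ∈ S}) ≤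
      ∑ u ∈ S.toFinset, ν.real (ξ.strip M ∩ B u.1 ×ˢ B u.2) +
        S.toFinset.card * ((1 + ∑ k ∈ W, ξ.coef μ ν k) * (2 * e)) := by
    refine le_trans (le_of_eq (Finset.sum_congr rfl fun k _ => ?_)) hsum
    rw [hL, Finset.mul_sum]
  have hpos : 0 ≤ (1 + ∑ k ∈ W, ξ.coef μ ν k) * (2 * e) := by
    have := Finset.sum_nonneg fun k (_ : k ∈ W) => ξ.coef_nonneg μ ν k
    positivity
  have := mul_le_mul_of_nonneg_right hcard hpos
  linarith

end TowerPartition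

/-- A fixed grid involves finitely many sets, all approximated by partition sets of `ξ j` with
vanishing error. The uniform bound `C` on the total coefficient keeps the accumulated error small
although the number of vectors `k` grows. -/
theorem eventually_sum_coef_le {μ : Measure X} [IsProbabilityMeasure μ]
    [VAddInvariantMeasure (Zn n) X μ] {ν : Measure (X × X)} [IsProbabilityMeasure ν]
    [VAddInvariantMeasure (Zn n) (X × X) ν] (h1 : ν.map Prod.fst = μ) (h2 : ν.map Prod.snd = μ)
    {ξ : ℕ → TowerPartition n X} (hξ : Approximating μ ξ)
    (hbase : ∀ᶠ j in atTop, μ.real (ξ j).base ≠ 0) {M : ℕ} {C : ℝ}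
    (hC : ∀ᶠ j in atTop, ∑ k ∈ smallVectors M (ξ j).height, (ξ j).coef μ ν k ≤ C)
    {R : Set (X × X)} (hR : IsGrid R) {ε : ℝ} (hε : 0 < ε) :
    ∀ᶠ j in atTop, ∑ k ∈ smallVectors M (ξ j).height, (ξ j).coef μ ν k *
      μ.real ((ξ j).core k ∩ {x | (x, k +ᵥ x) ∈ R}) ≤ ν.real R + ε := by
  obtain ⟨N, p, S, hp, rfl⟩ := hR
  choose A hA hAt using fun s : Fin N => hξ (p ⁻¹' {s}) (hp (measurableSet_singleton _))
  -- Solves the error bound of `sum_coef_mul_le` for `ε`; the final `+ 1` keeps the denominator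
  -- positive when `N = 0`.
  set e : ℝ := ε / (N ^ 2 * ((1 + |C|) * 2) + 1) with he
  have he0 : 0 < e := by positivity
  have hsmall : ∀ᶠ j in atTop, ∀ s, μ.real (symmDiff (p ⁻¹' {s}) (A s j)) ≤ e := by
    rw [eventually_all]
    intro s
    have := (ENNReal.tendsto_toReal ENNReal.zero_ne_top).comp (hAt s)
    exact (this.eventually_lt_const (by simpa using he0)).mono fun j hj => hj.le
  filter_upwards [hsmall, hC, hbase] with j hj hCj hb
  refine ((ξ j).sum_coef_mul_le ν h1 h2 hb M hp S (fun s => hA s j) hj he0.le).trans ?_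
  gcongr
  have h3 : (1 + ∑ k ∈ smallVectors M (ξ j).height, (ξ j).coef μ ν k) ≤ 1 + |C| := by
    linarith [le_abs_self C]
  calc (N : ℝ) ^ 2 * ((1 + ∑ k ∈ smallVectors M (ξ j).height, (ξ j).coef μ ν k) * (2 * e))
      ≤ N ^ 2 * ((1 + |C|) * (2 * e)) := by gcongr
    _ = (N ^ 2 * ((1 + |C|) * 2)) * e := by ring
    _ ≤ (N ^ 2 * ((1 + |C|) * 2) + 1) * e := by nlinarith
    _ = ε := by rw [he]; field_simp

end Strips

/-! ### Vanishing mass on close levels and the pigeonhole argument -/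

section Key

set_option linter.unusedSectionVars false

variable {n : ℕ} {X : Type*} [MeasurableSpace X] [AddAction (Zn n) X]
  [MeasurableConstVAdd (Zn n) X]

theorem natCast_mul_div_le (m : ℕ) {ε : ℝ} (hε : 0 ≤ ε) : m * (ε / (4 * (m + 1))) ≤ ε / 4 := by
  rw [mul_div_assoc', div_le_div_iff₀ (by positivity) (by positivity)]
  nlinarith

set_option maxHeartbeats 800000 in
/-- Joinings that are singular to `μ × μ` and to the off-diagonal measures give small mass to
pairs of close levels. -/
theorem eventually_strip_lt {μ : Measure X} [IsProbabilityMeasure μ]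
    [VAddInvariantMeasure (Zn n) X μ] {ν : Measure (X × X)} [IsProbabilityMeasure ν]
    [VAddInvariantMeasure (Zn n) (X × X) ν] (h1 : ν.map Prod.fst = μ) (h2 : ν.map Prod.snd = μ)
    {a : ℝ} (ha : 0 ≤ a) (ha1 : a ≤ 1) (hmix : PartiallyMixing n μ a)
    {ξ : ℕ → TowerPartition n X} (hξ : Approximating μ ξ)
    (hbase : ∀ᶠ j in atTop, μ.real (ξ j).base ≠ 0) {M : ℕ} {η : ℝ} (hη : 0 < η)
    (hcore : ∀ᶠ j in atTop, ∀ k ∈ smallVectors M (ξ j).height, 1 - a + η ≤ μ.real ((ξ j).core k))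
    (hprod : ν ⟂ₘ μ.prod μ) (hdiag : ∀ z : Zn n, ν ⟂ₘ shift z (diagonal μ)) {ε : ℝ} (hε : 0 < ε) :
    ∀ᶠ j in atTop, ν.real ((ξ j).strip M) < ε := by
  classical
  have hfin : ∀ z : Zn n, IsProbabilityMeasure (shift z (diagonal μ)) := fun z => by
    rw [shift_diagonal]
    exact Measure.isProbabilityMeasure_map (measurable_graph z).aemeasurable
  -- The strip has `ν`-mass at most one and every core has `μ`-mass at least `η`.
  have hC : ∀ᶠ j in atTop, ∑ k ∈ smallVectors M (ξ j).height, (ξ j).coef μ ν k ≤ 1 / η := by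
    filter_upwards [hbase, hcore] with j hb hc
    have h3 := (ξ j).measureReal_strip ν hb M
    have h4 : ν.real ((ξ j).strip M) ≤ 1 := measureReal_le_one
    rw [le_div_iff₀ hη, Finset.sum_mul]
    refine le_trans (Finset.sum_le_sum fun k hk => ?_) (h3 ▸ h4)
    exact mul_le_mul_of_nonneg_left (by linarith [hc k hk]) ((ξ j).coef_nonneg μ ν k)
  have hgrid := fun {R : Set (X × X)} (hR : IsGrid R) {ε : ℝ} (hε : 0 < ε) =>
    eventually_sum_coef_le h1 h2 hξ hbase hC hR hε
  have hinter : ∀ (R : Set (X × X)), IsGrid R → ∀ (j : ℕ) (k : Zn n),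
      μ.real ((ξ j).core k) - (shift k (diagonal μ)).real Rᶜ ≤
        μ.real ((ξ j).core k ∩ {x | (x, k +ᵥ x) ∈ R}) := by
    intro R hR j k
    rw [shift_diagonal, map_measureReal_apply (measurable_graph k) hR.measurableSet.compl]
    have : (ξ j).core k ⊆ ((ξ j).core k ∩ {x | (x, k +ᵥ x) ∈ R}) ∪
        (fun x => (x, k +ᵥ x)) ⁻¹' Rᶜ := by
      intro x hx
      by_cases hxR : (x, k +ᵥ x) ∈ R
      · exact Or.inl ⟨hx, hxR⟩
      · exact Or.inr hxR
    have := (measureReal_mono this).trans (measureReal_union_le (μ := μ) _ _)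
    linarith
  -- a fixed off-diagonal measure carries little mass
  have hcoef : ∀ k : Zn n, ∀ δ > 0, ∀ᶠ j in atTop,
      k ∈ smallVectors M (ξ j).height → (ξ j).coef μ ν k ≤ δ := by
    intro k δ hδ
    -- The bound `η / 2` leaves at least `η / 2` of the core on the grid `R`; the bound `δ * η / 4`
    -- makes `ν.real R + e` at most `δ * η / 2`.
    set e := min (η / 2) (δ * η / 4) with he
    have he0 : 0 < e := lt_min (by positivity) (by positivity)
    obtain ⟨R, hR, hR1, hR2⟩ := exists_isGrid_of_mutuallySingular (hdiag k) he0
    filter_upwards [hgrid hR he0, hcore] with j hj hc hk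
    have h3 : (ξ j).coef μ ν k * (η / 2) ≤ (ξ j).coef μ ν k *
        μ.real ((ξ j).core k ∩ {x | (x, k +ᵥ x) ∈ R}) := by
      refine mul_le_mul_of_nonneg_left ?_ ((ξ j).coef_nonneg μ ν k)
      have := hinter R hR j k
      have := hc k hk
      have := min_le_left (η / 2) (δ * η / 4)
      linarith
    have h4 := Finset.single_le_sum (f := fun k => (ξ j).coef μ ν k *
        μ.real ((ξ j).core k ∩ {x | (x, k +ᵥ x) ∈ R}))
      (fun k _ => mul_nonneg ((ξ j).coef_nonneg μ ν k) measureReal_nonneg) hk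
    have h5 := min_le_right (η / 2) (δ * η / 4)
    have h6 : (ξ j).coef μ ν k * (η / 2) ≤ δ * (η / 2) := by linarith
    exact le_of_mul_le_mul_right h6 (by positivity)
  set e := min (η / 4) (ε * η / 16) with he
  have he0 : 0 < e := lt_min (by positivity) (by positivity)
  have he1 : e ≤ η / 4 := min_le_left _ _
  have he2 : e ≤ ε * η / 16 := min_le_right _ _
  obtain ⟨R, hR, hR1, hR2⟩ := exists_isGrid_of_mutuallySingular hprod he0
  have hS := hmix.eventually_grid hR he0
  rw [eventually_cofinite] at hS
  set S := hS.toFinset with hSdef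
  -- Since `R` has product measure above `1 - e`, partial mixing gives it off-diagonal mass above `a
  -- (1 - e) - e`.
  have hS' : ∀ k : Zn n, k ∉ S → (shift k (diagonal μ)).real Rᶜ < 1 - a + 2 * e := by
    intro k hk
    simp only [hSdef, Set.Finite.mem_toFinset, Set.mem_ofPred_eq, not_not] at hk
    rw [probReal_compl_eq_one_sub hR.measurableSet]
    rw [probReal_compl_eq_one_sub hR.measurableSet] at hR2
    nlinarith
  have hev : ∀ᶠ j in atTop, ∀ k ∈ S, k ∈ smallVectors M (ξ j).height →
      (ξ j).coef μ ν k ≤ ε / (4 * (S.card + 1)) := by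
    rw [eventually_all_finset]
    exact fun k _ => hcoef k _ (by positivity)
  filter_upwards [hev, hgrid hR he0, hcore, hbase] with j hj1 hj2 hc hb
  set W := smallVectors M (ξ j).height
  have hW1 : ∑ k ∈ W.filter (· ∈ S), (ξ j).coef μ ν k ≤ ε / 4 := by
    calc ∑ k ∈ W.filter (· ∈ S), (ξ j).coef μ ν k
        ≤ ∑ k ∈ W.filter (· ∈ S), ε / (4 * (S.card + 1)) :=
          Finset.sum_le_sum fun k hk => hj1 k (Finset.mem_filter.1 hk).2 (Finset.mem_filter.1 hk).1
      _ ≤ ∑ k ∈ S, ε / (4 * (S.card + 1)) :=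
          Finset.sum_le_sum_of_subset_of_nonneg (fun k hk => (Finset.mem_filter.1 hk).2)
            fun k _ _ => by positivity
      _ ≤ ε / 4 := by
          rw [Finset.sum_const, nsmul_eq_mul]
          exact natCast_mul_div_le S.card hε.le
  -- Here `a + b > 1` is spent: the core has measure at least `1 - a + η`, at most `1 - a + 2e` of
  -- it escapes `R`, and `e ≤ η / 4`. So each such `k` puts at least `η / 2` times its coefficient
  -- on a set of small `ν`-measure.
  have hW2 : (∑ k ∈ W.filter (· ∉ S), (ξ j).coef μ ν k) * (η / 2) ≤ 2 * e := by
    rw [Finset.sum_mul]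
    calc ∑ k ∈ W.filter (· ∉ S), (ξ j).coef μ ν k * (η / 2)
        ≤ ∑ k ∈ W.filter (· ∉ S), (ξ j).coef μ ν k *
          μ.real ((ξ j).core k ∩ {x | (x, k +ᵥ x) ∈ R}) := by
          refine Finset.sum_le_sum fun k hk => ?_
          rw [Finset.mem_filter] at hk
          refine mul_le_mul_of_nonneg_left ?_ ((ξ j).coef_nonneg μ ν k)
          have := hinter R hR j k
          have := hc k hk.1
          have := hS' k hk.2
          linarith
      _ ≤ ∑ k ∈ W, (ξ j).coef μ ν k * μ.real ((ξ j).core k ∩ {x | (x, k +ᵥ x) ∈ R}) :=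
          Finset.sum_le_sum_of_subset_of_nonneg (Finset.filter_subset _ _)
            fun k _ _ => mul_nonneg ((ξ j).coef_nonneg μ ν k) measureReal_nonneg
      _ ≤ 2 * e := by linarith
  have hW3 : ∑ k ∈ W.filter (· ∉ S), (ξ j).coef μ ν k ≤ ε / 4 := by
    have : (∑ k ∈ W.filter (· ∉ S), (ξ j).coef μ ν k) * (η / 2) ≤ (ε / 4) * (η / 2) := by linarith
    exact le_of_mul_le_mul_right this (by positivity)
  rw [(ξ j).measureReal_strip ν hb M]
  calc ∑ k ∈ W, (ξ j).coef μ ν k * μ.real ((ξ j).core k) ≤ ∑ k ∈ W, (ξ j).coef μ ν k :=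
        Finset.sum_le_sum fun k _ =>
          mul_le_of_le_one_right ((ξ j).coef_nonneg μ ν k) measureReal_le_one
    _ = ∑ k ∈ W.filter (· ∈ S), (ξ j).coef μ ν k + ∑ k ∈ W.filter (· ∉ S), (ξ j).coef μ ν k :=
        (Finset.sum_filter_add_sum_filter_not _ _ _).symm
    _ < ε := by linarith

/-- Points of a tower in the same cell of the rectangle lie in close levels. -/
theorem TowerPartition.card_le_of_forall_notMem_strip (ξ : TowerPartition n X) {M : ℕ}
    (hM : 1 ≤ M) {ι : Type*} (I : Finset ι) (y : ι → X) (hy : ∀ i ∈ I, y i ∈ ξ.tower)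
    (hstrip : ∀ i ∈ I, ∀ j ∈ I, i ≠ j → (y i, y j) ∉ ξ.strip M) : I.card ≤ M ^ n := by
  classical
  by_contra hcon
  push Not at hcon
  have hlev : ∀ i ∈ I, ∃ z ∈ box ξ.height, y i ∈ ξ.level z := fun i hi => by
    have := hy i hi
    simp only [TowerPartition.tower, Set.mem_iUnion, exists_prop] at this
    exact this
  choose! z hz hyz using hlev
  have hcard : (Fintype.piFinset fun _ : Fin n => Finset.Ico (0 : ℤ) M).card < I.card := by
    simpa [Fintype.card_piFinset] using hcon
  -- Each axis is cut into `M` intervals by `⌊z l * M / height l⌋`. Two indices in one cell differ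
  -- along each axis by less than `height l / M`.
  obtain ⟨i, hi, j, hj, hij, heq⟩ := Finset.exists_ne_map_eq_of_card_lt_of_maps_to hcard
    (f := fun i l => z i l * M / (ξ.height l : ℤ)) (fun i hi => by
      simp only [Finset.mem_coe, Fintype.mem_piFinset, Finset.mem_Ico]
      intro l
      have h1 := hz i hi l
      have h2 : (0 : ℤ) < ξ.height l := h1.1.trans_lt h1.2
      refine ⟨Int.ediv_nonneg (mul_nonneg h1.1 (by positivity)) h2.le, ?_⟩
      rw [Int.ediv_lt_iff_lt_mul h2, mul_comm]
      exact mul_lt_mul_of_pos_left h1.2 (by exact_mod_cast hM))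
  refine hstrip i hi j hj hij (mem_strip hM (hz i hi) (hz j hj) (fun l => ?_) (hyz i hi) (hyz j hj))
  have h1 := congrFun heq l
  have h2 : (0 : ℤ) < ξ.height l := (hz i hi l).1.trans_lt (hz i hi l).2
  have h3 := Int.emod_add_mul_ediv (z i l * M) (ξ.height l)
  have h4 := Int.emod_add_mul_ediv (z j l * M) (ξ.height l)
  have h5 := Int.emod_nonneg (z i l * M) h2.ne'
  have h6 := Int.emod_nonneg (z j l * M) h2.ne'
  have h7 := Int.emod_lt_of_pos (z i l * M) h2
  have h8 := Int.emod_lt_of_pos (z j l * M) h2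
  have hM' : (|(M : ℤ)|) = M := abs_of_nonneg (by positivity)
  rw [← hM', ← abs_mul, sub_mul, abs_le]
  rw [h1] at h3
  constructor <;> linarith

/-- Among sufficiently many copies of the action in a joining, two have a joint law which is not
singular to the product measure and to all off-diagonal measures. -/
theorem exists_not_mutuallySingular {μ : Measure X} [IsProbabilityMeasure μ]
    [VAddInvariantMeasure (Zn n) X μ] {a b : ℝ} (ha : 0 ≤ a) (ha1 : a ≤ 1)
    (hmix : PartiallyMixing n μ a) (hab : 1 < a + b) {ξ : ℕ → TowerPartition n X}
    (hξ : Approximating μ ξ) (hb : Tendsto (fun j => μ.real (ξ j).tower) atTop (𝓝 b)) :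
    ∃ K : ℕ, ∀ {Ω : Type*} [MeasurableSpace Ω] (lam : Measure Ω) [IsProbabilityMeasure lam]
      (Y : Fin K → Ω → X), (∀ i, Measurable (Y i)) → (∀ i, lam.map (Y i) = μ) →
      (∀ i j, VAddInvariantMeasure (Zn n) (X × X) (lam.map fun ω => (Y i ω, Y j ω))) →
      ∃ i j, i ≠ j ∧ (¬ lam.map (fun ω => (Y i ω, Y j ω)) ⟂ₘ μ.prod μ ∨
        ∃ z : Zn n, ¬ lam.map (fun ω => (Y i ω, Y j ω)) ⟂ₘ shift z (diagonal μ)) := by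
  classical
  have hb0 : 0 < b := by linarith
  -- the number of subdivisions
  obtain ⟨M, hM, hM'⟩ : ∃ M : ℕ, 1 ≤ M ∧ 1 - a < (1 - 1 / (M : ℝ)) ^ n * b := by
    -- The factor is the fraction of the tower kept by a shift of relative size `1/M`; it tends to
    -- one, and `b > 1 - a`.
    have : Tendsto (fun M : ℕ => (1 - 1 / (M : ℝ)) ^ n * b) atTop (𝓝 ((1 - 0) ^ n * b)) :=
      ((tendsto_const_nhds.sub tendsto_one_div_atTop_nhds_zero_nat).pow n).mul_const b
    simp only [sub_zero, one_pow, one_mul] at this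
    obtain ⟨M, h1, h2⟩ := ((this.eventually_const_lt (by linarith : 1 - a < b)).and
      (eventually_ge_atTop 1)).exists
    exact ⟨M, h2, h1⟩
  have h1M : 0 ≤ (1 - 1 / (M : ℝ)) := by
    rw [sub_nonneg, div_le_one (by exact_mod_cast hM)]
    exact_mod_cast hM
  set η := ((1 - 1 / (M : ℝ)) ^ n * b - (1 - a)) / 2 with hη
  have hη0 : 0 < η := by rw [hη]; linarith
  have hcore : ∀ᶠ j in atTop, ∀ k ∈ smallVectors M (ξ j).height,
      1 - a + η ≤ μ.real ((ξ j).core k) := by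
    have := (hb.const_mul ((1 - 1 / (M : ℝ)) ^ n)).eventually_const_lt
      (by rw [hη]; linarith : 1 - a + η < (1 - 1 / (M : ℝ)) ^ n * b)
    filter_upwards [this] with j hj k hk
    exact hj.le.trans ((ξ j).measureReal_core_ge μ hM hk)
  have hbase : ∀ᶠ j in atTop, μ.real (ξ j).base ≠ 0 := by
    filter_upwards [hb.eventually_const_lt hb0] with j hj h0
    rw [(ξ j).measureReal_tower, h0, mul_zero] at hj
    exact lt_irrefl _ hj
  -- the number of copies
  obtain ⟨K, hK⟩ := exists_nat_gt ((M ^ n + 1) / (b / 2))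
  rw [div_lt_iff₀ (by positivity)] at hK
  refine ⟨K, fun {Ω} _ lam _ Y hY hYμ hinv => ?_⟩
  by_contra! hcon
  have hK0 : 0 < K := by
    rcases Nat.eq_zero_or_pos K with h | h
    · subst h
      simp only [Nat.cast_zero, zero_mul] at hK
      have : (0 : ℝ) ≤ M ^ n := by positivity
      linarith
    · exact h
  have hYY : ∀ i j, Measurable fun ω => (Y i ω, Y j ω) := fun i j => (hY i).prodMk (hY j)
  set P : Finset (Fin K × Fin K) := Finset.univ.filter fun q => q.1 ≠ q.2
  -- With weight `K` on each of at most `K ^ 2` pairs, this bound makes the total expected error at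
  -- most one.
  have hsmall : ∀ᶠ m in atTop, ∀ q ∈ P, (lam.map fun ω => (Y q.1 ω, Y q.2 ω)).real
      ((ξ m).strip M) < 1 / (K * (K ^ 2 + 1)) := by
    rw [eventually_all_finset]
    intro q hq
    have := hinv q.1 q.2
    have : IsProbabilityMeasure (lam.map fun ω => (Y q.1 ω, Y q.2 ω)) :=
      Measure.isProbabilityMeasure_map (hYY _ _).aemeasurable
    have hne : q.1 ≠ q.2 := (Finset.mem_filter.1 hq).2
    refine eventually_strip_lt ?_ ?_ ha ha1 hmix hξ hbase hη0 hcore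
      (hcon q.1 q.2 hne).1 (hcon q.1 q.2 hne).2 (by positivity)
    · rw [Measure.map_map measurable_fst (hYY _ _)]
      exact hYμ q.1
    · rw [Measure.map_map measurable_snd (hYY _ _)]
      exact hYμ q.2
  obtain ⟨m, hm1, hm2⟩ := (hsmall.and (hb.eventually_const_lt (by linarith : b / 2 < b))).exists
  set U := (ξ m).tower
  set V := (ξ m).strip M
  have hU : MeasurableSet U := by
    simp only [U, TowerPartition.tower_eq]
    exact Finset.measurableSet_biUnion _ fun z _ => (ξ m).measurableSet_level z
  have hV : MeasurableSet V := (ξ m).measurableSet_strip M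
  -- Without a close pair the pigeonhole bound `M ^ n` applies; with one, the trivial bound `K` is
  -- absorbed by that pair's term. Integrating gives `K * μ.real U ≤ M ^ n + 1`, against the choice
  -- of `K`.
  have hpt : ∀ ω, ∑ i, (Y i ⁻¹' U).indicator (1 : Ω → ℝ) ω ≤ M ^ n +
      ∑ q ∈ P, K * ((fun ω => (Y q.1 ω, Y q.2 ω)) ⁻¹' V).indicator (1 : Ω → ℝ) ω := by
    intro ω
    have hnn : ∀ q ∈ P, 0 ≤ (K : ℝ) *
        ((fun ω => (Y q.1 ω, Y q.2 ω)) ⁻¹' V).indicator (1 : Ω → ℝ) ω := fun q _ =>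
      mul_nonneg (by positivity) (Set.indicator_nonneg (fun _ _ => zero_le_one) _)
    have hle : ∑ i, (Y i ⁻¹' U).indicator (1 : Ω → ℝ) ω =
        ((Finset.univ.filter fun i => Y i ω ∈ U).card : ℝ) := by
      rw [Finset.card_filter, Nat.cast_sum]
      refine Finset.sum_congr rfl fun i _ => ?_
      simp [Set.indicator_apply]
    rw [hle]
    by_cases hex : ∃ q ∈ P, (Y q.1 ω, Y q.2 ω) ∈ V
    · obtain ⟨q, hq, hqV⟩ := hex
      have h3 := Finset.single_le_sum hnn hq
      have h4 : ((fun ω => (Y q.1 ω, Y q.2 ω)) ⁻¹' V).indicator (1 : Ω → ℝ) ω = 1 :=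
        Set.indicator_of_mem (s := (fun ω => (Y q.1 ω, Y q.2 ω)) ⁻¹' V) hqV _
      rw [h4, mul_one] at h3
      have h5 : ((Finset.univ.filter fun i => Y i ω ∈ U).card : ℝ) ≤ K := by
        have := Finset.card_le_univ (Finset.univ.filter fun i => Y i ω ∈ U)
        rw [Fintype.card_fin] at this
        exact_mod_cast this
      have : (0 : ℝ) ≤ M ^ n := by positivity
      linarith
    · push Not at hex
      have h3 := (ξ m).card_le_of_forall_notMem_strip hM (Finset.univ.filter fun i => Y i ω ∈ U)
        (fun i => Y i ω) (fun i hi => (Finset.mem_filter.1 hi).2)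
        (fun i _ j _ hij => hex (i, j) (Finset.mem_filter.2 ⟨Finset.mem_univ _, hij⟩))
      have h4 : ((Finset.univ.filter fun i => Y i ω ∈ U).card : ℝ) ≤ M ^ n := by exact_mod_cast h3
      linarith [Finset.sum_nonneg hnn]
  have hint : ∀ {s : Set Ω}, MeasurableSet s → Integrable (s.indicator (1 : Ω → ℝ)) lam :=
    fun hs => (integrable_const (1 : ℝ)).indicator hs
  have hI := integral_mono (μ := lam)
    (integrable_finsetSum _ fun i _ => hint (hY i hU))
    ((integrable_const _).add (integrable_finsetSum P fun q _ =>
      ((hint (hYY q.1 q.2 hV)).const_mul (K : ℝ)))) hpt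
  simp only [Pi.add_apply] at hI
  rw [integral_finsetSum _ fun i _ => hint (hY i hU), integral_add (integrable_const _)
    (integrable_finsetSum P fun q _ => ((hint (hYY q.1 q.2 hV)).const_mul (K : ℝ))),
    integral_finsetSum _ fun q _ => ((hint (hYY q.1 q.2 hV)).const_mul (K : ℝ))] at hI
  have h3 : ∀ i, ∫ ω, (Y i ⁻¹' U).indicator (1 : Ω → ℝ) ω ∂lam = μ.real U := fun i => by
    rw [integral_indicator_one (hY i hU), ← map_measureReal_apply (hY i) hU, hYμ]
  have h4 : ∀ q ∈ P, ∫ ω, (K : ℝ) *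
      ((fun ω => (Y q.1 ω, Y q.2 ω)) ⁻¹' V).indicator (1 : Ω → ℝ) ω ∂lam ≤ 1 / (K ^ 2 + 1) := by
    intro q hq
    rw [integral_const_mul, integral_indicator_one (hYY q.1 q.2 hV),
      ← map_measureReal_apply (hYY q.1 q.2) hV]
    calc (K : ℝ) * (lam.map fun ω => (Y q.1 ω, Y q.2 ω)).real V
        ≤ K * (1 / (K * (K ^ 2 + 1))) := by gcongr; exact (hm1 q hq).le
      _ = 1 / (K ^ 2 + 1) := by field_simp
  have h5 := Finset.sum_le_sum h4
  simp only [h3, Finset.sum_const, Finset.card_univ, Fintype.card_fin, nsmul_eq_mul,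
    integral_const, probReal_univ, smul_eq_mul, one_mul] at hI h5
  have h6 : (P.card : ℝ) * (1 / (K ^ 2 + 1)) ≤ 1 := by
    rw [mul_one_div, div_le_one (by positivity)]
    have : P.card ≤ K * K := by simpa using Finset.card_le_univ P
    have : (P.card : ℝ) ≤ ((K * K : ℕ) : ℝ) := by exact_mod_cast this
    push_cast at this
    nlinarith
  have h7 : (K : ℝ) * (b / 2) < K * μ.real U := by
    have : (0 : ℝ) < K := by exact_mod_cast hK0
    exact mul_lt_mul_of_pos_left hm2 this
  linarith

end Key

open ProbabilityTheory

/-! ### Conditionally independent copies and equivariant kernels -/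

section Kernels

set_option linter.unusedSectionVars false

/-- The product of finitely many Markov kernels. -/
def piKernel {α β : Type*} [MeasurableSpace α] [MeasurableSpace β] {K : ℕ}
    (κ : Fin K → Kernel α β) [∀ i, IsMarkovKernel (κ i)] : Kernel α (Fin K → β) where
  toFun a := Measure.pi fun i => κ i a
  measurable' := by
    refine Measurable.measure_of_isPiSystem_of_isProbabilityMeasure generateFrom_pi.symm
      isPiSystem_pi ?_
    rintro _ ⟨s, hs, rfl⟩
    simp only [Measure.pi_pi]
    exact Finset.measurable_prod _ fun i _ => (κ i).measurable_coe (hs i (Set.mem_univ i))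

section

variable {α β : Type*} [MeasurableSpace α] [MeasurableSpace β] {K : ℕ}
  (κ : Fin K → Kernel α β) [∀ i, IsMarkovKernel (κ i)]

theorem piKernel_apply (a : α) : piKernel κ a = Measure.pi fun i => κ i a := rfl

instance : IsMarkovKernel (piKernel κ) :=
  ⟨fun a => by rw [piKernel_apply]; infer_instance⟩

theorem map_compProd_piKernel (μ : Measure α) [IsProbabilityMeasure μ] (i : Fin K) :
    (μ ⊗ₘ piKernel κ).map (fun ω => (ω.1, ω.2 i)) = μ ⊗ₘ κ i := by
  have hm : Measurable fun ω : α × (Fin K → β) => (ω.1, ω.2 i) := by fun_prop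
  ext s hs
  rw [Measure.map_apply hm hs, Measure.compProd_apply (hm hs), Measure.compProd_apply hs]
  refine lintegral_congr fun x => ?_
  have h1 := (measurePreserving_eval (fun i => κ i x) i).measure_preimage
    (measurable_prodMk_left (x := x) hs).nullMeasurableSet
  exact h1

/-- Distinct coordinates are independent given the base point. This turns absence of atoms in the
fibres into absence of coincidences between copies. -/
theorem measure_compProd_piKernel_pair (μ : Measure α) [IsProbabilityMeasure μ] {i j : Fin K}
    (hij : i ≠ j) {s : Set (β × β)} (hs : MeasurableSet s) :
    (μ ⊗ₘ piKernel κ) {ω | (ω.2 i, ω.2 j) ∈ s} = ∫⁻ x, ((κ i x).prod (κ j x)) s ∂μ := by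
  have hm : Measurable fun ω : α × (Fin K → β) => (ω.2 i, ω.2 j) := by fun_prop
  have hm' : Measurable fun y : Fin K → β => (y i, y j) := by fun_prop
  change (μ ⊗ₘ piKernel κ) ((fun ω => (ω.2 i, ω.2 j)) ⁻¹' s) = _
  rw [Measure.compProd_apply (hm hs)]
  refine lintegral_congr fun x => ?_
  have h1 : IndepFun (fun y : Fin K → β => y i) (fun y => y j) (Measure.pi fun i => κ i x) :=
    (iIndepFun_pi (X := fun _ y => y) fun i => aemeasurable_id).indepFun hij
  have h2 := h1.map_prod_eq_prod_map_map (measurable_pi_apply i).aemeasurable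
    (measurable_pi_apply j).aemeasurable
  rw [(measurePreserving_eval (fun i => κ i x) i).map_eq,
    (measurePreserving_eval (fun i => κ i x) j).map_eq] at h2
  rw [← h2, Measure.map_apply hm' hs]
  rfl

end

variable {G α β : Type*} [AddGroup G] [MeasurableSpace α] [AddAction G α]
  [MeasurableConstVAdd G α] [MeasurableSpace β] [AddAction G β] [MeasurableConstVAdd G β]

variable (G) in
/-- Kernels that commute with the action. -/
def Equivariant (κ : Kernel α β) (μ : Measure α) : Prop :=
  ∀ g : G, ∀ᵐ x ∂μ, κ (g +ᵥ x) = (κ x).map (g +ᵥ ·)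

theorem Equivariant.vaddInvariantMeasure {κ : Kernel α β} [IsMarkovKernel κ] {μ : Measure α}
    [IsProbabilityMeasure μ] [VAddInvariantMeasure G α μ] (h : Equivariant G κ μ) :
    VAddInvariantMeasure G (α × β) (μ ⊗ₘ κ) := by
  refine ⟨fun g s hs => ?_⟩
  rw [Measure.compProd_apply (measurable_const_vadd g hs), Measure.compProd_apply hs]
  have h1 : ∀ᵐ x ∂μ, κ x (Prod.mk x ⁻¹' ((g +ᵥ ·) ⁻¹' s)) =
      κ (g +ᵥ x) (Prod.mk (g +ᵥ x) ⁻¹' s) := by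
    filter_upwards [h g] with x hx
    rw [hx, Measure.map_apply (measurable_const_vadd g) (measurable_prodMk_left hs)]
    rfl
  rw [lintegral_congr_ae h1]
  exact (measurePreserving_vadd g μ).lintegral_comp (f := fun x => κ x (Prod.mk x ⁻¹' s))
    (Kernel.measurable_kernel_prodMk_left hs)

/-- Conjugating `κ` by `g` gives another disintegration of the same invariant measure, and
disintegrations are almost surely unique. -/
theorem equivariant_of_vaddInvariantMeasure [StandardBorelSpace β] [Nonempty β] {κ : Kernel α β}
    [IsMarkovKernel κ] {μ : Measure α} [IsProbabilityMeasure μ] [VAddInvariantMeasure G α μ]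
    [VAddInvariantMeasure G (α × β) (μ ⊗ₘ κ)] : Equivariant G κ μ := by
  intro g
  set κ' : Kernel α β := (κ.comap (g +ᵥ ·) (measurable_const_vadd g)).map (-g +ᵥ ·)
  have hκ' : ∀ x, κ' x = (κ (g +ᵥ x)).map (-g +ᵥ ·) := fun x => by
    rw [Kernel.map_apply _ (measurable_const_vadd _), Kernel.comap_apply]
  have : IsMarkovKernel κ' := Kernel.IsMarkovKernel.map _ (measurable_const_vadd _)
  have h1 : μ ⊗ₘ κ' = μ ⊗ₘ κ := by
    ext s hs
    rw [← measure_preimage_vadd (μ ⊗ₘ κ) (-g) s,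
      Measure.compProd_apply (measurable_const_vadd (-g) hs), Measure.compProd_apply hs,
      ← (measurePreserving_vadd g μ).lintegral_comp
        (f := fun x => κ x (Prod.mk x ⁻¹' ((-g +ᵥ ·) ⁻¹' s)))
        (Kernel.measurable_kernel_prodMk_left (measurable_const_vadd (-g) hs))]
    refine lintegral_congr fun x => ?_
    rw [hκ', Measure.map_apply (measurable_const_vadd _) (measurable_prodMk_left hs)]
    congr 1
    ext y
    simp only [Set.mem_preimage]
    change _ ↔ (-g +ᵥ (g +ᵥ x), -g +ᵥ y) ∈ s
    rw [neg_vadd_vadd]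
  have h2 := condKernel_compProd μ κ
  have h3 := condKernel_compProd μ κ'
  simp only [h1] at h3
  filter_upwards [h2, h3] with x hx hx'
  have h4 : κ x = (κ (g +ᵥ x)).map (-g +ᵥ ·) := by rw [← hκ', ← hx', hx]
  rw [h4, Measure.map_map (measurable_const_vadd g) (measurable_const_vadd _)]
  have : ((fun y : β => g +ᵥ y) ∘ fun y => -g +ᵥ y) = id := by
    ext y; simp
  rw [this, Measure.map_id]

theorem Equivariant.pi {K : ℕ} {κ : Fin K → Kernel α β} [∀ i, IsMarkovKernel (κ i)]
    {μ : Measure α} (h : ∀ i, Equivariant G (κ i) μ) : Equivariant G (piKernel κ) μ := by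
  intro g
  have : ∀ᵐ x ∂μ, ∀ i, κ i (g +ᵥ x) = (κ i x).map (g +ᵥ ·) := ae_all_iff.2 fun i => h i g
  filter_upwards [this] with x hx
  rw [piKernel_apply, piKernel_apply]
  simp only [hx]
  have : ∀ i, IsProbabilityMeasure ((κ i x).map (g +ᵥ ·)) := fun i =>
    Measure.isProbabilityMeasure_map (measurable_const_vadd g).aemeasurable
  exact (Measure.pi_map_pi fun i => (measurable_const_vadd g).aemeasurable).symm

end Kernels

/-! ### Ramsey's theorem and sums over cliques -/

section Ramsey

/-- Ramsey's theorem for graphs. -/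
theorem exists_ramsey (s t : ℕ) : ∃ R : ℕ, ∀ {ι : Type} [DecidableEq ι] (r : ι → ι → Prop),
    (∀ i j, r i j → r j i) → ∀ S : Finset ι, R ≤ S.card →
      (∃ C ⊆ S, C.card = s ∧ ∀ i ∈ C, ∀ j ∈ C, i ≠ j → r i j) ∨
      (∃ C ⊆ S, C.card = t ∧ ∀ i ∈ C, ∀ j ∈ C, i ≠ j → ¬ r i j) := by
  classical
  induction s generalizing t with
  | zero => exact ⟨0, fun r _ S _ => Or.inl ⟨∅, by simp⟩⟩
  | succ s ihs =>
    induction t with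
    | zero => exact ⟨0, fun r _ S _ => Or.inr ⟨∅, by simp⟩⟩
    | succ t iht =>
      obtain ⟨R₁, h₁⟩ := ihs (t + 1)
      obtain ⟨R₂, h₂⟩ := iht
      -- After removing one vertex `v`, it has `R₁` neighbours or `R₂` non-neighbours, and `v`
      -- extends the configuration found among them.
      refine ⟨R₁ + R₂ + 1, fun {ι} _ r hr S hS => ?_⟩
      obtain ⟨v, hv⟩ : S.Nonempty := Finset.card_pos.1 (by omega)
      have hcard := Finset.card_filter_add_card_filter_not (s := S.erase v) (r v)
      rw [Finset.card_erase_of_mem hv] at hcard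
      have hor : R₁ ≤ ((S.erase v).filter (r v)).card ∨
          R₂ ≤ ((S.erase v).filter fun i => ¬ r v i).card := by omega
      have hins : ∀ (p : ι → ι → Prop) (C : Finset ι), (∀ i ∈ C, i ∈ S ∧ i ≠ v ∧ p v i) →
          (∀ i j, p i j → p j i) → (∀ i ∈ C, ∀ j ∈ C, i ≠ j → p i j) →
          insert v C ⊆ S ∧ (insert v C).card = C.card + 1 ∧
            ∀ i ∈ insert v C, ∀ j ∈ insert v C, i ≠ j → p i j := by
        intro p C hC hp hpC
        refine ⟨Finset.insert_subset hv fun i hi => (hC i hi).1,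
          Finset.card_insert_of_notMem fun h => (hC v h).2.1 rfl, fun i hi j hj hij => ?_⟩
        rw [Finset.mem_insert] at hi hj
        by_cases hiv : i = v
        · subst hiv
          exact (hC j (hj.resolve_left (Ne.symm hij))).2.2
        · have hi' := hi.resolve_left hiv
          by_cases hjv : j = v
          · subst hjv
            exact hp _ _ (hC i hi').2.2
          · exact hpC i hi' j (hj.resolve_left hjv) hij
      rcases hor with h | h
      · have hmem : ∀ i ∈ (S.erase v).filter (r v), i ∈ S ∧ i ≠ v ∧ r v i := fun i hi => by
          rw [Finset.mem_filter, Finset.mem_erase] at hi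
          exact ⟨hi.1.2, hi.1.1, hi.2⟩
        rcases h₁ r hr _ h with ⟨C, hC, hcC, hrC⟩ | ⟨C, hC, hcC, hrC⟩
        · obtain ⟨h3, h4, h5⟩ := hins r C (fun i hi => hmem i (hC hi)) hr hrC
          exact Or.inl ⟨_, h3, by rw [h4, hcC], h5⟩
        · exact Or.inr ⟨C, fun i hi => (hmem i (hC hi)).1, hcC, hrC⟩
      · have hmem : ∀ i ∈ (S.erase v).filter (fun i => ¬ r v i), i ∈ S ∧ i ≠ v ∧ ¬ r v i :=
          fun i hi => by
            rw [Finset.mem_filter, Finset.mem_erase] at hi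
            exact ⟨hi.1.2, hi.1.1, hi.2⟩
        rcases h₂ r hr _ h with ⟨C, hC, hcC, hrC⟩ | ⟨C, hC, hcC, hrC⟩
        · exact Or.inl ⟨C, fun i hi => (hmem i (hC hi)).1, hcC, hrC⟩
        · obtain ⟨h3, h4, h5⟩ := hins (fun i j => ¬ r i j) C (fun i hi => hmem i (hC hi))
            (fun i j h h' => h (hr j i h')) hrC
          exact Or.inr ⟨_, h3, by rw [h4, hcC], h5⟩

/-- A sum over a set without large independent subsets is controlled by the sums over cliques. -/
theorem sum_le_of_clique_sum_le {ι : Type} {r : ι → ι → Prop} {t R : ℕ} (ht : 0 < t)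
    (hR : ∀ S : Finset ι, R ≤ S.card →
      ∃ C ⊆ S, C.card = t ^ 2 ∧ ∀ i ∈ C, ∀ j ∈ C, i ≠ j → r i j) {a : ι → ℝ} {w : ℝ} (hw : 0 ≤ w)
    (ha : ∀ i, a i ≤ w)
    (hclique : ∀ C : Finset ι, C.card = t ^ 2 → (∀ i ∈ C, ∀ j ∈ C, i ≠ j → r i j) →
      ∑ i ∈ C, a i ≤ w * t) (S : Finset ι) : ∑ i ∈ S, a i ≤ w * (S.card / t + R) := by
  classical
  induction hm : S.card using Nat.strong_induction_on generalizing S with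
  | _ m ih =>
    have ht0 : (0 : ℝ) < t := by exact_mod_cast ht
    by_cases h : R ≤ S.card
    -- Peeling off a clique of `t ^ 2` elements costs `w * t`, that is `w / t` per element. When
    -- fewer than `R` elements remain, each costs at most `w`.
    · obtain ⟨C, hC, hcard, hr⟩ := hR S h
      have h1 := hclique C hcard hr
      have h2 : (S \ C).card + C.card = S.card := Finset.card_sdiff_add_card_eq_card hC
      have h0 : 0 < t ^ 2 := by positivity
      have h3 := ih (S \ C).card (by omega) (S \ C) rfl
      rw [← Finset.sum_sdiff hC]
      have h4 : ((S \ C).card : ℝ) = m - t ^ 2 := by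
        rw [← hm, ← h2, hcard]; push_cast; ring
      rw [h4] at h3
      have h5 : w * ((m - (t : ℝ) ^ 2) / t + R) = w * (m / t + R) - w * t := by
        field_simp
        ring
      linarith
    · push Not at h
      have h1 : ∑ i ∈ S, a i ≤ S.card * w := by
        simpa using Finset.sum_le_sum fun i (_ : i ∈ S) => ha i
      have h2 : (S.card : ℝ) ≤ m / t + R := by
        have : (S.card : ℝ) ≤ R := by exact_mod_cast h.le
        have : (0 : ℝ) ≤ m / t := by positivity
        linarith
      have := mul_le_mul_of_nonneg_left h2 hw
      linarith

end Ramsey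

/-! ### Correlation bounds for families of pairwise independent copies -/

section NoAtoms

set_option linter.unusedSectionVars false

universe u

variable {n : ℕ} {X : Type u} [MeasurableSpace X] [AddAction (Zn n) X]
  [MeasurableConstVAdd (Zn n) X]

variable (n) in
/-- Among any `K` copies of the action, two have a joint law which is not singular to the product
measure and to all off-diagonal measures. -/
def HasClosePairs (μ : Measure X) (K : ℕ) : Prop :=
  ∀ {Ω : Type u} [MeasurableSpace Ω] (lam : Measure Ω) [IsProbabilityMeasure lam]
    (Y : Fin K → Ω → X), (∀ i, Measurable (Y i)) → (∀ i, lam.map (Y i) = μ) →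
    (∀ i j, VAddInvariantMeasure (Zn n) (X × X) (lam.map fun ω => (Y i ω, Y j ω))) →
    ∃ i j, i ≠ j ∧ (¬ lam.map (fun ω => (Y i ω, Y j ω)) ⟂ₘ μ.prod μ ∨
      ∃ z : Zn n, ¬ lam.map (fun ω => (Y i ω, Y j ω)) ⟂ₘ shift z (diagonal μ))

theorem measurableSet_graph [StandardBorelSpace X] (z : Zn n) :
    MeasurableSet {q : X × X | q.2 = z +ᵥ q.1} :=
  measurableSet_eq_fun measurable_snd ((measurable_const_vadd z).comp measurable_fst)

theorem mutuallySingular_shift_diagonal [StandardBorelSpace X] {μ : Measure X}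
    {ν : Measure (X × X)} {z : Zn n} (h : ν {q : X × X | q.2 = z +ᵥ q.1} = 0) :
    ν ⟂ₘ shift z (diagonal μ) := by
  refine ⟨_, measurableSet_graph z, h, ?_⟩
  rw [shift_diagonal, Measure.map_apply (measurable_graph z) (measurableSet_graph z).compl]
  simp

/-- Completing the square with weight `t`. It will be used with `H` a sum of `t ^ 2` uncorrelated
terms, of typical size `t`. -/
theorem mul_le_half {t f H : ℝ} (ht : 0 < t) (hf : |f| ≤ 1) : f * H ≤ t / 2 + H ^ 2 / (2 * t) := by
  have h1 : f ^ 2 ≤ 1 := by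
    rw [← sq_abs]
    exact pow_le_one₀ (abs_nonneg f) hf
  have h2 : t / 2 + H ^ 2 / (2 * t) - f * H = ((t * f - H) ^ 2 + t ^ 2 * (1 - f ^ 2)) / (2 * t) := by
    field_simp
    ring
  have h3 : 0 ≤ ((t * f - H) ^ 2 + t ^ 2 * (1 - f ^ 2)) / (2 * t) := by
    have : 0 ≤ 1 - f ^ 2 := by linarith
    positivity
  linarith

theorem integrable_of_abs_le_one {Ω : Type*} [MeasurableSpace Ω] {m : Measure Ω}
    [IsFiniteMeasure m] {f : Ω → ℝ} (hf : Measurable f) (h : ∀ ω, |f ω| ≤ 1) : Integrable f m :=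
  Integrable.of_bound hf.aestronglyMeasurable 1 (ae_of_all _ h)

/-- Pairwise independent variables are almost orthogonal to a given one on average. -/
theorem sum_integral_le_of_pairwise_indep {Ω : Type*} [MeasurableSpace Ω] {m : Measure Ω}
    [IsFiniteMeasure m] {μ : Measure X} [IsProbabilityMeasure μ] {ι : Type*} {Y : ι → Ω → X}
    (hY : ∀ i, Measurable (Y i)) {f : Ω → ℝ} (hf : Measurable f) (hf1 : ∀ ω, |f ω| ≤ 1)
    {h : X → ℝ} (hh : Measurable h) (hh1 : ∀ x, |h x| ≤ 1) (hh0 : ∫ x, h x ∂μ = 0) {t : ℕ}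
    (ht : 0 < t) {C : Finset ι} (hC : C.card = t ^ 2)
    (hind : ∀ i ∈ C, ∀ j ∈ C, i ≠ j →
      m.map (fun ω => (Y i ω, Y j ω)) = m Set.univ • μ.prod μ) :
    ∑ i ∈ C, ∫ ω, f ω * h (Y i ω) ∂m ≤ m.real Set.univ * t := by
  classical
  have ht0 : (0 : ℝ) < t := by exact_mod_cast ht
  have hhY : ∀ i, Measurable fun ω => h (Y i ω) := fun i => hh.comp (hY i)
  have hint1 : ∀ i, Integrable (fun ω => f ω * h (Y i ω)) m := fun i =>
    integrable_of_abs_le_one (hf.mul (hhY i)) fun ω => by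
      rw [abs_mul]
      exact mul_le_one₀ (hf1 ω) (abs_nonneg _) (hh1 _)
  have hint2 : ∀ i j, Integrable (fun ω => h (Y i ω) * h (Y j ω)) m := fun i j =>
    integrable_of_abs_le_one ((hhY i).mul (hhY j)) fun ω => by
      rw [abs_mul]
      exact mul_le_one₀ (hh1 _) (abs_nonneg _) (hh1 _)
  have hsq : ∀ ω, (∑ i ∈ C, h (Y i ω)) ^ 2 = ∑ i ∈ C, ∑ j ∈ C, h (Y i ω) * h (Y j ω) := fun ω => by
    rw [sq, Finset.sum_mul_sum]
  have hint3 : Integrable (fun ω => (∑ i ∈ C, h (Y i ω)) ^ 2) m := by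
    simp only [hsq]
    exact integrable_finsetSum _ fun i _ => integrable_finsetSum _ fun j _ => hint2 i j
  -- Cross terms vanish by independence and mean zero; only the `t ^ 2` diagonal terms remain.
  have hsqint : ∫ ω, (∑ i ∈ C, h (Y i ω)) ^ 2 ∂m ≤ m.real Set.univ * t ^ 2 := by
    simp only [hsq]
    rw [integral_finsetSum _ fun i _ => integrable_finsetSum _ fun j _ => hint2 i j]
    have : ∀ i ∈ C, ∫ ω, ∑ j ∈ C, h (Y i ω) * h (Y j ω) ∂m ≤ m.real Set.univ := by
      intro i hi
      rw [integral_finsetSum _ fun j _ => hint2 i j, Finset.sum_eq_single i]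
      · refine (integral_mono (hint2 i i) (integrable_const (1 : ℝ)) fun ω => ?_).trans (by simp)
        rw [← sq, ← sq_abs]
        exact pow_le_one₀ (abs_nonneg _) (hh1 _)
      · intro j hj hij
        have hm : Measurable fun ω => (Y i ω, Y j ω) := (hY i).prodMk (hY j)
        have h1 := integral_map (μ := m) hm.aemeasurable (f := fun q : X × X => h q.1 * h q.2)
          ((hh.comp measurable_fst).mul (hh.comp measurable_snd)).aestronglyMeasurable
        rw [hind i hi j hj (Ne.symm hij), integral_smul_measure, integral_prod_mul, hh0] at h1
        rw [← h1]
        simp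
      · exact fun h => absurd hi h
    refine (Finset.sum_le_sum this).trans (le_of_eq ?_)
    rw [Finset.sum_const, nsmul_eq_mul, hC]
    push_cast
    ring
  rw [← integral_finsetSum _ fun i _ => hint1 i]
  calc ∫ ω, ∑ i ∈ C, f ω * h (Y i ω) ∂m
      ≤ ∫ ω, ((t : ℝ) / 2 + (∑ i ∈ C, h (Y i ω)) ^ 2 / (2 * t)) ∂m := by
        refine integral_mono (integrable_finsetSum _ fun i _ => hint1 i)
          ((integrable_const _).add (hint3.div_const _)) fun ω => ?_
        simp only [← Finset.mul_sum]
        exact mul_le_half ht0 (hf1 ω)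
    _ = m.real Set.univ * (t / 2) + (∫ ω, (∑ i ∈ C, h (Y i ω)) ^ 2 ∂m) / (2 * t) := by
        rw [integral_add (integrable_const _) (hint3.div_const _), integral_const,
          smul_eq_mul, integral_div]
    _ ≤ m.real Set.univ * (t / 2) + (m.real Set.univ * t ^ 2) / (2 * t) := by gcongr
    _ = m.real Set.univ * t := by field_simp; ring

/-- Join two indices by an edge when the copies are independent. `HasClosePairs` forbids `K₀`
indices without an edge: coincidences along orbits are null, so a non-singular pair is non-singular
to the product, hence independent by the dichotomy. Ramsey then leaves only cliques, whose
correlation with `f` is small on average. -/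
theorem sum_integral_le_of_dichotomy [StandardBorelSpace X] {Ω : Type u} [MeasurableSpace Ω]
    {m : Measure Ω} [IsFiniteMeasure m] {μ : Measure X} [IsProbabilityMeasure μ] {K₀ K t R : ℕ}
    (hkey : HasClosePairs n μ K₀) (ht : 0 < t)
    (hR : ∀ (r : Fin K → Fin K → Prop), (∀ i j, r i j → r j i) → ∀ S : Finset (Fin K),
      R ≤ S.card → (∃ C ⊆ S, C.card = t ^ 2 ∧ ∀ i ∈ C, ∀ j ∈ C, i ≠ j → r i j) ∨
      (∃ C ⊆ S, C.card = K₀ ∧ ∀ i ∈ C, ∀ j ∈ C, i ≠ j → ¬ r i j))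
    {Y : Fin K → Ω → X} (hY : ∀ i, Measurable (Y i)) (hYμ : ∀ i, m.map (Y i) = m Set.univ • μ)
    (hinv : ∀ i j, VAddInvariantMeasure (Zn n) (X × X) (m.map fun ω => (Y i ω, Y j ω)))
    (hdich : ∀ i j, i ≠ j → m.map (fun ω => (Y i ω, Y j ω)) = m Set.univ • μ.prod μ ∨
      m.map (fun ω => (Y i ω, Y j ω)) ⟂ₘ μ.prod μ)
    (hdiag : ∀ i j, i ≠ j → ∀ z : Zn n, m {ω | Y j ω = z +ᵥ Y i ω} = 0)
    {f : Ω → ℝ} (hf : Measurable f) (hf1 : ∀ ω, |f ω| ≤ 1) {h : X → ℝ} (hh : Measurable h)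
    (hh1 : ∀ x, |h x| ≤ 1) (hh0 : ∫ x, h x ∂μ = 0) :
    ∑ i, ∫ ω, f ω * h (Y i ω) ∂m ≤ m.real Set.univ * (K / t + R) := by
  classical
  rcases eq_or_ne m 0 with rfl | hm
  · simp
  have hYY : ∀ i j, Measurable fun ω => (Y i ω, Y j ω) := fun i j => (hY i).prodMk (hY j)
  set r : Fin K → Fin K → Prop := fun i j =>
    m.map (fun ω => (Y i ω, Y j ω)) = m Set.univ • μ.prod μ with hr
  have hrsymm : ∀ i j, r i j → r j i := by
    intro i j hij
    have h1 : m.map (fun ω => (Y j ω, Y i ω)) =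
        (m.map (fun ω => (Y i ω, Y j ω))).map Prod.swap := by
      rw [Measure.map_map measurable_swap (hYY i j)]
      rfl
    simp only [hr] at hij ⊢
    rw [h1, hij, Measure.map_smul, Measure.prod_swap]
  have hm0 : m Set.univ ≠ 0 := by simpa using hm
  have hc0 : (m Set.univ)⁻¹ ≠ 0 := ENNReal.inv_ne_zero.2 (measure_ne_top _ _)
  have hc1 : (m Set.univ)⁻¹ * m Set.univ = 1 :=
    ENNReal.inv_mul_cancel hm0 (measure_ne_top _ _)
  -- `m` is normalized first, since `HasClosePairs` speaks of probability measures and `m` will be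
  -- the restriction to an invariant piece.
  have hnoindep : ∀ C : Finset (Fin K), C.card = K₀ → ∃ i ∈ C, ∃ j ∈ C, i ≠ j ∧ r i j := by
    intro C hC
    set lam := (m Set.univ)⁻¹ • m
    have : IsProbabilityMeasure lam := ⟨by simp [lam, hc1]⟩
    set e := C.orderEmbOfFin hC
    obtain ⟨i, j, hij, hor⟩ := hkey lam (fun i => Y (e i)) (fun i => hY _) (fun i => by
      rw [Measure.map_smul, hYμ, smul_smul, hc1, one_smul]) (fun i j => by
      have := hinv (e i) (e j)
      rw [Measure.map_smul]
      infer_instance)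
    have hne : e i ≠ e j := fun h => hij (e.injective h)
    refine ⟨e i, C.orderEmbOfFin_mem hC i, e j, C.orderEmbOfFin_mem hC j, hne, ?_⟩
    rw [Measure.map_smul] at hor
    rcases hdich _ _ hne with h1 | h1
    · exact h1
    · exfalso
      rcases hor with h2 | ⟨z, h2⟩
      · exact h2 (h1.smul _)
      · refine h2 (mutuallySingular_shift_diagonal ?_)
        rw [Measure.smul_apply, Measure.map_apply (hYY _ _) (measurableSet_graph z)]
        have : (fun ω => (Y (e i) ω, Y (e j) ω)) ⁻¹' {q : X × X | q.2 = z +ᵥ q.1} =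
          {ω | Y (e j) ω = z +ᵥ Y (e i) ω} := rfl
        rw [this, hdiag _ _ hne, smul_zero]
  have hint1 : ∀ i, Integrable (fun ω => f ω * h (Y i ω)) m := fun i =>
    integrable_of_abs_le_one (hf.mul (hh.comp (hY i))) fun ω => by
      rw [abs_mul]
      exact mul_le_one₀ (hf1 ω) (abs_nonneg _) (hh1 _)
  have := sum_le_of_clique_sum_le (r := r) ht (R := R) (fun S hS => ?_) (w := m.real Set.univ)
    (a := fun i => ∫ ω, f ω * h (Y i ω) ∂m) measureReal_nonneg (fun i => ?_)
    (fun C hC hrC => sum_integral_le_of_pairwise_indep hY hf hf1 hh hh1 hh0 ht hC hrC) Finset.univ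
  · simpa using this
  · rcases hR r hrsymm S hS with h1 | ⟨C, _, hC, hrC⟩
    · exact h1
    · obtain ⟨i, hi, j, hj, hij, h2⟩ := hnoindep C hC
      exact absurd h2 (hrC i hi j hj hij)
  · refine (integral_mono (hint1 i) (integrable_const (1 : ℝ)) fun ω => ?_).trans (by simp)
    refine (le_abs_self _).trans ?_
    rw [abs_mul]
    exact mul_le_one₀ (hf1 ω) (abs_nonneg _) (hh1 _)

end NoAtoms

/-! ### Atomless fibres force the product joining -/

section NoAtoms

set_option linter.unusedSectionVars false

universe u

variable {n : ℕ} {X : Type u} [MeasurableSpace X] [AddAction (Zn n) X]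
  [MeasurableConstVAdd (Zn n) X]

theorem ae_forall_vadd_mem_iff {G Ω ι : Type*} [AddGroup G] [MeasurableSpace Ω] [AddAction G Ω]
    {m : Measure Ω} [Countable ι] {A : ι → Set Ω} (h : ∀ i (g : G), (g +ᵥ ·) ⁻¹' A i =ᵐ[m] A i)
    (g : G) : ∀ᵐ ω ∂m, ∀ i, g +ᵥ ω ∈ A i ↔ ω ∈ A i :=
  ae_all_iff.2 fun i => (h i g).mem_iff

/-- All `K` conditionally independent copies of the second coordinate have the same correlation `I`
with `f`, so `K * I ≤ K / t + R` with `R` independent of `K`. Letting `K` and then `t` tend to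
infinity gives the claim. -/
theorem integral_le_zero_of_noAtoms [StandardBorelSpace X] [Nonempty X] {μ : Measure X}
    [IsProbabilityMeasure μ] {K₀ : ℕ}
    (hkey : HasClosePairs n μ K₀) [ErgodicVAdd (Zn n) X μ]
    [ErgodicVAdd (Zn n) (X × X) (μ.prod μ)] {κ : Kernel X X} [IsMarkovKernel κ]
    [VAddInvariantMeasure (Zn n) (X × X) (μ ⊗ₘ κ)] (hsnd : (μ ⊗ₘ κ).map Prod.snd = μ)
    (hatom : ∀ᵐ x ∂μ, ∀ y, κ x {y} = 0) {f : X → ℝ} (hf : Measurable f) (hf1 : ∀ x, |f x| ≤ 1)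
    {h : X → ℝ} (hh : Measurable h) (hh1 : ∀ x, |h x| ≤ 1) (hh0 : ∫ x, h x ∂μ = 0) :
    ∫ q, f q.1 * h q.2 ∂(μ ⊗ₘ κ) ≤ 0 := by
  classical
  set I := ∫ q, f q.1 * h q.2 ∂(μ ⊗ₘ κ) with hI
  suffices hmain : ∀ t : ℕ, 0 < t → ∃ R : ℕ, ∀ K : ℕ, K * I ≤ K / t + R by
    refine le_of_forall_pos_le_add fun ε hε => ?_
    obtain ⟨t, ht⟩ := exists_nat_gt (2 / ε)
    have ht0 : (0 : ℝ) < t := lt_trans (by positivity) ht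
    obtain ⟨R, hR⟩ := hmain t (by exact_mod_cast ht0)
    obtain ⟨K, hK⟩ := exists_nat_gt (2 * R / ε)
    have hK0 : (0 : ℝ) < K := lt_of_le_of_lt (by positivity) hK
    have h1 : 1 / (t : ℝ) ≤ ε / 2 := by
      rw [div_lt_iff₀ hε] at ht
      rw [div_le_div_iff₀ ht0 two_pos]
      linarith
    have h2 : (R : ℝ) ≤ K * (ε / 2) := by
      rw [div_lt_iff₀ hε] at hK
      linarith
    have h3 : K * I ≤ K * (0 + ε) := by
      have := hR K
      rw [div_eq_mul_one_div] at this
      nlinarith [mul_le_mul_of_nonneg_left h1 hK0.le]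
    exact le_of_mul_le_mul_left h3 hK0
  intro t ht
  obtain ⟨R, hR⟩ := exists_ramsey (t ^ 2) K₀
  refine ⟨R, fun K => ?_⟩
  set κs : Fin K → Kernel X X := fun _ => κ with hκs
  have : ∀ i, IsMarkovKernel (κs i) := fun i => by simp only [hκs]; infer_instance
  set Λ := μ ⊗ₘ piKernel κs with hΛ
  have hequiv : Equivariant (Zn n) (piKernel κs) μ :=
    Equivariant.pi fun i => equivariant_of_vaddInvariantMeasure
  have hΛinv : VAddInvariantMeasure (Zn n) (X × (Fin K → X)) Λ := hequiv.vaddInvariantMeasure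
  set Y : Fin K → X × (Fin K → X) → X := fun i ω => ω.2 i with hYdef
  have hY : ∀ i, Measurable (Y i) := fun i => (measurable_pi_apply i).comp measurable_snd
  have hYY : ∀ i j, Measurable fun ω => (Y i ω, Y j ω) := fun i j => (hY i).prodMk (hY j)
  have hXY : ∀ i, Λ.map (fun ω => (ω.1, Y i ω)) = μ ⊗ₘ κ := fun i => map_compProd_piKernel κs μ i
  have hYμ : ∀ i, Λ.map (Y i) = μ := fun i => by
    have h1 : Λ.map (Y i) = (Λ.map (fun ω => (ω.1, Y i ω))).map Prod.snd := by
      rw [Measure.map_map measurable_snd (measurable_fst.prodMk (hY i))]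
      rfl
    rw [h1, hXY, hsnd]
  have hpairinv : ∀ {m : Measure (X × (Fin K → X))} [VAddInvariantMeasure (Zn n) _ m] (i j),
      VAddInvariantMeasure (Zn n) (X × X) (m.map fun ω => (Y i ω, Y j ω)) :=
    fun {m} _ i j => vaddInvariantMeasure_map m _ (fun _ _ => rfl) (hYY i j)
  have hdiag : ∀ i j, i ≠ j → ∀ z : Zn n, Λ {ω | Y j ω = z +ᵥ Y i ω} = 0 := by
    intro i j hij z
    have h1 := measure_compProd_piKernel_pair κs μ hij (measurableSet_graph (X := X) z)
    refine h1.trans ?_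
    refine (lintegral_congr_ae (g := fun _ => 0) ?_).trans lintegral_zero
    filter_upwards [hatom] with x hx
    rw [Measure.prod_apply (measurableSet_graph z)]
    refine (lintegral_congr fun y => ?_).trans lintegral_zero
    exact hx (z +ᵥ y)
  -- The law of a pair need not be ergodic. `E i j` carries its absolutely continuous part, and the
  -- pieces `P s` below record exactly which pairs fall in their `E`. On an invariant piece each
  -- such law is a multiple of `μ × μ`, by ergodicity of the product, and every other one is
  -- singular to it.
  choose E hE hE1 hE2 hE3 using fun i j : Fin K =>
    have := hpairinv (m := Λ) i j
    exists_invariant_absolutelyContinuous_part (Zn n)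
      (Λ.map fun ω => (Y i ω, Y j ω)) (μ.prod μ)
  set A : Fin K × Fin K → Set (X × (Fin K → X)) := fun q =>
    (fun ω => (Y q.1 ω, Y q.2 ω)) ⁻¹' E q.1 q.2 with hA
  have hAm : ∀ q, MeasurableSet (A q) := fun q => hYY _ _ (hE _ _)
  have hAinv : ∀ q (g : Zn n), (g +ᵥ ·) ⁻¹' A q =ᵐ[Λ] A q := fun q g => by
    filter_upwards [ae_of_ae_map (hYY q.1 q.2).aemeasurable (hE3 q.1 q.2 g)] with ω hω
    exact hω
  set P : Finset (Fin K × Fin K) → Set (X × (Fin K → X)) := fun s =>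
    {ω | ∀ q, ω ∈ A q ↔ q ∈ s} with hP
  have hPm : ∀ s, MeasurableSet (P s) := fun s => by
    have : P s = ⋂ q, {ω | ω ∈ A q ↔ q ∈ s} := by ext; simp [hP]
    rw [this]
    refine MeasurableSet.iInter fun q => ?_
    by_cases hq : q ∈ s
    · have : {ω | ω ∈ A q ↔ q ∈ s} = A q := by ext; simp [hq]
      rw [this]
      exact hAm q
    · have : {ω | ω ∈ A q ↔ q ∈ s} = (A q)ᶜ := by ext; simp [hq]
      rw [this]
      exact (hAm q).compl
  have hPinv : ∀ s (g : Zn n), (g +ᵥ ·) ⁻¹' P s =ᵐ[Λ] P s := fun s g => by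
    filter_upwards [ae_forall_vadd_mem_iff hAinv g] with ω hω
    exact propext (forall_congr' fun q => by rw [hω q])
  have hPU : ⋃ s, P s = Set.univ := by
    refine Set.eq_univ_of_forall fun ω => Set.mem_iUnion.2 ⟨Finset.univ.filter fun q => ω ∈ A q, ?_⟩
    simp [hP]
  have hPd : Pairwise (Function.onFun Disjoint P) := fun s s' hss' => by
    rw [Function.onFun, Set.disjoint_left]
    exact fun ω h1 h2 => hss' (Finset.ext fun q => (h1 q).symm.trans (h2 q))
  have hpiece : ∀ s, ∑ i, ∫ ω in P s, f ω.1 * h (Y i ω) ∂Λ ≤ Λ.real (P s) * (K / t + R) := by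
    intro s
    have := vaddInvariantMeasure_restrict (hPinv s)
    have hmap : ∀ i, ((Λ.restrict (P s)).map (Y i)) = (Λ.restrict (P s)) Set.univ • μ := fun i => by
      have h1 : VAddInvariantMeasure (Zn n) X ((Λ.restrict (P s)).map (Y i)) :=
        vaddInvariantMeasure_map _ _ (fun _ _ => rfl) (hY i)
      have h2 : (Λ.restrict (P s)).map (Y i) ≪ μ := by
        conv_rhs => rw [← hYμ i]
        exact Measure.restrict_le_self.absolutelyContinuous.map (hY i)
      have h3 := eq_smul_of_absolutelyContinuous (Zn n) h2
      rwa [Measure.map_apply (hY i) MeasurableSet.univ, Set.preimage_univ] at h3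
    have := sum_integral_le_of_dichotomy (n := n) (m := Λ.restrict (P s)) hkey ht
      (fun r => hR (ι := Fin K) r) hY hmap hpairinv (fun i j hij => ?_) (fun i j hij z => ?_)
      (f := fun ω => f ω.1) (hf.comp measurable_fst) (fun ω => hf1 _) hh hh1 hh0
    · rwa [measureReal_restrict_apply MeasurableSet.univ, Set.univ_inter] at this
    · by_cases hq : (i, j) ∈ s
      · left
        have h1 := hpairinv (m := Λ.restrict (P s)) i j
        have h2 : (Λ.restrict (P s)).map (fun ω => (Y i ω, Y j ω)) ≪ μ.prod μ := by
          refine Measure.AbsolutelyContinuous.trans (Measure.absolutelyContinuous_of_le ?_) (hE2 i j)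
          rw [Measure.restrict_map (hYY i j) (hE i j)]
          exact Measure.map_mono (Measure.restrict_mono (fun ω hω => (hω (i, j)).2 hq) le_rfl)
            (hYY i j)
        have h3 := eq_smul_of_absolutelyContinuous (Zn n) h2
        rwa [Measure.map_apply (hYY i j) MeasurableSet.univ, Set.preimage_univ] at h3
      · right
        refine ⟨E i j, hE i j, ?_, hE1 i j⟩
        rw [Measure.map_apply (hYY i j) (hE i j), Measure.restrict_apply (hYY i j (hE i j))]
        convert measure_empty (μ := Λ)
        ext ω
        simp only [Set.mem_inter_iff, Set.mem_empty_iff_false, iff_false]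
        rintro ⟨h1, h2⟩
        exact hq ((h2 (i, j)).1 h1)
    · exact Measure.absolutelyContinuous_of_le Measure.restrict_le_self (hdiag i j hij z)
  have hint : ∀ i, Integrable (fun ω => f ω.1 * h (Y i ω)) Λ := fun i =>
    integrable_of_abs_le_one ((hf.comp measurable_fst).mul (hh.comp (hY i))) fun ω => by
      rw [abs_mul]
      exact mul_le_one₀ (hf1 _) (abs_nonneg _) (hh1 _)
  have hIi : ∀ i, ∫ ω, f ω.1 * h (Y i ω) ∂Λ = I := fun i => by
    rw [hI, ← hXY i, integral_map (measurable_fst.prodMk (hY i)).aemeasurable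
      (f := fun q : X × X => f q.1 * h q.2) ((hf.comp measurable_fst).mul (hh.comp measurable_snd)).aestronglyMeasurable]
  have hsplit : ∀ i, ∫ ω, f ω.1 * h (Y i ω) ∂Λ = ∑ s, ∫ ω in P s, f ω.1 * h (Y i ω) ∂Λ := fun i => by
    rw [← integral_iUnion_fintype hPm hPd fun s => (hint i).integrableOn, hPU, setIntegral_univ]
  have hmass : ∑ s, Λ.real (P s) = 1 := by
    have := measureReal_iUnion_fintype (μ := Λ) hPd hPm
    rw [hPU, probReal_univ] at this
    exact this.symm
  calc (K : ℝ) * I = ∑ i : Fin K, ∫ ω, f ω.1 * h (Y i ω) ∂Λ := by simp [hIi]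
    _ = ∑ s, ∑ i, ∫ ω in P s, f ω.1 * h (Y i ω) ∂Λ := by
        rw [Finset.sum_comm]
        exact Finset.sum_congr rfl fun i _ => hsplit i
    _ ≤ ∑ s, Λ.real (P s) * (K / t + R) := Finset.sum_le_sum fun s _ => hpiece s
    _ = K / t + R := by rw [← Finset.sum_mul, hmass, one_mul]

/-- A self-joining without atoms on the fibres is the product measure. -/
theorem compProd_eq_prod_of_noAtoms [StandardBorelSpace X] [Nonempty X] {μ : Measure X}
    [IsProbabilityMeasure μ] {K₀ : ℕ} (hkey : HasClosePairs n μ K₀) [ErgodicVAdd (Zn n) X μ]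
    [ErgodicVAdd (Zn n) (X × X) (μ.prod μ)] {κ : Kernel X X} [IsMarkovKernel κ]
    [VAddInvariantMeasure (Zn n) (X × X) (μ ⊗ₘ κ)] (hsnd : (μ ⊗ₘ κ).map Prod.snd = μ)
    (hatom : ∀ᵐ x ∂μ, ∀ y, κ x {y} = 0) : μ ⊗ₘ κ = μ.prod μ := by
  refine (Measure.prod_eq fun A C hA hC => ?_).symm
  set f : X → ℝ := A.indicator 1 with hf
  have hfm : Measurable f := measurable_one.indicator hA
  have hf1 : ∀ x, |f x| ≤ 1 := fun x => by
    by_cases hx : x ∈ A <;> simp [hf, hx]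
  -- Centring makes the correlation with the indicator of `A` equal to the defect `ν(A × C) - μ(A)
  -- μ(C)`; the one-sided bound for `f` and for `-f` makes it vanish.
  set h : X → ℝ := fun y => C.indicator 1 y - μ.real C with hh
  have hhm : Measurable h := (measurable_one.indicator hC).sub_const _
  have hh1 : ∀ x, |h x| ≤ 1 := fun x => by
    have h1 : 0 ≤ μ.real C := measureReal_nonneg
    have h2 : μ.real C ≤ 1 := measureReal_le_one
    rw [abs_le]
    by_cases hx : x ∈ C
    · simp only [hh, Set.indicator_of_mem hx, Pi.one_apply]
      constructor <;> linarith
    · simp only [hh, Set.indicator_of_notMem hx]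
      constructor <;> linarith
  have hh0 : ∫ x, h x ∂μ = 0 := by
    simp only [hh]
    rw [integral_sub ((integrable_const _).indicator hC) (integrable_const _),
      integral_indicator_one hC]
    simp
  have h1 := integral_le_zero_of_noAtoms hkey hsnd hatom hfm hf1 hhm hh1 hh0
  have h2 := integral_le_zero_of_noAtoms hkey hsnd hatom hfm.neg
    (fun x => by simpa using hf1 x) hhm hh1 hh0
  have h3 : ∫ q, f q.1 * h q.2 ∂(μ ⊗ₘ κ) = (μ ⊗ₘ κ).real (A ×ˢ C) - μ.real A * μ.real C := by
    have h4 : ∀ q : X × X, f q.1 * h q.2 =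
        (A ×ˢ C).indicator 1 q - μ.real C * (Prod.fst ⁻¹' A).indicator 1 q := by
      rintro ⟨x, y⟩
      by_cases hx : x ∈ A <;> by_cases hy : y ∈ C <;>
        simp [hf, hh, Set.indicator, hx, hy]
    simp only [h4]
    rw [integral_sub ((integrable_const _).indicator (hA.prod hC))
      (((integrable_const _).indicator (measurable_fst hA)).const_mul _),
      integral_indicator_one (hA.prod hC), integral_const_mul,
      integral_indicator_one (measurable_fst hA), mul_comm,
      ← map_measureReal_apply measurable_fst hA]
    have : (μ ⊗ₘ κ).map Prod.fst = μ := Measure.fst_compProd μ κ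
    rw [this]
  have h5 : ∫ q, (-f) q.1 * h q.2 ∂(μ ⊗ₘ κ) = -∫ q, f q.1 * h q.2 ∂(μ ⊗ₘ κ) := by
    rw [← integral_neg]
    simp
  rw [h5] at h2
  have h6 : (μ ⊗ₘ κ).real (A ×ˢ C) = μ.real A * μ.real C := by linarith
  rw [← ENNReal.toReal_eq_toReal_iff' (measure_ne_top _ _) (by finiteness), ENNReal.toReal_mul]
  exact h6

end NoAtoms

/-! ### Existence of ergodic components -/

section Components

set_option linter.unusedSectionVars false

universe u

variable {n : ℕ} {X : Type u} [MeasurableSpace X] [AddAction (Zn n) X]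
  [MeasurableConstVAdd (Zn n) X]

variable (n) in
/-- Invariant measures on `X × X` with both marginals `μ`. -/
structure IsSelfJoining (μ : Measure X) (ν : Measure (X × X)) : Prop where
  map_fst : ν.map Prod.fst = μ
  map_snd : ν.map Prod.snd = μ
  inv : VAddInvariantMeasure (Zn n) (X × X) ν

theorem IsErgodicSelfJoining.isSelfJoining {μ : Measure X} {ν : Measure (X × X)}
    (h : IsErgodicSelfJoining n μ ν) : IsSelfJoining n μ ν :=
  ⟨h.map_fst, h.map_snd, h.ergodic.toVAddInvariantMeasure⟩

theorem IsSelfJoining.isProbabilityMeasure {μ : Measure X} [IsProbabilityMeasure μ]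
    {ν : Measure (X × X)} (h : IsSelfJoining n μ ν) : IsProbabilityMeasure ν := by
  refine ⟨?_⟩
  rw [← Set.preimage_univ (f := Prod.fst), ← Measure.map_apply measurable_fst MeasurableSet.univ,
    h.map_fst, measure_univ]

theorem IsErgodicSelfJoining.isProbabilityMeasure {μ : Measure X} [IsProbabilityMeasure μ]
    {ν : Measure (X × X)} (h : IsErgodicSelfJoining n μ ν) : IsProbabilityMeasure ν :=
  h.isSelfJoining.isProbabilityMeasure

theorem isErgodicSelfJoining_prod {μ : Measure X} [IsProbabilityMeasure μ]
    [ErgodicVAdd (Zn n) (X × X) (μ.prod μ)] : IsErgodicSelfJoining n μ (μ.prod μ) :=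
  ⟨Measure.fst_prod, Measure.snd_prod, inferInstance⟩

/-- The marginals of an invariant piece are invariant and absolutely continuous with respect to the
ergodic `μ`, hence multiples of it. -/
theorem IsSelfJoining.map_restrict {μ : Measure X} [IsProbabilityMeasure μ]
    [ErgodicVAdd (Zn n) X μ] {ν : Measure (X × X)} (h : IsSelfJoining n μ ν) {E : Set (X × X)}
    (hE : ∀ g : Zn n, (g +ᵥ ·) ⁻¹' E =ᵐ[ν] E) :
    (ν.restrict E).map Prod.fst = ν E • μ ∧ (ν.restrict E).map Prod.snd = ν E • μ := by
  have := h.isProbabilityMeasure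
  have := h.inv
  have h0 := vaddInvariantMeasure_restrict hE
  constructor
  · have h1 : VAddInvariantMeasure (Zn n) X ((ν.restrict E).map Prod.fst) :=
      vaddInvariantMeasure_map _ _ (fun _ _ => rfl) measurable_fst
    have h2 : (ν.restrict E).map Prod.fst ≪ μ := by
      conv_rhs => rw [← h.map_fst]
      exact Measure.restrict_le_self.absolutelyContinuous.map measurable_fst
    have h3 := eq_smul_of_absolutelyContinuous (Zn n) h2
    rwa [Measure.map_apply measurable_fst MeasurableSet.univ, Set.preimage_univ,
      Measure.restrict_apply_univ] at h3
  · have h1 : VAddInvariantMeasure (Zn n) X ((ν.restrict E).map Prod.snd) :=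
      vaddInvariantMeasure_map _ _ (fun _ _ => rfl) measurable_snd
    have h2 : (ν.restrict E).map Prod.snd ≪ μ := by
      conv_rhs => rw [← h.map_snd]
      exact Measure.restrict_le_self.absolutelyContinuous.map measurable_snd
    have h3 := eq_smul_of_absolutelyContinuous (Zn n) h2
    rwa [Measure.map_apply measurable_snd MeasurableSet.univ, Set.preimage_univ,
      Measure.restrict_apply_univ] at h3

/-- Normalized invariant parts of a self-joining are self-joinings. -/
theorem IsSelfJoining.smul_restrict {μ : Measure X} [IsProbabilityMeasure μ]
    [ErgodicVAdd (Zn n) X μ] {ν : Measure (X × X)} (h : IsSelfJoining n μ ν) {E : Set (X × X)}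
    (hE : ∀ g : Zn n, (g +ᵥ ·) ⁻¹' E =ᵐ[ν] E) (h0 : ν E ≠ 0) :
    IsSelfJoining n μ ((ν E)⁻¹ • ν.restrict E) := by
  have := h.isProbabilityMeasure
  have := h.inv
  have := vaddInvariantMeasure_restrict hE
  have hc : (ν E)⁻¹ * ν E = 1 := ENNReal.inv_mul_cancel h0 (measure_ne_top _ _)
  refine ⟨?_, ?_, inferInstance⟩
  · rw [Measure.map_smul, (h.map_restrict hE).1, smul_smul, hc, one_smul]
  · rw [Measure.map_smul, (h.map_restrict hE).2, smul_smul, hc, one_smul]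

/-- The mass of a point on its fibre. -/
def weight (κ : Kernel X X) (q : X × X) : ℝ≥0∞ := κ q.1 {q.2}

theorem measurable_weight [StandardBorelSpace X] (κ : Kernel X X) [IsMarkovKernel κ] :
    Measurable (weight κ) := by
  have hD : MeasurableSet {p : (X × X) × X | p.2 = p.1.2} :=
    measurableSet_eq_fun measurable_snd (measurable_snd.comp measurable_fst)
  exact Kernel.measurable_kernel_prodMk_left (κ := κ.comap (Prod.fst : X × X → X) measurable_fst) hD

/-- Equivariance of the fibre measures carries the atom at `y` over `x` to an atom of the same mass
at `g +ᵥ y` over `g +ᵥ x`. -/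
theorem ae_weight_vadd [StandardBorelSpace X] [Nonempty X] {μ : Measure X} [IsProbabilityMeasure μ]
    [VAddInvariantMeasure (Zn n) X μ] (κ : Kernel X X) [IsMarkovKernel κ]
    [VAddInvariantMeasure (Zn n) (X × X) (μ ⊗ₘ κ)] (g : Zn n) :
    (fun q => weight κ (g +ᵥ q)) =ᵐ[μ ⊗ₘ κ] weight κ := by
  have h1 : ∀ᵐ x ∂(μ ⊗ₘ κ).map Prod.fst, κ (g +ᵥ x) = (κ x).map (g +ᵥ ·) := by
    have : (μ ⊗ₘ κ).map Prod.fst = μ := Measure.fst_compProd μ κ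
    rw [this]
    exact equivariant_of_vaddInvariantMeasure g
  filter_upwards [ae_of_ae_map measurable_fst.aemeasurable h1] with q hq
  change κ (g +ᵥ q.1) {g +ᵥ q.2} = κ q.1 {q.2}
  rw [hq, Measure.map_apply (measurable_const_vadd g) (measurableSet_singleton _)]
  congr 1
  ext y
  simp

theorem noAtoms_of_ae_weight_eq_zero [StandardBorelSpace X] {μ : Measure X}
    [IsProbabilityMeasure μ] {κ : Kernel X X} [IsMarkovKernel κ]
    (h : weight κ =ᵐ[μ ⊗ₘ κ] 0) : ∀ᵐ x ∂μ, ∀ y, κ x {y} = 0 := by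
  filter_upwards [Measure.ae_ae_of_ae_compProd h] with x hx y
  by_contra hy
  have h1 : y ∈ {y' | ¬ weight κ (x, y') = (0 : X × X → ℝ≥0∞) (x, y')} := hy
  exact hy (measure_mono_null (Set.singleton_subset_iff.2 h1) hx)

/-- Invariant subsets of the set of points of large weight have large measure. -/
theorem le_measure_of_le_weight [StandardBorelSpace X] {μ : Measure X} [IsProbabilityMeasure μ]
    [ErgodicVAdd (Zn n) X μ] {κ : Kernel X X} [IsMarkovKernel κ]
    (h : IsSelfJoining n μ (μ ⊗ₘ κ)) {δ : ℝ≥0∞} {E : Set (X × X)} (hEm : MeasurableSet E)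
    (hE : ∀ g : Zn n, (g +ᵥ ·) ⁻¹' E =ᵐ[μ ⊗ₘ κ] E) (h0 : (μ ⊗ₘ κ) E ≠ 0)
    (hδ : ∀ q ∈ E, δ ≤ weight κ q) : δ ≤ (μ ⊗ₘ κ) E := by
  have h1 := (h.map_restrict hE).1
  -- The first marginal of the invariant piece is a multiple of `μ`, so its fibres have almost
  -- surely constant mass. A nonempty fibre already contains an atom of mass at least `δ`.
  have h2 : (fun x => κ x (Prod.mk x ⁻¹' E)) =ᵐ[μ] fun _ => (μ ⊗ₘ κ) E := by
    refine ae_eq_of_forall_setLIntegral_eq_of_sigmaFinite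
      (Kernel.measurable_kernel_prodMk_left hEm) measurable_const fun A hA _ => ?_
    rw [setLIntegral_const]
    have h3 := congrArg (fun m : Measure X => m A) h1
    simp only [Measure.smul_apply, smul_eq_mul] at h3
    rw [← h3, Measure.map_apply measurable_fst hA, Measure.restrict_apply (measurable_fst hA),
      Measure.compProd_apply ((measurable_fst hA).inter hEm), ← lintegral_indicator hA]
    refine lintegral_congr fun x => ?_
    by_cases hx : x ∈ A
    · rw [Set.indicator_of_mem hx]
      congr 1
      ext y
      simp [hx]
    · rw [Set.indicator_of_notMem hx]
      symm
      convert measure_empty (μ := κ x)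
      ext y
      simp [hx]
  obtain ⟨x, hx⟩ := h2.exists
  replace hx : κ x (Prod.mk x ⁻¹' E) = (μ ⊗ₘ κ) E := hx
  rw [← hx] at h0 ⊢
  obtain ⟨y, hy⟩ := nonempty_of_measure_ne_zero h0
  exact (hδ (x, y) hy).trans (measure_mono (Set.singleton_subset_iff.2 hy))

/-- Either almost no pair carries an atom, and the joining is the ergodic `μ × μ`; or the pairs of
weight at least some `δ` form a nonnull invariant set. Nonnull invariant subsets of it have measure
at least `δ`, so it cannot be split indefinitely, and an almost minimal one is ergodic. -/
theorem exists_ergodic_component_compProd [StandardBorelSpace X] [Nonempty X] {μ : Measure X}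
    [IsProbabilityMeasure μ] {K₀ : ℕ} (hkey : HasClosePairs n μ K₀) [ErgodicVAdd (Zn n) X μ]
    [ErgodicVAdd (Zn n) (X × X) (μ.prod μ)] {κ : Kernel X X} [IsMarkovKernel κ]
    (h : IsSelfJoining n μ (μ ⊗ₘ κ)) :
    ∃ e, IsErgodicSelfJoining n μ e ∧ ∃ c : ℝ≥0∞, c ≠ 0 ∧ c • e ≤ μ ⊗ₘ κ := by
  have hinv := h.inv
  set ν := μ ⊗ₘ κ with hν
  by_cases hw : weight κ =ᵐ[ν] 0
  · refine ⟨μ.prod μ, isErgodicSelfJoining_prod, 1, one_ne_zero, ?_⟩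
    rw [one_smul, hν,
      compProd_eq_prod_of_noAtoms hkey h.map_snd (noAtoms_of_ae_weight_eq_zero hw)]
  obtain ⟨k, hk⟩ : ∃ k : ℕ, ν {q | (k : ℝ≥0∞)⁻¹ ≤ weight κ q} ≠ 0 := by
    by_contra! hcon
    refine hw ?_
    have : ν (⋃ k : ℕ, {q | (k : ℝ≥0∞)⁻¹ ≤ weight κ q}) = 0 := measure_iUnion_null hcon
    refine measure_mono_null (fun q hq => ?_) this
    have hq0 : weight κ q ≠ 0 := hq
    obtain ⟨k, hk⟩ := ENNReal.exists_inv_nat_lt hq0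
    exact Set.mem_iUnion.2 ⟨k, hk.le⟩
  set δ : ℝ≥0∞ := (k : ℝ≥0∞)⁻¹ with hδ
  set S := {q | δ ≤ weight κ q} with hS
  have hSm : MeasurableSet S := measurableSet_le measurable_const (measurable_weight κ)
  have hSinv : ∀ g : Zn n, (g +ᵥ ·) ⁻¹' S =ᵐ[ν] S := fun g => by
    filter_upwards [ae_weight_vadd (μ := μ) κ g] with q hq
    change (δ ≤ weight κ (g +ᵥ q)) = (δ ≤ weight κ q)
    rw [hq]
  set good : Set (Set (X × X)) := {E | MeasurableSet E ∧
    (∀ g : Zn n, (g +ᵥ ·) ⁻¹' E =ᵐ[ν] E) ∧ E ⊆ S ∧ ν E ≠ 0} with hgood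
  have hge : ∀ E ∈ good, δ.toReal ≤ ν.real E := fun E hE =>
    ENNReal.toReal_mono (measure_ne_top _ _)
      (le_measure_of_le_weight h hE.1 hE.2.1 hE.2.2.2 fun q hq => hE.2.2.1 hq)
  -- The bound by `ν S` rules out `δ = ∞`, the case `k = 0`.
  have hδ0 : 0 < δ.toReal := by
    refine ENNReal.toReal_pos (ENNReal.inv_ne_zero.2 (ENNReal.natCast_ne_top k)) ?_
    exact ne_top_of_le_ne_top (measure_ne_top ν S)
      (le_measure_of_le_weight h hSm hSinv hk fun q hq => hq)
  -- The infimum need not be known to be attained: within `δ` of it suffices, since splitting `E`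
  -- would give one part at least the infimum and the other at least `δ`.
  obtain ⟨_, ⟨E, hE, rfl⟩, hEmin⟩ := exists_lt_of_csInf_lt
    (s := (fun E => ν.real E) '' good) ⟨_, S, ⟨hSm, hSinv, subset_rfl, hk⟩, rfl⟩
    (lt_add_of_pos_right _ hδ0)
  have hbdd : BddBelow ((fun E => ν.real E) '' good) :=
    ⟨0, by rintro _ ⟨E, _, rfl⟩; exact measureReal_nonneg⟩
  obtain ⟨hEm, hEinv, hES, hE0⟩ := hE
  have hjoin := h.smul_restrict hEinv hE0
  have hcne : (ν E)⁻¹ ≠ 0 := ENNReal.inv_ne_zero.2 (measure_ne_top _ _)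
  refine ⟨(ν E)⁻¹ • ν.restrict E, ⟨hjoin.map_fst, hjoin.map_snd, ?_⟩, ν E, hE0, ?_⟩
  · have := hjoin.inv
    refine ⟨fun {s} hs hsinv => ?_⟩
    simp only [Measure.ae_ennreal_smul_measure_eq hcne] at hsinv ⊢
    have hkey : ∀ s : Set (X × X), MeasurableSet s →
        (∀ g : Zn n, (g +ᵥ ·) ⁻¹' s =ᵐ[ν.restrict E] s) → ∀ g : Zn n,
        (g +ᵥ ·) ⁻¹' (E ∩ s) =ᵐ[ν] (E ∩ s : Set (X × X)) := fun s hs hsinv g => by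
      have h1 := (ae_restrict_iff' hEm).1 (hsinv g).mem_iff
      filter_upwards [h1, (hEinv g).mem_iff] with q hq1 hq2
      refine propext ⟨fun hq => ?_, fun hq => ?_⟩
      · have := hq2.1 hq.1
        exact ⟨this, (hq1 this).1 hq.2⟩
      · exact ⟨hq2.2 hq.1, (hq1 hq.1).2 hq.2⟩
    have hscinv : ∀ g : Zn n, (g +ᵥ ·) ⁻¹' sᶜ =ᵐ[ν.restrict E] (sᶜ : Set (X × X)) :=
      fun g => (hsinv g).compl
    rw [eventuallyConst_set]
    by_contra hcon
    rw [not_or] at hcon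
    have h1 : ν (E ∩ s) ≠ 0 := fun h0 => hcon.2 (by
      refine measure_eq_zero_iff_ae_notMem.1 ?_
      rw [Measure.restrict_apply hs, Set.inter_comm, h0])
    have h2 : ν (E ∩ sᶜ) ≠ 0 := fun h0 => hcon.1 (by
      change (ν.restrict E) sᶜ = 0
      rw [Measure.restrict_apply hs.compl, Set.inter_comm, h0])
    have h3 : sInf ((fun E => ν.real E) '' good) ≤ ν.real (E ∩ s) :=
      csInf_le hbdd ⟨_, ⟨hEm.inter hs, hkey s hs hsinv, Set.inter_subset_left.trans hES, h1⟩, rfl⟩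
    have h4 := hge (E ∩ sᶜ)
      ⟨hEm.inter hs.compl, hkey _ hs.compl hscinv, Set.inter_subset_left.trans hES, h2⟩
    have h5 : ν.real (E ∩ s) + ν.real (E \ s) = ν.real E := measureReal_inter_add_sdiff hs
    rw [Set.sdiff_eq] at h5
    linarith
  · rw [smul_smul, ENNReal.mul_inv_cancel hE0 (measure_ne_top _ _), one_smul]
    exact Measure.restrict_le_self

/-- Every self-joining has an ergodic component. -/
theorem IsSelfJoining.exists_ergodic_component [StandardBorelSpace X] {μ : Measure X}
    [IsProbabilityMeasure μ] {K₀ : ℕ} (hkey : HasClosePairs n μ K₀) [ErgodicVAdd (Zn n) X μ]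
    [ErgodicVAdd (Zn n) (X × X) (μ.prod μ)] {ν : Measure (X × X)} (h : IsSelfJoining n μ ν) :
    ∃ e, IsErgodicSelfJoining n μ e ∧ ∃ c : ℝ≥0∞, c ≠ 0 ∧ c • e ≤ ν := by
  have := nonempty_of_isProbabilityMeasure μ
  have := h.isProbabilityMeasure
  have h1 : μ ⊗ₘ ν.condKernel = ν := by
    have h2 : ν.fst = μ := h.map_fst
    rw [← h2]
    exact ν.disintegrate ν.condKernel
  rw [← h1] at h
  have := exists_ergodic_component_compProd hkey h
  rwa [h1] at this

end Components

/-! ### Joinings with finite fibres are graphs of finite-valued maps -/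

section Graphs

set_option linter.unusedSectionVars false

universe u

/-- Rewrites a condition on the `i`-th smallest point as a count, which a uniform fibre measure can
read off measurably. The `+ 1` comes from `Fin N` starting at zero. -/
theorem orderEmbOfFin_le_iff {N : ℕ} {T : Finset ℝ} (h : T.card = N) (i : Fin N) (t : ℝ) :
    T.orderEmbOfFin h i ≤ t ↔ (i : ℕ) + 1 ≤ (T.filter (· ≤ t)).card := by
  constructor
  · intro hi
    have h1 : (Finset.Iic i).map (T.orderEmbOfFin h).toEmbedding ⊆ T.filter (· ≤ t) := by
      intro s hs
      obtain ⟨j, hj, rfl⟩ := Finset.mem_map.1 hs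
      exact Finset.mem_filter.2 ⟨T.orderEmbOfFin_mem h j,
        ((T.orderEmbOfFin h).monotone (Finset.mem_Iic.1 hj)).trans hi⟩
    have h2 := Finset.card_le_card h1
    rwa [Finset.card_map, Fin.card_Iic] at h2
  · intro hi
    by_contra! hlt
    have h1 : T.filter (· ≤ t) ⊆ (Finset.Iio i).map (T.orderEmbOfFin h).toEmbedding := by
      intro s hs
      obtain ⟨hsT, hst⟩ := Finset.mem_filter.1 hs
      obtain ⟨j, rfl⟩ : s ∈ Set.range (T.orderEmbOfFin h) := by
        rw [T.range_orderEmbOfFin h]; exact hsT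
      refine Finset.mem_map.2 ⟨j, Finset.mem_Iio.2 ?_, rfl⟩
      exact (T.orderEmbOfFin h).lt_iff_lt.1 (hst.trans_lt hlt)
    have h2 := Finset.card_le_card h1
    rw [Finset.card_map, Fin.card_Iio] at h2
    omega

/-- A probability measure whose points have almost surely the same mass is uniform on a finite
set. -/
theorem exists_finset_of_ae_singleton_eq {X : Type*} [MeasurableSpace X]
    [MeasurableSingletonClass X] {m : Measure X} [IsProbabilityMeasure m] {c : ℝ≥0∞} (hc : c ≠ 0)
    (h : ∀ᵐ y ∂m, m {y} = c) :
    ∃ S : Finset X, (S.card : ℝ≥0∞) * c = 1 ∧ m = c • ∑ y ∈ S, Measure.dirac y := by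
  have hT : ∀ T : Finset X, (∀ y ∈ T, m {y} = c) → m T = T.card * c := fun T hT => by
    rw [← sum_measure_singleton, Finset.sum_congr rfl hT, Finset.sum_const, nsmul_eq_mul]
  have hfin : {y | m {y} = c}.Finite := by
    by_contra hinf
    obtain ⟨k, hk⟩ := ENNReal.exists_nat_mul_gt hc ENNReal.one_ne_top
    obtain ⟨T, hTs, hTc⟩ := (show Set.Infinite _ from hinf).exists_subset_card_eq k
    have h1 := hT T fun y hy => hTs hy
    rw [hTc] at h1
    exact absurd (prob_le_one (μ := m) (s := T)) (by rw [h1]; exact not_le.2 hk)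
  have hS : m (hfin.toFinset : Set X)ᶜ = 0 := by
    rw [hfin.coe_toFinset]
    exact h
  refine ⟨hfin.toFinset, ?_, ?_⟩
  · rw [← hT _ fun y hy => by simpa using hy]
    exact (prob_compl_eq_zero_iff hfin.toFinset.measurableSet).1 hS
  · ext B hB
    classical
    have h1 : m B = m ((hfin.toFinset.filter (· ∈ B) : Finset X) : Set X) := by
      refine measure_congr ?_
      have h2 : ∀ᵐ y ∂m, y ∈ (hfin.toFinset : Set X) := hS
      filter_upwards [h2] with y hy
      refine propext ⟨fun hyB => ?_, fun hyB => ?_⟩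
      · exact Finset.mem_coe.2 (Finset.mem_filter.2 ⟨hy, hyB⟩)
      · exact (Finset.mem_filter.1 (Finset.mem_coe.1 hyB)).2
    rw [h1, hT _ fun y hy => by simpa using (Finset.mem_filter.1 hy).1]
    simp only [Measure.smul_apply, Measure.finsetSum_apply, Measure.dirac_apply' _ hB, smul_eq_mul,
      Set.indicator_apply, Pi.one_apply]
    rw [Finset.sum_boole, mul_comm]

variable {X : Type u} [MeasurableSpace X]

/-- A joining whose fibres are uniform on finite sets with `N` elements is the graph of an
`N`-valued map. -/
theorem isFiniteValuedGraph_of_ae_weight_eq [StandardBorelSpace X] [Nonempty X] {μ : Measure X}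
    [IsProbabilityMeasure μ] {κ : Kernel X X} [IsMarkovKernel κ] {c : ℝ≥0∞} (hc : c ≠ 0)
    (h : ∀ᵐ x ∂μ, ∀ᵐ y ∂κ x, κ x {y} = c) : IsFiniteValuedGraph μ (μ ⊗ₘ κ) := by
  obtain ⟨G, hG, hGm, hGx⟩ := h.exists_measurable_mem
  have hpt : ∀ x ∈ G, ∃ S : Finset X, (S.card : ℝ≥0∞) * c = 1 ∧
      κ x = c • ∑ y ∈ S, Measure.dirac y := fun x hx =>
    exists_finset_of_ae_singleton_eq hc (hGx x hx)
  obtain ⟨x₀, hx₀⟩ : G.Nonempty := by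
    refine nonempty_of_measure_ne_zero (μ := μ) ?_
    rw [(prob_compl_eq_zero_iff hGm).1 hG]
    exact one_ne_zero
  obtain ⟨S₀, hS₀, -⟩ := hpt x₀ hx₀
  set N := S₀.card with hN
  have hcN : c = (N : ℝ≥0∞)⁻¹ := ENNReal.eq_inv_of_mul_eq_one_left (by rwa [mul_comm])
  have hN0 : N ≠ 0 := by
    rintro h0
    rw [h0] at hS₀
    simp at hS₀
  have hctop : c ≠ ∞ := by
    rw [hcN]
    exact ENNReal.inv_ne_top.2 (by exact_mod_cast hN0)
  have hcard : ∀ S : Finset X, (S.card : ℝ≥0∞) * c = 1 → S.card = N := fun S hS => by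
    have := hS.trans hS₀.symm
    rw [ENNReal.mul_left_inj hc hctop] at this
    exact_mod_cast this
  -- Points of a fibre are enumerated in increasing order of their images in `ℝ`; `g` is a
  -- measurable left inverse bringing them back.
  set e := embeddingReal X
  have he : MeasurableEmbedding e := measurableEmbedding_embeddingReal X
  obtain ⟨g, hg, hge⟩ := he.exists_measurable_extend measurable_id fun _ => ‹Nonempty X›
  have hge' : ∀ x, g (e x) = x := fun x => congrFun hge x
  have hT : ∀ x, ∃ T : Finset ℝ, T.card = N ∧ (x ∈ G →
      (↑T ⊆ Set.range e ∧ (κ x).map e = c • ∑ t ∈ T, Measure.dirac t)) := fun x => by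
    classical
    by_cases hx : x ∈ G
    · obtain ⟨S, hS, hSκ⟩ := hpt x hx
      refine ⟨S.image e, ?_, fun _ => ⟨?_, ?_⟩⟩
      · rw [Finset.card_image_of_injective _ he.injective, hcard S hS]
      · rw [Finset.coe_image]
        exact Set.image_subset_range _ _
      · rw [Finset.sum_image he.injective.injOn, hSκ, Measure.map_smul]
        congr 1
        rw [← Measure.mapₗ_apply_of_measurable he.measurable, map_sum]
        exact Finset.sum_congr rfl fun y _ => by
          rw [Measure.mapₗ_apply_of_measurable he.measurable, Measure.map_dirac' he.measurable]
    -- An arbitrary set of `N` reals off the good set, so that the enumeration by `Fin N` is defined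
    -- everywhere.
    · refine ⟨(Finset.range N).map ⟨fun k : ℕ => (k : ℝ), Nat.cast_injective⟩, ?_,
        fun h => absurd h hx⟩
      rw [Finset.card_map, Finset.card_range]
  choose T hTc hT using hT
  set q : Fin N → X → ℝ := fun i => G.indicator fun x => (T x).orderEmbOfFin (hTc x) i with hq
  have hqG : ∀ i, ∀ x ∈ G, q i x = (T x).orderEmbOfFin (hTc x) i := fun i x hx =>
    Set.indicator_of_mem hx _
  have hqm : ∀ i, Measurable (q i) := fun i => by
    refine measurable_of_Iic fun t => ?_
    have h1 : q i ⁻¹' Set.Iic t = (G ∩ {x | ((i : ℕ) + 1 : ℕ) * c ≤ κ x (e ⁻¹' Set.Iic t)}) ∪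
        (Gᶜ ∩ {_x | (0 : ℝ) ≤ t}) := by
      ext x
      by_cases hx : x ∈ G
      · have h2 : κ x (e ⁻¹' Set.Iic t) = ((T x).filter (· ≤ t)).card * c := by
          rw [← Measure.map_apply he.measurable measurableSet_Iic, (hT x hx).2]
          simp only [Measure.smul_apply, Measure.finsetSum_apply,
            Measure.dirac_apply' _ measurableSet_Iic, smul_eq_mul, Set.indicator_apply,
            Pi.one_apply, Set.mem_Iic]
          rw [Finset.sum_boole, mul_comm]
        simp only [Set.mem_preimage, Set.mem_Iic, hqG i x hx, Set.mem_union, Set.mem_inter_iff, hx,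
          true_and, Set.mem_ofPred_eq, Set.mem_compl_iff, not_true, false_and, or_false, h2]
        rw [orderEmbOfFin_le_iff, ENNReal.mul_le_mul_iff_left hc hctop, Nat.cast_le]
      · simp [hq, hx]
    rw [h1]
    exact (hGm.inter (measurableSet_le measurable_const
      (κ.measurable_coe (he.measurable measurableSet_Iic)))).union
      (hGm.compl.inter (MeasurableSet.const _))
  have hκ : ∀ x ∈ G, κ x = c • ∑ i, Measure.dirac (g (q i x)) := fun x hx => by
    have h1 : κ x = ((κ x).map e).map g := by
      rw [Measure.map_map hg he.measurable, hge, Measure.map_id]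
    rw [h1, (hT x hx).2, Measure.map_smul]
    congr 1
    rw [← Measure.mapₗ_apply_of_measurable hg, map_sum]
    simp only [Measure.mapₗ_apply_of_measurable hg, Measure.map_dirac' hg]
    simp only [hqG _ x hx]
    refine Eq.trans ?_ (Finset.sum_map Finset.univ ((T x).orderEmbOfFin (hTc x)).toEmbedding
      (fun t => Measure.dirac (g t)))
    rw [Finset.map_orderEmbOfFin_univ]
  have hμG : ∀ᵐ x ∂μ, x ∈ G := hG
  refine ⟨N, Nat.pos_of_ne_zero hN0, fun i x => g (q i x), fun i => hg.comp (hqm i), ?_, ?_⟩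
  · filter_upwards [hμG] with x hx i j hij
    have hr : ∀ i, ∃ y, e y = q i x := fun i => by
      have := (hT x hx).1 ((T x).orderEmbOfFin_mem (hTc x) i)
      rwa [← hqG i x hx] at this
    obtain ⟨y, hy⟩ := hr i
    obtain ⟨y', hy'⟩ := hr j
    simp only [← hy, ← hy', hge'] at hij
    rw [hij, hy', hqG i x hx, hqG j x hx] at hy
    exact ((T x).orderEmbOfFin (hTc x)).injective hy.symm
  · have hfm : ∀ i, Measurable fun x => (x, g (q i x)) := fun i =>
      measurable_id.prodMk (hg.comp (hqm i))
    ext s hs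
    rw [Measure.compProd_apply hs, ← hcN]
    simp only [Measure.smul_apply, Measure.finsetSum_apply, smul_eq_mul]
    have h1 : ∀ i, μ.map (fun x => (x, g (q i x))) s
        = ∫⁻ x, s.indicator 1 (x, g (q i x)) ∂μ := fun i => by
      rw [Measure.map_apply (hfm i) hs, ← lintegral_indicator_one (hfm i hs)]
      rfl
    have h2 : ∀ i, Measurable fun x => s.indicator (1 : X × X → ℝ≥0∞) (x, g (q i x)) := fun i =>
      (measurable_one.indicator hs).comp (hfm i)
    rw [Finset.sum_congr rfl fun i _ => h1 i, ← lintegral_finsetSum _ fun i _ => h2 i,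
      ← lintegral_const_mul]
    · refine lintegral_congr_ae ?_
      filter_upwards [hμG] with x hx
      rw [hκ x hx]
      simp only [Measure.smul_apply, Measure.finsetSum_apply,
        Measure.dirac_apply' _ (measurable_prodMk_left hs), smul_eq_mul]
      rfl
    · exact Finset.measurable_fun_sum _ fun i _ => h2 i

variable {n : ℕ} [AddAction (Zn n) X] [MeasurableConstVAdd (Zn n) X]

/-- The weight is invariant, hence constant by ergodicity of `ν`. Zero would mean atomless fibres
and the product measure, so it is a positive constant and the fibres are uniform on finite sets. -/
theorem IsErgodicSelfJoining.isFiniteValuedGraph [StandardBorelSpace X] {μ : Measure X}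
    [IsProbabilityMeasure μ] {K₀ : ℕ} (hkey : HasClosePairs n μ K₀) [ErgodicVAdd (Zn n) X μ]
    [ErgodicVAdd (Zn n) (X × X) (μ.prod μ)] {ν : Measure (X × X)} (h : IsErgodicSelfJoining n μ ν) (hne : ν ≠ μ.prod μ) :
    IsFiniteValuedGraph μ ν := by
  have := nonempty_of_isProbabilityMeasure μ
  have := h.isProbabilityMeasure
  have h1 : μ ⊗ₘ ν.condKernel = ν := by
    have h2 : ν.fst = μ := h.map_fst
    rw [← h2]
    exact ν.disintegrate ν.condKernel
  have herg : ErgodicVAdd (Zn n) (X × X) (μ ⊗ₘ ν.condKernel) := by rw [h1]; exact h.ergodic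
  obtain ⟨c, hc⟩ := ae_const_of_ae_invariant (Zn n) (measurable_weight ν.condKernel)
    (μ := μ ⊗ₘ ν.condKernel) (ae_weight_vadd ν.condKernel)
  by_cases hc0 : c = 0
  · subst hc0
    refine absurd ?_ hne
    rw [← h1]
    have h := h.isSelfJoining
    rw [← h1] at h
    exact compProd_eq_prod_of_noAtoms hkey h.map_snd (noAtoms_of_ae_weight_eq_zero hc)
  · rw [← h1]
    exact isFiniteValuedGraph_of_ae_weight_eq hc0 (Measure.ae_ae_of_ae_compProd hc)

end Graphs

/-! ### Finitely many classes of ergodic joinings, and joining rank -/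

section Classes

set_option linter.unusedSectionVars false

universe u

variable {n : ℕ} {X : Type u} [MeasurableSpace X] [AddAction (Zn n) X]
  [MeasurableConstVAdd (Zn n) X]

theorem measurable_shift (z : Zn n) : Measurable fun p : X × X => (p.1, z +ᵥ p.2) :=
  measurable_fst.prodMk ((measurable_const_vadd z).comp measurable_snd)

theorem shift_shift (z w : Zn n) (ν : Measure (X × X)) : shift z (shift w ν) = shift (z + w) ν := by
  rw [shift, shift, shift, Measure.map_map (measurable_shift z) (measurable_shift w)]
  congr 1
  ext p
  · rfl
  · simp [add_vadd]

theorem shift_zero (ν : Measure (X × X)) : shift (0 : Zn n) ν = ν := by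
  simp [shift]

theorem IsErgodicSelfJoining.shift {μ : Measure X} [VAddInvariantMeasure (Zn n) X μ]
    {ν : Measure (X × X)} (h : IsErgodicSelfJoining n μ ν) (z : Zn n) :
    IsErgodicSelfJoining n μ (shift z ν) := by
  have := h.ergodic
  refine ⟨?_, ?_, ?_⟩
  · rw [ZnAction.shift, Measure.map_map measurable_fst (measurable_shift z)]
    exact h.map_fst
  · rw [ZnAction.shift, Measure.map_map measurable_snd (measurable_shift z)]
    change ν.map ((z +ᵥ ·) ∘ Prod.snd) = μ
    rw [← Measure.map_map (measurable_const_vadd z) measurable_snd, h.map_snd, (measurePreserving_vadd z μ).map_eq]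
  · refine ergodicVAdd_map (Zn n) (measurable_shift z) fun g a => ?_
    ext
    · rfl
    · exact vadd_comm z g a.2

theorem IsErgodicSelfJoining.swap {μ : Measure X} {ν : Measure (X × X)}
    (h : IsErgodicSelfJoining n μ ν) : IsErgodicSelfJoining n μ (ν.map Prod.swap) := by
  have := h.ergodic
  refine ⟨?_, ?_, ?_⟩
  · rw [Measure.map_map measurable_fst measurable_swap]
    exact h.map_snd
  · rw [Measure.map_map measurable_snd measurable_swap]
    exact h.map_fst
  · exact ergodicVAdd_map (Zn n) measurable_swap fun g a => rfl

/-- The underlying measure has no atoms or is a point mass. -/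
theorem nullSingletonClass_or_ae_eq [StandardBorelSpace X] {μ : Measure X} [IsProbabilityMeasure μ]
    [ErgodicVAdd (Zn n) (X × X) (μ.prod μ)] : NullSingletonClass μ ∨ ∃ x₀, ∀ᵐ x ∂μ, x = x₀ := by
  by_cases hμ : ∀ x, μ {x} = 0
  · exact Or.inl ⟨hμ⟩
  right
  push Not at hμ
  obtain ⟨x₀, hx₀⟩ := hμ
  -- The diagonal is invariant, so null or full for the ergodic `μ × μ`. An atom excludes null, and
  -- full means that `μ` is a point mass.
  have hD : MeasurableSet {q : X × X | q.2 = q.1} := measurableSet_eq_fun measurable_snd measurable_fst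
  have h1 := aeconst_of_forall_preimage_vadd_ae_eq (Zn n) (μ := μ.prod μ) hD.nullMeasurableSet
    fun g => by
      refine Eventually.of_forall fun q => ?_
      change (g +ᵥ q.2 = g +ᵥ q.1) = (q.2 = q.1)
      rw [vadd_left_cancel_iff]
  rcases measure_zero_or_compl_zero h1 with h2 | h2
  · have h3 : (μ.prod μ) ({x₀} ×ˢ {x₀}) ≤ 0 := by
      rw [← h2]
      refine measure_mono ?_
      rintro ⟨x, y⟩ ⟨hx, hy⟩
      rw [Set.mem_singleton_iff] at hx hy
      exact hy.trans hx.symm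
    rw [Measure.prod_prod, nonpos_iff_eq_zero, mul_self_eq_zero] at h3
    exact absurd h3 hx₀
  · have h3 : ∀ᵐ q ∂μ.prod μ, q.2 = q.1 := h2
    obtain ⟨x₁, hx₁⟩ := (Measure.ae_ae_of_ae_prod h3).exists
    exact ⟨x₁, hx₁⟩

theorem map_eq_of_ae_eq {μ : Measure X} {ν : Measure (X × X)} {x₀ : X}
    (h : ∀ᵐ x ∂μ, x = x₀) (h1 : ν.map Prod.fst = μ) (h2 : ν.map Prod.snd = μ) :
    ν = ν Set.univ • Measure.dirac (x₀, x₀) := by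
  have h3 : ∀ᵐ q ∂ν, q.1 = x₀ := ae_of_ae_map measurable_fst.aemeasurable (by rwa [h1])
  have h4 : ∀ᵐ q ∂ν, q.2 = x₀ := ae_of_ae_map measurable_snd.aemeasurable (by rwa [h2])
  have h5 : id =ᵐ[ν] fun _ => (x₀, x₀) := by
    filter_upwards [h3, h4] with q hq hq'
    exact Prod.ext hq hq'
  rw [← Measure.map_const, ← Measure.map_congr h5, Measure.map_id]

/-- Over a point mass the only joining is `μ × μ`. -/
theorem nullSingletonClass_of_ne_prod [StandardBorelSpace X] {μ : Measure X} [IsProbabilityMeasure μ]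
    [ErgodicVAdd (Zn n) (X × X) (μ.prod μ)] {ν : Measure (X × X)} (h : IsErgodicSelfJoining n μ ν)
    (hne : ν ≠ μ.prod μ) : NullSingletonClass μ := by
  refine (nullSingletonClass_or_ae_eq (n := n)).resolve_right ?_
  rintro ⟨x₀, hx₀⟩
  have := h.isProbabilityMeasure
  refine hne ?_
  rw [map_eq_of_ae_eq hx₀ h.map_fst h.map_snd,
    map_eq_of_ae_eq hx₀ (ν := μ.prod μ) Measure.fst_prod Measure.snd_prod]
  simp

theorem IsFiniteValuedGraph.exists_ae_eq [StandardBorelSpace X] {μ : Measure X}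
    {ν : Measure (X × X)} (h : IsFiniteValuedGraph μ ν) :
    ∃ N : ℕ, ∃ f : Fin N → X → X, (∀ i, Measurable (f i)) ∧ ∀ᵐ q ∂ν, ∃ i, q.2 = f i q.1 := by
  obtain ⟨N, -, f, hf, -, rfl⟩ := h
  refine ⟨N, f, hf, ?_⟩
  have hm : MeasurableSet {q : X × X | ∃ i, q.2 = f i q.1} := by
    rw [Set.ofPred_exists]
    exact MeasurableSet.iUnion fun i =>
      measurableSet_eq_fun measurable_snd ((hf i).comp measurable_fst)
  refine Measure.ae_smul_measure ?_ _
  rw [ae_iff, Measure.finsetSum_apply]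
  refine Finset.sum_eq_zero fun i _ => ?_
  refine (ae_map_iff (measurable_id.prodMk (hf i)).aemeasurable hm).2 ?_
  exact ae_of_all _ fun x => ⟨i, rfl⟩

/-- Among sufficiently many nontrivial ergodic self-joinings two are equivalent. -/
theorem exists_eq_shift [StandardBorelSpace X] {μ : Measure X} [IsProbabilityMeasure μ] {K₀ : ℕ}
    (hkey : HasClosePairs n μ K₀) [ErgodicVAdd (Zn n) X μ]
    [ErgodicVAdd (Zn n) (X × X) (μ.prod μ)] {ν : Fin K₀ → Measure (X × X)}
    (h : ∀ i, IsErgodicSelfJoining n μ (ν i)) (hne : ∀ i, ν i ≠ μ.prod μ) :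
    ∃ i j, i ≠ j ∧ ∃ z : Zn n, ν j = shift z (ν i) := by
  have := nonempty_of_isProbabilityMeasure μ
  have hprob := fun i => (h i).isProbabilityMeasure
  set κ : Fin K₀ → Kernel X X := fun i => (ν i).condKernel with hκ
  have hν : ∀ i, μ ⊗ₘ κ i = ν i := fun i => by
    have h2 : (ν i).fst = μ := (h i).map_fst
    rw [hκ]
    dsimp only
    rw [← h2]
    exact (ν i).disintegrate (ν i).condKernel
  set Λ := μ ⊗ₘ piKernel κ with hΛ
  have hmarg : ∀ i, Λ.map (fun ω => (ω.1, ω.2 i)) = ν i := fun i => by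
    rw [← hν i]; exact map_compProd_piKernel κ μ i
  have hm : ∀ i, Measurable fun ω : X × (Fin K₀ → X) => (ω.1, ω.2 i) := fun i => by fun_prop
  have heq : ∀ i, Equivariant (Zn n) (κ i) μ := fun i => by
    have : VAddInvariantMeasure (Zn n) (X × X) (μ ⊗ₘ κ i) := by
      rw [hν]; exact (h i).ergodic.toVAddInvariantMeasure
    exact equivariant_of_vaddInvariantMeasure
  have hΛinv : VAddInvariantMeasure (Zn n) (X × (Fin K₀ → X)) Λ :=
    (Equivariant.pi heq).vaddInvariantMeasure
  obtain ⟨i, j, hij, hcase⟩ := hkey Λ (fun i ω => ω.2 i) (fun i => by fun_prop)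
    (fun i => by
      rw [← (h i).map_snd, ← hmarg i, Measure.map_map measurable_snd (hm i)]
      rfl)
    (fun i j => vaddInvariantMeasure_map _ _ (fun _ _ => rfl) (by fun_prop))
  have hmij : Measurable fun ω : X × (Fin K₀ → X) => (ω.2 i, ω.2 j) := by fun_prop
  refine ⟨i, j, hij, ?_⟩
  rcases hcase with hcase | ⟨z, hcase⟩
  · exfalso
    have := nullSingletonClass_of_ne_prod (h i) (hne i)
    obtain ⟨N, f, hf, hfν⟩ := ((h j).isFiniteValuedGraph hkey (hne j)).exists_ae_eq
    have hne' : (ν i).map Prod.swap ≠ μ.prod μ := fun h0 => hne i (by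
      have h1 := congrArg (Measure.map Prod.swap) h0
      rwa [Measure.map_map measurable_swap measurable_swap, Prod.swap_swap_eq, Measure.map_id,
        Measure.prod_swap] at h1)
    obtain ⟨M, g, hg, hgν⟩ := ((h i).swap.isFiniteValuedGraph hkey hne').exists_ae_eq
    -- From the `i`-th coordinate there are finitely many candidates `g a` for the common base
    -- point, and from it finitely many `f b` for the `j`-th. So the pair lives on a set with finite
    -- fibres, null for the product of the nonatomic `μ`.
    set Γ : Set (X × X) := {q | ∃ b a, q.2 = f b (g a q.1)} with hΓ
    have hΓm : MeasurableSet Γ := by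
      simp only [hΓ, Set.ofPred_exists]
      exact MeasurableSet.iUnion fun b => MeasurableSet.iUnion fun a =>
        measurableSet_eq_fun measurable_snd ((hf b).comp ((hg a).comp measurable_fst))
    refine hcase (Measure.MutuallySingular.symm ⟨Γ, hΓm, ?_, ?_⟩)
    · rw [Measure.measure_prod_null hΓm]
      refine ae_of_all _ fun x => ?_
      refine Set.Finite.measure_zero (Set.Finite.subset (Set.finite_range
        fun p : Fin N × Fin M => f p.1 (g p.2 x)) ?_) μ
      rintro y ⟨b, a, hy⟩
      exact ⟨(b, a), hy.symm⟩
    · rw [← hmarg j] at hfν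
      rw [← hmarg i, Measure.map_map measurable_swap (hm i)] at hgν
      have h1 := ae_of_ae_map (hm j).aemeasurable hfν
      have h2 := ae_of_ae_map (measurable_swap.comp (hm i)).aemeasurable hgν
      have h3 : ∀ᵐ q ∂Λ.map (fun ω => (ω.2 i, ω.2 j)), q ∈ Γ := by
        refine (ae_map_iff hmij.aemeasurable hΓm).2 ?_
        filter_upwards [h1, h2] with ω ⟨b, hb⟩ ⟨a, ha⟩
        refine ⟨b, a, ?_⟩
        change ω.1 = g a (ω.2 i) at ha
        rw [← ha]
        exact hb
      exact h3
  · refine ⟨z, ?_⟩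
    -- On this event the points of `X × X` with laws `ν j` and `shift z (ν i)` coincide, so a set
    -- separating the two measures would make it null.
    have h1 : Λ {ω | ω.2 j = z +ᵥ ω.2 i} ≠ 0 := fun h0 => hcase
      (mutuallySingular_shift_diagonal (by
        rw [Measure.map_apply hmij (measurableSet_graph z)]
        exact h0))
    have hs := (h i).shift z
    have := hs.isProbabilityMeasure
    have := hs.ergodic
    have := (h j).ergodic
    refine eq_of_ergodic_of_not_mutuallySingular (Zn n) ?_
    rintro ⟨E, hE, hE0, hE1⟩
    refine h1 ?_
    rw [← hmarg j, Measure.map_apply (hm j) hE] at hE0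
    rw [shift, Measure.map_apply (measurable_shift z) hE.compl, ← hmarg i,
      Measure.map_apply (hm i) (measurable_shift z hE.compl)] at hE1
    refine measure_mono_null (fun ω hω => ?_) (measure_union_null hE0 hE1)
    by_cases h2 : (ω.1, ω.2 j) ∈ E
    · exact Or.inl h2
    · refine Or.inr ?_
      change (ω.1, z +ᵥ ω.2 i) ∉ E
      rwa [← show ω.2 j = z +ᵥ ω.2 i from hω]

/-- If no finite subset of `S` represented everything, pairwise unrelated elements could be chosen
one after another beyond `K` of them. -/
theorem exists_finite_of_exists_rel {α : Type*} {S : Set α} {r : α → α → Prop} (hr : ∀ a, r a a)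
    (hs : ∀ a b, r a b → r b a) {K : ℕ}
    (h : ∀ a : Fin K → α, (∀ i, a i ∈ S) → ∃ i j, i ≠ j ∧ r (a i) (a j)) :
    ∃ F : Set α, F.Finite ∧ F ⊆ S ∧ ∀ a ∈ S, ∃ b ∈ F, r a b := by
  classical
  by_contra! hcon
  have : ∀ k : ℕ, ∃ F : Finset α, F.card = k ∧ ↑F ⊆ S ∧ ∀ a ∈ F, ∀ b ∈ F, a ≠ b → ¬ r a b := by
    intro k
    induction k with
    | zero => exact ⟨∅, by simp⟩
    | succ k ih =>
      obtain ⟨F, hFc, hFS, hF⟩ := ih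
      obtain ⟨a, ha, haF⟩ := hcon F F.finite_toSet hFS
      have haF' : a ∉ F := fun h' => haF a h' (hr a)
      refine ⟨insert a F, by rw [Finset.card_insert_of_notMem haF', hFc], ?_, ?_⟩
      · rw [Finset.coe_insert]
        exact Set.insert_subset ha hFS
      · intro x hx y hy hxy
        rcases Finset.mem_insert.1 hx with rfl | hx <;> rcases Finset.mem_insert.1 hy with rfl | hy
        · exact absurd rfl hxy
        · exact haF y hy
        · exact fun h' => haF x ‹_› (hs _ _ h')
        · exact hF x hx y hy hxy
  obtain ⟨F, hFc, hFS, hF⟩ := this K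
  obtain ⟨i, j, hij, hr'⟩ := h (fun i => (F.equivFinOfCardEq hFc).symm i)
    fun i => hFS (Finset.coe_mem _)
  exact hF _ (Finset.coe_mem _) _ (Finset.coe_mem _)
    (fun h0 => hij ((F.equivFinOfCardEq hFc).symm.injective (Subtype.ext h0))) hr'

/-- The ergodic self-joinings form finitely many classes. -/
theorem exists_finite_classes [StandardBorelSpace X] {μ : Measure X} [IsProbabilityMeasure μ]
    {K₀ : ℕ} (hkey : HasClosePairs n μ K₀) [ErgodicVAdd (Zn n) X μ]
    [ErgodicVAdd (Zn n) (X × X) (μ.prod μ)] :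
    ∃ F : Set (Measure (X × X)), F.Finite ∧ (∀ ν ∈ F, IsErgodicSelfJoining n μ ν) ∧
      ∀ ν, IsErgodicSelfJoining n μ ν → ∃ ν' ∈ F, ∃ z : Zn n, ν = shift z ν' := by
  have hsymm : ∀ ν ν' : Measure (X × X), (∃ z : Zn n, ν = shift z ν') → ∃ z : Zn n, ν' = shift z ν := by
    rintro _ ν' ⟨z, rfl⟩
    exact ⟨-z, by rw [shift_shift, neg_add_cancel, shift_zero]⟩
  obtain ⟨F, hF, hFS, hFr⟩ := exists_finite_of_exists_rel
    (S := {ν | IsErgodicSelfJoining n μ ν ∧ ν ≠ μ.prod μ})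
    (r := fun ν ν' => ∃ z : Zn n, ν = shift z ν') (fun ν => ⟨0, (shift_zero ν).symm⟩) hsymm
    (K := K₀) fun ν hν => by
      obtain ⟨i, j, hij, h⟩ := exists_eq_shift hkey (fun i => (hν i).1) fun i => (hν i).2
      exact ⟨i, j, hij, hsymm _ _ h⟩
  -- The product joining is its own class and is added by hand, because `exists_eq_shift` excludes
  -- it.
  refine ⟨insert (μ.prod μ) F, hF.insert _, ?_, fun ν hν => ?_⟩
  · rintro ν (rfl | hν)
    · exact isErgodicSelfJoining_prod
    · exact (hFS hν).1
  · by_cases h : ν = μ.prod μ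
    · exact ⟨_, Set.mem_insert _ _, 0, by rw [shift_zero, h]⟩
    · obtain ⟨ν', h1, h2⟩ := hFr ν ⟨hν, h⟩
      exact ⟨ν', Set.mem_insert_of_mem _ h1, h2⟩

theorem isErgodicSelfJoining_shift_diagonal {μ : Measure X} [IsProbabilityMeasure μ]
    [ErgodicVAdd (Zn n) X μ] (z : Zn n) : IsErgodicSelfJoining n μ (shift z (diagonal μ)) := by
  have hd : Measurable fun x : X => (x, x) := measurable_id.prodMk measurable_id
  refine IsErgodicSelfJoining.shift ⟨?_, ?_, ?_⟩ z
  · rw [diagonal, Measure.map_map measurable_fst hd]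
    exact Measure.map_id
  · rw [diagonal, Measure.map_map measurable_snd hd]
    exact Measure.map_id
  · exact ergodicVAdd_map (Zn n) hd fun _ _ => rfl

/-- `HasClosePairs` applies to the coordinates themselves. Their pair laws are factors of an ergodic
joining, hence ergodic, and a non-singular ergodic pair is equal. -/
theorem hasFiniteJoiningRank [StandardBorelSpace X] {μ : Measure X} [IsProbabilityMeasure μ]
    {r : ℕ} (hkey : HasClosePairs n μ (r + 1)) [ErgodicVAdd (Zn n) X μ]
    [ErgodicVAdd (Zn n) (X × X) (μ.prod μ)] : HasFiniteJoiningRank n μ := by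
  refine ⟨r, fun lam h => ?_⟩
  have := h.ergodic
  have hprob : IsProbabilityMeasure lam := by
    refine ⟨?_⟩
    rw [← Set.preimage_univ (f := fun x : Fin (r + 1) → X => x 0),
      ← Measure.map_apply (measurable_pi_apply 0) MeasurableSet.univ, h.map_eval, measure_univ]
  have hpair : ∀ i j, IsErgodicSelfJoining n μ (lam.map fun x => (x i, x j)) := fun i j => by
    have hm : Measurable fun x : Fin (r + 1) → X => (x i, x j) := by fun_prop
    refine ⟨?_, ?_, ergodicVAdd_map (Zn n) hm fun _ _ => rfl⟩
    · rw [Measure.map_map measurable_fst hm]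
      exact h.map_eval i
    · rw [Measure.map_map measurable_snd hm]
      exact h.map_eval j
  obtain ⟨i, j, hij, hcase⟩ := hkey lam (fun i x => x i) measurable_pi_apply h.map_eval
    fun i j => (hpair i j).ergodic.toVAddInvariantMeasure
  have := (hpair i j).ergodic
  have := (hpair i j).isProbabilityMeasure
  refine ⟨i, j, hij, hcase.imp (fun hc => eq_of_ergodic_of_not_mutuallySingular (Zn n) hc) ?_⟩
  rintro ⟨z, hc⟩
  have hd := isErgodicSelfJoining_shift_diagonal (μ := μ) z
  have := hd.ergodic
  have := hd.isProbabilityMeasure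
  exact ⟨z, eq_of_ergodic_of_not_mutuallySingular (Zn n) hc⟩

end Classes

/-! ### Countable ergodic decomposition of joinings -/

section Decomposition

set_option linter.unusedSectionVars false

universe u

variable {n : ℕ} {X : Type u} [MeasurableSpace X] [AddAction (Zn n) X]
  [MeasurableConstVAdd (Zn n) X]

/-- Every self-joining is a countable convex combination of ergodic ones. -/
theorem IsSelfJoining.exists_eq_sum [StandardBorelSpace X] {μ : Measure X}
    [IsProbabilityMeasure μ] {K₀ : ℕ} (hkey : HasClosePairs n μ K₀) [ErgodicVAdd (Zn n) X μ]
    [ErgodicVAdd (Zn n) (X × X) (μ.prod μ)]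
    (hcount : {e : Measure (X × X) | IsErgodicSelfJoining n μ e}.Countable)
    {ν : Measure (X × X)} (h : IsSelfJoining n μ ν) :
    ∃ c : {e : Measure (X × X) | IsErgodicSelfJoining n μ e} → ℝ≥0∞,
      ν = Measure.sum fun e => c e • (e : Measure (X × X)) := by
  have hprob := h.isProbabilityMeasure
  have hinv := h.inv
  set 𝓔 := {e : Measure (X × X) | IsErgodicSelfJoining n μ e} with h𝓔
  have := hcount.to_subtype
  have hex : ∀ e : 𝓔, ∃ E : Set (X × X), MeasurableSet E ∧ (e : Measure (X × X)) Eᶜ = 0 ∧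
      ν.restrict E = ν E • (e : Measure (X × X)) ∧ ∀ g : Zn n, (g +ᵥ ·) ⁻¹' E =ᵐ[ν] E := fun e => by
    have he : IsErgodicSelfJoining n μ e := e.2
    have := he.ergodic
    have := he.isProbabilityMeasure
    exact exists_restrict_eq_smul (Zn n)
  choose E hEm hE0 hE hEinv using hex
  have hdisj : Pairwise (Function.onFun (AEDisjoint ν) E) := fun e e' hee => by
    have he : IsErgodicSelfJoining n μ e := e.2
    have he' : IsErgodicSelfJoining n μ e' := e'.2
    have := he.ergodic
    have := he.isProbabilityMeasure
    have := he'.ergodic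
    have := he'.isProbabilityMeasure
    have hsing : (e : Measure (X × X)) ⟂ₘ (e' : Measure (X × X)) := by
      by_contra hns
      exact hee (Subtype.ext (eq_of_ergodic_of_not_mutuallySingular (Zn n) hns))
    obtain ⟨D, hD, hD0, hD1⟩ := hsing
    have h1 : ν (D ∩ E e) = 0 := by
      rw [← Measure.restrict_apply hD, hE e, Measure.smul_apply, hD0, smul_zero]
    have h2 : ν (Dᶜ ∩ E e') = 0 := by
      rw [← Measure.restrict_apply hD.compl, hE e', Measure.smul_apply, hD1, smul_zero]
    refine measure_mono_null (fun q hq => ?_) (measure_union_null h1 h2)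
    by_cases hqD : q ∈ D
    · exact Or.inl ⟨hqD, hq.1⟩
    · exact Or.inr ⟨hqD, hq.2⟩
  have hU : ν.restrict (⋃ e, E e) = Measure.sum fun e => ν (E e) • (e : Measure (X × X)) := by
    rw [Measure.restrict_iUnion_ae hdisj fun e => (hEm e).nullMeasurableSet]
    congr 1
    funext e
    exact hE e
  -- A nonnull remainder would be a joining after normalization and have an ergodic component `e`;
  -- but `e` is carried by its own `E e`, which the remainder misses.
  have hR : ν (⋃ e, E e)ᶜ = 0 := by
    by_contra hne
    have hRinv : ∀ g : Zn n, (g +ᵥ ·) ⁻¹' (⋃ e, E e)ᶜ =ᵐ[ν] ((⋃ e, E e)ᶜ : Set (X × X)) := fun g => by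
      rw [Set.preimage_compl, Set.preimage_iUnion]
      exact (Filter.EventuallyEq.countable_iUnion fun e => hEinv e g).compl
    obtain ⟨e, he, c, hc, hle⟩ := (h.smul_restrict hRinv hne).exists_ergodic_component hkey
    have := he.isProbabilityMeasure
    have h1 := hle (E ⟨e, he⟩)
    have h2 : (ν.restrict (⋃ e, E e)ᶜ) (E ⟨e, he⟩) = 0 := by
      rw [Measure.restrict_apply (hEm _)]
      convert measure_empty (μ := ν)
      refine Set.disjoint_iff_inter_eq_empty.1 (Set.disjoint_left.2 fun q hq hq' => hq' ?_)
      exact Set.mem_iUnion.2 ⟨_, hq⟩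
    have h3 : e (E ⟨e, he⟩) = 1 := (prob_compl_eq_zero_iff (hEm _)).1 (hE0 ⟨e, he⟩)
    simp only [Measure.smul_apply, h2, h3, smul_eq_mul, mul_one, mul_zero, nonpos_iff_eq_zero] at h1
    exact hc h1
  refine ⟨fun e => ν (E e), ?_⟩
  rw [← hU, Measure.restrict_eq_self_of_ae_mem (by exact hR)]

theorem countable_isErgodicSelfJoining [StandardBorelSpace X] {μ : Measure X}
    [IsProbabilityMeasure μ] {F : Set (Measure (X × X))} (hF : F.Finite)
    (hFr : ∀ ν, IsErgodicSelfJoining n μ ν → ∃ ν' ∈ F, ∃ z : Zn n, ν = shift z ν') :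
    {e : Measure (X × X) | IsErgodicSelfJoining n μ e}.Countable := by
  refine ((hF.countable.prod (Set.countable_univ (α := Zn n))).image
    fun p => shift p.2 p.1).mono fun e he => ?_
  obtain ⟨ν', h1, z, rfl⟩ := hFr e he
  exact ⟨(ν', z), ⟨h1, Set.mem_univ _⟩, rfl⟩

end Decomposition

/-! ### Markov operators and the joinings that represent them -/

section Operators

set_option linter.unusedSectionVars false

universe u

variable {X : Type u} [MeasurableSpace X] {μ : Measure X} [IsProbabilityMeasure μ]

/-- The indicator function of a set as an element of `L²`. -/
def indLp (μ : Measure X) [IsProbabilityMeasure μ] {A : Set X} (hA : MeasurableSet A) :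
    Lp ℝ 2 μ := indicatorConstLp 2 hA (measure_ne_top μ A) 1

theorem inner_indLp {A : Set X} (hA : MeasurableSet A) (f : Lp ℝ 2 μ) :
    inner ℝ (indLp μ hA) f = ∫ x in A, f x ∂μ :=
  L2.inner_indicatorConstLp_one hA (measure_ne_top μ A) f

theorem inner_indLp_indLp {A C : Set X} (hA : MeasurableSet A) (hC : MeasurableSet C) :
    inner ℝ (indLp μ hA) (indLp μ hC) = μ.real (A ∩ C) :=
  L2.real_inner_indicatorConstLp_one_indicatorConstLp_one hA hC

theorem coeFn_indLp {A : Set X} (hA : MeasurableSet A) :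
    indLp μ hA =ᵐ[μ] A.indicator fun _ => 1 := indicatorConstLp_coeFn

theorem indLp_univ : indLp μ MeasurableSet.univ = Lp.const 2 μ (1 : ℝ) :=
  indicatorConstLp_univ _ _ _

theorem eq_of_inner_indLp {u v : Lp ℝ 2 μ} (h : ∀ (A : Set X) (hA : MeasurableSet A),
    inner ℝ (indLp μ hA) u = inner ℝ (indLp μ hA) v) : u = v := by
  refine Lp.ext (Integrable.ae_eq_of_forall_setIntegral_eq _ _ ((Lp.memLp u).integrable one_le_two)
    ((Lp.memLp v).integrable one_le_two) fun A hA _ => ?_)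
  rw [← inner_indLp hA, ← inner_indLp hA, h A hA]

theorem nonneg_of_inner_indLp {u : Lp ℝ 2 μ} (h : ∀ (A : Set X) (hA : MeasurableSet A),
    0 ≤ inner ℝ (indLp μ hA) u) : 0 ≤ u := by
  rw [← Lp.coeFn_nonneg]
  refine ae_nonneg_of_forall_setIntegral_nonneg ((Lp.memLp u).integrable one_le_two)
    fun A hA _ => ?_
  rw [← inner_indLp hA]
  exact h A hA

theorem inner_indLp_nonneg {A : Set X} (hA : MeasurableSet A) {u : Lp ℝ 2 μ} (hu : 0 ≤ u) :
    0 ≤ inner ℝ (indLp μ hA) u := by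
  rw [inner_indLp]
  exact integral_nonneg_of_ae (ae_restrict_of_ae ((Lp.coeFn_nonneg u).2 hu))

theorem clm_ext_indLp {P Q : Lp ℝ 2 μ →L[ℝ] Lp ℝ 2 μ} (h : ∀ (A : Set X) (hA : MeasurableSet A),
    P (indLp μ hA) = Q (indLp μ hA)) : P = Q := by
  ext1 f
  refine Lp.induction ENNReal.ofNat_ne_top (motive := fun f => P f = Q f) ?_ ?_ ?_ f
  · intro c s hs hμs
    have h1 : (Lp.simpleFunc.indicatorConst 2 hs hμs.ne c : Lp ℝ 2 μ) = c • indLp μ hs := by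
      rw [Lp.simpleFunc.coe_indicatorConst]
      refine Lp.ext ?_
      filter_upwards [indicatorConstLp_coeFn (p := 2) (hs := hs) (hμs := hμs.ne) (c := c),
        Lp.coeFn_smul c (indLp μ hs), coeFn_indLp (μ := μ) hs] with x h1 h2 h3
      rw [h1, h2, Pi.smul_apply, h3]
      by_cases hx : x ∈ s <;> simp [hx]
    rw [h1, map_smul, map_smul, h]
  · intro f g hf hg _ h1 h2
    rw [map_add, map_add, h1, h2]
  · exact isClosed_eq P.continuous Q.continuous

/-- The operator `P` has the kernel `ν`. -/
def Represents (μ : Measure X) [IsProbabilityMeasure μ] (ν : Measure (X × X))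
    (P : Lp ℝ 2 μ →L[ℝ] Lp ℝ 2 μ) : Prop :=
  ∀ (A C : Set X) (hA : MeasurableSet A) (hC : MeasurableSet C),
    inner ℝ (indLp μ hA) (P (indLp μ hC)) = ν.real (A ×ˢ C)

theorem Represents.eq {ν : Measure (X × X)} {P Q : Lp ℝ 2 μ →L[ℝ] Lp ℝ 2 μ}
    (hP : Represents μ ν P) (hQ : Represents μ ν Q) : P = Q :=
  clm_ext_indLp fun C hC => eq_of_inner_indLp fun A hA => by rw [hP A C hA hC, hQ A C hA hC]

/-- Testing `P 1` and `P* 1` on indicators reads off the first and the second marginal of `ν`. -/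
theorem represents_one_iff {ν : Measure (X × X)} {P : Lp ℝ 2 μ →L[ℝ] Lp ℝ 2 μ}
    [IsFiniteMeasure ν] (hP : Represents μ ν P) :
    (P (Lp.const 2 μ 1) = Lp.const 2 μ 1 ↔ ν.map Prod.fst = μ) ∧
    (ContinuousLinearMap.adjoint P (Lp.const 2 μ 1) = Lp.const 2 μ 1 ↔ ν.map Prod.snd = μ) := by
  have h1 : ∀ (A : Set X) (hA : MeasurableSet A), inner ℝ (indLp μ hA) (Lp.const 2 μ (1 : ℝ))
      = μ.real A := fun A hA => by
    rw [← indLp_univ, inner_indLp_indLp hA MeasurableSet.univ, Set.inter_univ]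
  constructor
  · have h2 : ∀ (A : Set X) (hA : MeasurableSet A),
        inner ℝ (indLp μ hA) (P (Lp.const 2 μ (1 : ℝ))) = (ν.map Prod.fst).real A := fun A hA => by
      rw [← indLp_univ, hP A _ hA MeasurableSet.univ, Set.prod_univ,
        map_measureReal_apply measurable_fst hA]
    constructor
    · intro h
      ext A hA
      rw [← ENNReal.toReal_eq_toReal_iff' (measure_ne_top _ _) (measure_ne_top _ _)]
      change (ν.map Prod.fst).real A = μ.real A
      rw [← h2 A hA, h, h1]
    · intro h
      refine eq_of_inner_indLp fun A hA => ?_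
      rw [h2, h, h1]
  · have h2 : ∀ (A : Set X) (hA : MeasurableSet A),
        inner ℝ (indLp μ hA) (ContinuousLinearMap.adjoint P (Lp.const 2 μ (1 : ℝ)))
          = (ν.map Prod.snd).real A := fun A hA => by
      rw [ContinuousLinearMap.adjoint_inner_right, real_inner_comm, ← indLp_univ,
        hP _ A MeasurableSet.univ hA, Set.univ_prod, map_measureReal_apply measurable_snd hA]
    constructor
    · intro h
      ext A hA
      rw [← ENNReal.toReal_eq_toReal_iff' (measure_ne_top _ _) (measure_ne_top _ _)]
      change (ν.map Prod.snd).real A = μ.real A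
      rw [← h2 A hA, h, h1]
    · intro h
      refine eq_of_inner_indLp fun A hA => ?_
      rw [h2, h, h1]

variable {n : ℕ} [AddAction (Zn n) X] [MeasurableConstVAdd (Zn n) X]
  [VAddInvariantMeasure (Zn n) X μ]

theorem koopman_indLp (z : Zn n) {A : Set X} (hA : MeasurableSet A) :
    koopman μ z (indLp μ hA) = indLp μ (measurable_const_vadd z hA) := rfl

theorem inner_koopman_koopman (z : Zn n) (f g : Lp ℝ 2 μ) :
    inner ℝ (koopman μ z f) (koopman μ z g) = inner ℝ f g :=
  LinearIsometry.inner_map_map _ f g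

theorem inner_indLp_koopman (z : Zn n) {A : Set X} (hA : MeasurableSet A) (f : Lp ℝ 2 μ) :
    inner ℝ (indLp μ hA) (koopman μ z f) =
      inner ℝ (indLp μ (measurable_const_vadd (-z) hA)) f := by
  rw [← inner_koopman_koopman z (indLp μ (measurable_const_vadd (-z) hA)) f, koopman_indLp]
  congr 2
  ext x
  simp

/-- Tested on indicators, commutation moves the action from one side of a rectangle to the other,
which is invariance on rectangles. -/
theorem represents_comm_iff {ν : Measure (X × X)} {P : Lp ℝ 2 μ →L[ℝ] Lp ℝ 2 μ}
    [IsFiniteMeasure ν] (hP : Represents μ ν P) :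
    (∀ z : Zn n, P ∘L koopman μ z = koopman μ z ∘L P) ↔
      VAddInvariantMeasure (Zn n) (X × X) ν := by
  have h1 : ∀ (z : Zn n) (A C : Set X) (hA : MeasurableSet A) (hC : MeasurableSet C),
      inner ℝ (indLp μ hA) ((P ∘L koopman μ z) (indLp μ hC)) = ν.real (A ×ˢ ((z +ᵥ ·) ⁻¹' C)) :=
    fun z A C hA hC => by
      rw [ContinuousLinearMap.comp_apply, koopman_indLp, hP]
  have h2 : ∀ (z : Zn n) (A C : Set X) (hA : MeasurableSet A) (hC : MeasurableSet C),
      inner ℝ (indLp μ hA) ((koopman μ z ∘L P) (indLp μ hC)) =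
        ν.real (((-z +ᵥ ·) ⁻¹' A) ×ˢ C) :=
    fun z A C hA hC => by
      rw [ContinuousLinearMap.comp_apply, inner_indLp_koopman, hP]
  constructor
  · intro h
    refine vaddInvariantMeasure_of_map fun z => ?_
    have := Measure.isFiniteMeasure_map ν (fun q : X × X => z +ᵥ q)
    refine Measure.ext_prod fun {A C} hA hC => ?_
    rw [← ENNReal.toReal_eq_toReal_iff' (measure_ne_top _ _) (measure_ne_top _ _)]
    rw [Measure.map_apply (measurable_const_vadd z) (hA.prod hC)]
    have h3 := h1 z _ C (measurable_const_vadd z hA) hC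
    rw [h z, h2] at h3
    have h4 : (fun q : X × X => z +ᵥ q) ⁻¹' (A ×ˢ C)
      = ((z +ᵥ ·) ⁻¹' A) ×ˢ ((z +ᵥ ·) ⁻¹' C) := rfl
    have h5 : ((-z +ᵥ ·) ⁻¹' ((z +ᵥ ·) ⁻¹' A) : Set X) = A := by
      ext x; simp
    rw [h5] at h3
    rw [h4]
    exact h3.symm
  · intro h z
    refine clm_ext_indLp fun C hC => eq_of_inner_indLp fun A hA => ?_
    rw [h1, h2]
    have h4 : (A ×ˢ ((z +ᵥ ·) ⁻¹' C) : Set (X × X))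
        = (fun q : X × X => z +ᵥ q) ⁻¹' (((-z +ᵥ ·) ⁻¹' A) ×ˢ C) := by
      ext ⟨x, y⟩
      simp [Set.mem_prod]
    rw [h4, measureReal_def, measureReal_def, measure_preimage_vadd]

/-- The operator of a self-joining. -/
theorem IsSelfJoining.exists_represents {ν : Measure (X × X)} (h : IsSelfJoining n μ ν) :
    ∃ P ∈ markovCentralizer n μ, ‖P‖ ≤ 1 ∧ Represents μ ν P := by
  have := h.isProbabilityMeasure
  have := h.inv
  have h1 : MeasurePreserving Prod.fst ν μ := ⟨measurable_fst, h.map_fst⟩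
  have h2 : MeasurePreserving Prod.snd ν μ := ⟨measurable_snd, h.map_snd⟩
  set V := (Lp.compMeasurePreservingₗᵢ (p := 2) (E := ℝ) ℝ Prod.fst h1).toContinuousLinearMap with hV
  set W := (Lp.compMeasurePreservingₗᵢ (p := 2) (E := ℝ) ℝ Prod.snd h2).toContinuousLinearMap with hW
  -- Lift `f` to a function of the second coordinate and project to functions of the first: the
  -- conditional expectation under `ν`.
  set P := ContinuousLinearMap.adjoint V ∘L W with hPdef
  have hin : ∀ f g, inner ℝ f (P g) = inner ℝ (V f) (W g) := fun f g => by
    rw [hPdef, ContinuousLinearMap.comp_apply, ContinuousLinearMap.adjoint_inner_right]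
  have hVind : ∀ (A : Set X) (hA : MeasurableSet A), V (indLp μ hA) = indLp ν (measurable_fst hA) :=
    fun A hA => rfl
  have hWind : ∀ (A : Set X) (hA : MeasurableSet A), W (indLp μ hA) = indLp ν (measurable_snd hA) :=
    fun A hA => rfl
  have hrep : Represents μ ν P := fun A C hA hC => by
    rw [hin, hVind, hWind, inner_indLp_indLp]
    rfl
  have hone := represents_one_iff hrep
  refine ⟨P, ⟨⟨fun f hf => ?_, hone.1.2 h.map_fst, hone.2.2 h.map_snd⟩,
    (represents_comm_iff hrep).2 h.inv⟩, ?_, hrep⟩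
  · refine nonneg_of_inner_indLp fun A hA => ?_
    rw [hin, hVind, inner_indLp]
    refine integral_nonneg_of_ae (ae_restrict_of_ae ?_)
    have h3 : W f =ᵐ[ν] f ∘ Prod.snd := Lp.coeFn_compMeasurePreserving f h2
    have h4 : ∀ᵐ q ∂ν, 0 ≤ f q.2 :=
      ae_of_ae_map measurable_snd.aemeasurable (by
        rw [h.map_snd]
        exact (Lp.coeFn_nonneg f).2 hf)
    filter_upwards [h3, h4] with q hq hq'
    rw [hq]
    exact hq'
  · have hV1 : ‖V‖ ≤ 1 := LinearIsometry.norm_toContinuousLinearMap_le _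
    have hW1 : ‖W‖ ≤ 1 := LinearIsometry.norm_toContinuousLinearMap_le _
    calc ‖P‖ ≤ ‖ContinuousLinearMap.adjoint V‖ * ‖W‖ := ContinuousLinearMap.opNorm_comp_le _ _
      _ = ‖V‖ * ‖W‖ := by rw [LinearIsometryEquiv.norm_map]
      _ ≤ 1 := mul_le_one₀ hV1 (norm_nonneg _) hW1

theorem Represents.isSelfJoining {ν : Measure (X × X)} [IsFiniteMeasure ν]
    {P : Lp ℝ 2 μ →L[ℝ] Lp ℝ 2 μ} (hP : Represents μ ν P) (h : P ∈ markovCentralizer n μ) :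
    IsSelfJoining n μ ν :=
  ⟨(represents_one_iff hP).1.1 h.1.map_one, (represents_one_iff hP).2.1 h.1.adjoint_one,
    (represents_comm_iff hP).1 h.2⟩

/-- Commutation lets `koopman μ z` act before `P`, that is on the second coordinate. -/
theorem Represents.shift {ν : Measure (X × X)} {P : Lp ℝ 2 μ →L[ℝ] Lp ℝ 2 μ}
    (hP : Represents μ ν P) (h : P ∈ markovCentralizer n μ) (z : Zn n) :
    Represents μ (shift z ν) (koopman μ z ∘L P) := fun A C hA hC => by
  rw [← h.2 z, ContinuousLinearMap.comp_apply, koopman_indLp, hP, ZnAction.shift,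
    map_measureReal_apply (measurable_shift z) (hA.prod hC)]
  rfl

/-- Countable convex combinations of Markov operators in the centralizer are in the
centralizer. -/
theorem mem_markovCentralizer_of_hasSum {ι : Type*} {c : ι → ℝ} (hc : ∀ i, 0 ≤ c i)
    (hc1 : HasSum c 1) {P : ι → (Lp ℝ 2 μ →L[ℝ] Lp ℝ 2 μ)}
    (hP : ∀ i, P i ∈ markovCentralizer n μ) {Q : Lp ℝ 2 μ →L[ℝ] Lp ℝ 2 μ}
    (hQ : HasSum (fun i => c i • P i) Q) : Q ∈ markovCentralizer n μ := by
  have happ : ∀ f, HasSum (fun i => c i • P i f) (Q f) := fun f =>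
    hQ.mapL (ContinuousLinearMap.apply ℝ (Lp ℝ 2 μ) f)
  have hone : HasSum (fun i => c i • Lp.const 2 μ (1 : ℝ)) (Lp.const 2 μ (1 : ℝ)) := by
    simpa using hc1.smul_const (Lp.const 2 μ (1 : ℝ))
  refine ⟨⟨fun f hf => ?_, ?_, ?_⟩, fun z => ?_⟩
  · refine nonneg_of_inner_indLp fun A hA => ?_
    refine ((happ f).mapL (innerSL ℝ (indLp μ hA))).nonneg fun i => ?_
    rw [map_smul]
    exact mul_nonneg (hc i) (inner_indLp_nonneg hA ((hP i).1.nonneg f hf))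
  · refine (happ _).unique ?_
    simpa only [(hP _).1.map_one] using hone
  · refine HasSum.unique (f := fun i => c i • Lp.const 2 μ (1 : ℝ)) ?_ hone
    -- Over `ℝ` the adjoint is linear and continuous, so it passes through the norm convergent sum.
    have h1 := hQ.mapL ((ContinuousLinearMap.apply ℝ (Lp ℝ 2 μ) (Lp.const 2 μ (1 : ℝ))) ∘L
      (ContinuousLinearMap.adjoint (𝕜 := ℝ) (E := Lp ℝ 2 μ) (F := Lp ℝ 2 μ)).toContinuousLinearEquiv.toContinuousLinearMap)
    simpa [(hP _).1.adjoint_one] using h1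
  · ext1 f
    rw [ContinuousLinearMap.comp_apply, ContinuousLinearMap.comp_apply]
    refine (happ _).unique ?_
    have h1 := (happ f).mapL (koopman μ z)
    have h2 : (fun i => c i • P i (koopman μ z f)) = fun i => koopman μ z (c i • P i f) :=
      funext fun i => by
        rw [map_smul]
        exact congrArg (c i • ·) (congrArg (fun T => T f) ((hP i).2 z))
    rw [h2]
    exact h1

end Operators

/-! ### Constructing a kernel for a Markov operator -/

section MarkovKernels

set_option linter.unusedSectionVars false

universe u

/-- A monotone family with the right integrals is almost surely a distribution function. -/
theorem ae_isRatStieltjesPoint {Ω : Type*} [MeasurableSpace Ω] {μ : Measure Ω}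
    [IsProbabilityMeasure μ] {m : Measure ℝ} [IsProbabilityMeasure m] {F : Ω → ℚ → ℝ}
    (hF : ∀ q, Integrable (fun ω => F ω q) μ)
    (hmono : ∀ q r, q ≤ r → ∀ᵐ ω ∂μ, F ω q ≤ F ω r) (h0 : ∀ q, ∀ᵐ ω ∂μ, 0 ≤ F ω q)
    (h1 : ∀ q, ∀ᵐ ω ∂μ, F ω q ≤ 1) (hI : ∀ q : ℚ, ∫ ω, F ω q ∂μ = m.real (Set.Iic (q : ℝ))) :
    ∀ᵐ ω ∂μ, IsRatStieltjesPoint F ω := by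
  have hmono' : ∀ᵐ ω ∂μ, Monotone (F ω) := by
    have : ∀ᵐ ω ∂μ, ∀ q r, q ≤ r → F ω q ≤ F ω r := by
      refine ae_all_iff.2 fun q => ae_all_iff.2 fun r => ?_
      by_cases hqr : q ≤ r
      · filter_upwards [hmono q r hqr] with ω hω _ using hω
      · exact ae_of_all _ fun ω h => absurd h hqr
    exact this
  have hcdf : ∀ q : ℚ, ∫ ω, F ω q ∂μ = cdf m q := fun q => by rw [hI, cdf_eq_real]
  -- For a monotone sequence bounded by an integrable function, convergence of the integrals to its
  -- integral gives almost sure convergence to it. The limit at `-∞` and right continuity are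
  -- obtained in the same way.
  have htop : ∀ᵐ ω ∂μ, Tendsto (fun k : ℕ => F ω k) atTop (𝓝 1) := by
    refine tendsto_of_integral_tendsto_of_monotone (F := fun _ => 1) (fun k => hF _)
      (integrable_const _) ?_ ?_ (ae_all_iff.2 fun k => h1 k)
    · simp only [hcdf, integral_const, probReal_univ, smul_eq_mul, mul_one, Rat.cast_natCast]
      exact (tendsto_cdf_atTop m).comp tendsto_natCast_atTop_atTop
    · filter_upwards [hmono'] with ω hω i j hij
      exact hω (Nat.cast_le.2 hij)
  have hbot : ∀ᵐ ω ∂μ, Tendsto (fun k : ℕ => F ω (-k)) atTop (𝓝 0) := by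
    refine tendsto_of_integral_tendsto_of_antitone (F := fun _ => 0) (fun k => hF _)
      (integrable_const _) ?_ ?_ (ae_all_iff.2 fun k => h0 _)
    · simp only [hcdf, integral_const, smul_zero, Rat.cast_neg, Rat.cast_natCast]
      exact (tendsto_cdf_atBot m).comp (tendsto_neg_atTop_atBot.comp tendsto_natCast_atTop_atTop)
    · filter_upwards [hmono'] with ω hω i j hij
      exact hω (neg_le_neg (Nat.cast_le.2 hij))
  have hright : ∀ᵐ ω ∂μ, ∀ t : ℚ, Tendsto (fun k : ℕ => F ω (t + 1 / (k + 1))) atTop (𝓝 (F ω t)) := by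
    refine ae_all_iff.2 fun t => ?_
    have hanti : Antitone fun k : ℕ => t + 1 / ((k : ℚ) + 1) := fun i j hij => by
      dsimp only
      gcongr
    refine tendsto_of_integral_tendsto_of_antitone (F := fun ω => F ω t) (fun k => hF _)
      (hF t) ?_ ?_ ?_
    · simp only [hcdf]
      have h2 : ContinuousWithinAt (cdf m) (Set.Ici (t : ℝ)) t := (cdf m).right_continuous t
      refine h2.tendsto.comp (tendsto_nhdsWithin_iff.2 ⟨?_, Eventually.of_forall fun k => ?_⟩)
      · have h3 := (tendsto_one_div_add_atTop_nhds_zero_nat (𝕜 := ℝ)).const_add (t : ℝ)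
        rw [add_zero] at h3
        refine h3.congr fun k => ?_
        push_cast
        rfl
      · rw [Set.mem_Ici, Rat.cast_le]
        have : (0 : ℚ) ≤ 1 / ((k : ℚ) + 1) := by positivity
        linarith
    · filter_upwards [hmono'] with ω hω i j hij
      exact hω (hanti hij)
    · filter_upwards [hmono'] with ω hω k
      refine hω ?_
      have : (0 : ℚ) ≤ 1 / ((k : ℚ) + 1) := by positivity
      linarith
  filter_upwards [hmono', htop, hbot, hright, ae_all_iff.2 h0] with ω hm ht hb hr hnn
  refine ⟨hm, (tendsto_iff_tendsto_subseq_of_monotone hm tendsto_natCast_atTop_atTop).2 ht, ?_,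
    fun t => ?_⟩
  · have h2 : Antitone fun q : ℚ => F ω (-q) := fun q r hqr => hm (neg_le_neg hqr)
    have h3 := (tendsto_iff_tendsto_subseq_of_antitone h2
      (tendsto_natCast_atTop_atTop (R := ℚ))).2 hb
    have h4 := h3.comp tendsto_neg_atBot_atTop
    refine h4.congr fun q => ?_
    simp
  · have hbdd : BddBelow (Set.range fun r : Set.Ioi t => F ω r) :=
      ⟨0, by rintro _ ⟨r, rfl⟩; exact hnn r⟩
    refine le_antisymm (ge_of_tendsto (hr t) (Eventually.of_forall fun k => ?_)) ?_
    · have h2 : t < t + 1 / ((k : ℚ) + 1) := by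
        have : (0 : ℚ) < 1 / ((k : ℚ) + 1) := by positivity
        linarith
      exact ciInf_le hbdd ⟨_, h2⟩
    · have : Nonempty (Set.Ioi t) := ⟨⟨t + 1, by simp⟩⟩
      exact le_ciInf fun r => hm (le_of_lt r.2)

/-- A π-λ argument. The kernel is built from values on rational half-lines, and this extends the
identity to all Borel sets. -/
theorem setIntegral_preimage_eq_of_Iic {Ω Ω' : Type*} [MeasurableSpace Ω] [MeasurableSpace Ω']
    {m : Measure Ω} {m' : Measure Ω'} {u : Ω → ℝ} {v : Ω' → ℝ} (hu : Integrable u m)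
    (hv : Integrable v m') {p : Ω → ℝ} {q : Ω' → ℝ} (hp : Measurable p) (hq : Measurable q)
    (huniv : ∫ x, u x ∂m = ∫ x, v x ∂m')
    (h : ∀ r : ℚ, ∫ x in p ⁻¹' Set.Iic (r : ℝ), u x ∂m = ∫ x in q ⁻¹' Set.Iic (r : ℝ), v x ∂m')
    {D : Set ℝ} (hD : MeasurableSet D) : ∫ x in p ⁻¹' D, u x ∂m = ∫ x in q ⁻¹' D, v x ∂m' := by
  have hb : (inferInstance : MeasurableSpace ℝ) = .generateFrom (⋃ a : ℚ, {Set.Iic (a : ℝ)}) := by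
    rw [← Real.borel_eq_generateFrom_Iic_rat]
    exact BorelSpace.measurable_eq
  induction D, hD using MeasurableSpace.induction_on_inter hb Real.isPiSystem_Iic_rat with
  | empty => simp
  | basic D hD =>
    obtain ⟨r, hr⟩ := Set.mem_iUnion.1 hD
    rw [Set.mem_singleton_iff.1 hr]
    exact h r
  | compl D hD ih =>
    rw [Set.preimage_compl, Set.preimage_compl, setIntegral_compl (hp hD) hu,
      setIntegral_compl (hq hD) hv, huniv, ih]
  | iUnion D hdisj hD ih =>
    rw [Set.preimage_iUnion, Set.preimage_iUnion]
    have h1 := hasSum_integral_iUnion (fun i => hp (hD i))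
      (fun i j hij => (hdisj hij).preimage p) hu.integrableOn
    have h2 := hasSum_integral_iUnion (fun i => hq (hD i))
      (fun i j hij => (hdisj hij).preimage q) hv.integrableOn
    refine h1.unique ?_
    simpa only [ih] using h2

variable {X : Type u} [MeasurableSpace X] {μ : Measure X} [IsProbabilityMeasure μ]

theorem indLp_mono {A C : Set X} (hA : MeasurableSet A) (hC : MeasurableSet C) (h : A ⊆ C) :
    0 ≤ indLp μ hC - indLp μ hA := by
  refine nonneg_of_inner_indLp fun B hB => ?_
  rw [inner_sub_right, inner_indLp_indLp, inner_indLp_indLp, sub_nonneg]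
  exact measureReal_mono (Set.inter_subset_inter_right B h)

/-- A Markov operator on a standard Borel space has a kernel. -/
theorem IsMarkov.exists_represents [StandardBorelSpace X] {P : Lp ℝ 2 μ →L[ℝ] Lp ℝ 2 μ}
    (hP : IsMarkov μ P) : ∃ ν : Measure (X × X), IsFiniteMeasure ν ∧ Represents μ ν P := by
  have := nonempty_of_isProbabilityMeasure μ
  set e := embeddingReal X
  have he : MeasurableEmbedding e := measurableEmbedding_embeddingReal X
  obtain ⟨g, hg, hge⟩ := he.exists_measurable_extend measurable_id fun _ => ‹Nonempty X›
  have hmono : ∀ {A C : Set X} (hA : MeasurableSet A) (hC : MeasurableSet C), A ⊆ C →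
      ∀ᵐ x ∂μ, P (indLp μ hA) x ≤ P (indLp μ hC) x := fun hA hC hAC => by
    have h1 := hP.nonneg _ (indLp_mono hA hC hAC)
    rw [map_sub, sub_nonneg, ← Lp.coeFn_le] at h1
    exact h1
  have hone : ∀ᵐ x ∂μ, P (indLp μ MeasurableSet.univ) x = 1 := by
    rw [indLp_univ, hP.map_one]
    exact Lp.coeFn_const 2 μ 1
  have hnn : ∀ {A : Set X} (hA : MeasurableSet A), ∀ᵐ x ∂μ, 0 ≤ P (indLp μ hA) x := fun hA => by
    refine (Lp.coeFn_nonneg _).2 (hP.nonneg _ (nonneg_of_inner_indLp fun B hB => ?_))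
    rw [inner_indLp_indLp]
    exact measureReal_nonneg
  have hint : ∀ f : Lp ℝ 2 μ, Integrable f μ := fun f => (Lp.memLp f).integrable one_le_two
  have hD : ∀ q : ℚ, MeasurableSet (e ⁻¹' Set.Iic (q : ℝ)) := fun q => he.measurable measurableSet_Iic
  -- The would-be conditional distribution functions of the second coordinate, transported to `ℝ`.
  -- Positivity of `P` gives monotonicity, `P 1 = 1` the upper bound, and `P* 1 = 1` the integrals
  -- required by `ae_isRatStieltjesPoint`.
  set F : X → ℚ → ℝ := fun x q => P (indLp μ (hD q)) x with hFdef
  have hF : Measurable F := measurable_pi_iff.2 fun q => (Lp.stronglyMeasurable _).measurable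
  have : IsProbabilityMeasure (μ.map e) := Measure.isProbabilityMeasure_map he.measurable.aemeasurable
  have hpt := ae_isRatStieltjesPoint (m := μ.map e) (F := F) (fun q => hint _)
    (fun q r hqr => hmono _ _ (Set.preimage_mono (Set.Iic_subset_Iic.2 (Rat.cast_le.2 hqr))))
    (fun q => hnn _)
    (fun q => by
      filter_upwards [hone, hmono (hD q) MeasurableSet.univ (Set.subset_univ _)] with x h1 h2
      rwa [h1] at h2)
    (fun q => by
      have h1 := inner_indLp (MeasurableSet.univ) (P (indLp μ (hD q)))
      rw [Measure.restrict_univ, ← ContinuousLinearMap.adjoint_inner_left, indLp_univ,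
        hP.adjoint_one, ← indLp_univ, inner_indLp_indLp, Set.univ_inter] at h1
      rw [map_measureReal_apply he.measurable measurableSet_Iic, h1])
  set κ : Kernel X ℝ := ⟨fun x => (stieltjesOfMeasurableRat F hF x).measure,
    measurable_measure_stieltjesOfMeasurableRat hF⟩ with hκ
  have : IsMarkovKernel κ := ⟨fun x => instIsProbabilityMeasure_stieltjesOfMeasurableRat hF x⟩
  have hκF : ∀ q : ℚ, ∀ᵐ x ∂μ, (κ x).real (Set.Iic (q : ℝ)) = F x q := fun q => by
    filter_upwards [hpt, hnn (hD q)] with x hx hx0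
    have h1 : κ x (Set.Iic (q : ℝ)) = ENNReal.ofReal (F x q) := by
      change (stieltjesOfMeasurableRat F hF x).measure _ = _
      rw [measure_stieltjesOfMeasurableRat_Iic, stieltjesOfMeasurableRat_eq,
        toRatCDF_of_isRatStieltjesPoint hx]
    rw [measureReal_def, h1, ENNReal.toReal_ofReal hx0]
  set ν' := μ ⊗ₘ κ with hν'
  have hrect : ∀ (A : Set X) (hA : MeasurableSet A) (D : Set ℝ) (hD : MeasurableSet D),
      ν'.real (A ×ˢ D) = ∫ x in A, (κ x).real D ∂μ := fun A hA D hD => by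
    rw [measureReal_def, hν', Measure.compProd_apply_prod hA hD,
      ← integral_toReal (κ.measurable_coe hD).aemeasurable (ae_of_all _ fun x => measure_lt_top _ _)]
    rfl
  have hgm : Measurable fun p : X × ℝ => (p.1, g p.2) :=
    measurable_fst.prodMk (hg.comp measurable_snd)
  refine ⟨ν'.map fun p => (p.1, g p.2), inferInstance, fun A C hA hC => ?_⟩
  have hu : Integrable (ContinuousLinearMap.adjoint P (indLp μ hA)) μ := hint _
  -- Passing to the adjoint makes the dependence on `B` the integral of a fixed function over `B`,
  -- hence countably additive, as the π-λ argument needs.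
  have hPu : ∀ (B : Set X) (hB : MeasurableSet B),
      ∫ x in B, ContinuousLinearMap.adjoint P (indLp μ hA) x ∂μ =
        ∫ x in A, P (indLp μ hB) x ∂μ := fun B hB => by
    rw [← inner_indLp hB, ← inner_indLp hA, ContinuousLinearMap.adjoint_inner_right,
      real_inner_comm]
  have hone' : ∀ D : Set ℝ, MeasurableSet D →
      ∫ p in Prod.snd ⁻¹' D, (1 : ℝ) ∂(ν'.restrict (A ×ˢ Set.univ)) = ν'.real (A ×ˢ D) :=
    fun D hD => by
      rw [setIntegral_one_eq_measureReal, measureReal_restrict_apply (measurable_snd hD)]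
      congr 1
      ext p
      simp [and_comm]
  have hkey := setIntegral_preimage_eq_of_Iic (m' := ν'.restrict (A ×ˢ Set.univ)) (v := fun _ => 1)
    hu (integrable_const _) he.measurable measurable_snd (by
      have h1 := hPu Set.univ MeasurableSet.univ
      have h2 := hone' Set.univ MeasurableSet.univ
      rw [Set.preimage_univ, Measure.restrict_univ, hrect A hA _ MeasurableSet.univ] at h2
      rw [Measure.restrict_univ] at h1
      rw [h1, h2]
      refine setIntegral_congr_ae hA ?_
      filter_upwards [hone] with x hx _
      rw [hx, probReal_univ])
    (fun q => by
      rw [hPu _ (hD q), hone' _ measurableSet_Iic, hrect A hA _ measurableSet_Iic]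
      refine setIntegral_congr_ae hA ?_
      filter_upwards [hκF q] with x hx _
      rw [hx])
    (hg hC)
  have hC' : e ⁻¹' (g ⁻¹' C) = C := by rw [← Set.preimage_comp, hge, Set.preimage_id]
  rw [hC', hPu C hC, hone' _ (hg hC)] at hkey
  rw [inner_indLp, hkey, map_measureReal_apply hgm (hA.prod hC)]
  rfl

end MarkovKernels

/-! ### Generators of the Markov centralizer -/

section Generators

set_option linter.unusedSectionVars false

universe u

variable {n : ℕ} {X : Type u} [MeasurableSpace X] [AddAction (Zn n) X]
  [MeasurableConstVAdd (Zn n) X]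

/-- Pairing with indicators is continuous in the operator, so the sums match on every rectangle. -/
theorem represents_tsum {μ : Measure X} [IsProbabilityMeasure μ] {ι : Type*} [Countable ι]
    {ν : ι → Measure (X × X)} [∀ i, IsProbabilityMeasure (ν i)] {c : ι → ℝ≥0∞} (hc : ∑' i, c i = 1)
    {P : ι → (Lp ℝ 2 μ →L[ℝ] Lp ℝ 2 μ)} (hP : ∀ i, Represents μ (ν i) (P i))
    {Q : Lp ℝ 2 μ →L[ℝ] Lp ℝ 2 μ} (hQ : HasSum (fun i => (c i).toReal • P i) Q) :
    Represents μ (Measure.sum fun i => c i • ν i) Q := fun A C hA hC => by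
  have htop : ∀ i, c i ≠ ∞ := ENNReal.ne_top_of_tsum_ne_top (by rw [hc]; exact ENNReal.one_ne_top)
  have h1 : HasSum (fun i => (c i).toReal * (ν i).real (A ×ˢ C))
      (inner ℝ (indLp μ hA) (Q (indLp μ hC))) := by
    have h2 := (hQ.mapL (ContinuousLinearMap.apply ℝ (Lp ℝ 2 μ) (indLp μ hC))).mapL
      (innerSL ℝ (indLp μ hA))
    have h4 : ∀ i, inner ℝ (indLp μ hA) (((c i).toReal • P i) (indLp μ hC)) =
        (c i).toReal * (ν i).real (A ×ˢ C) := fun i => by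
      rw [smul_apply, inner_smul_right, hP i A C hA hC]
    simp only [← h4]
    exact h2
  have h3 : (Measure.sum fun i => c i • ν i).real (A ×ˢ C)
      = ∑' i, (c i).toReal * (ν i).real (A ×ˢ C) := by
    rw [measureReal_def, Measure.sum_apply _ (hA.prod hC), ENNReal.tsum_toReal_eq]
    · refine tsum_congr fun i => ?_
      rw [Measure.smul_apply, smul_eq_mul, ENNReal.toReal_mul, measureReal_def]
    · intro i
      exact ENNReal.mul_ne_top (htop i) (measure_ne_top _ _)
  rw [h3, h1.tsum_eq]

/-- The Markov centralizer is generated by the action and finitely many operators. -/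
theorem exists_markovCentralizer_generators [StandardBorelSpace X] {μ : Measure X}
    [IsProbabilityMeasure μ] {K₀ : ℕ} (hkey : HasClosePairs n μ K₀)
    [ErgodicVAdd (Zn n) X μ] [ErgodicVAdd (Zn n) (X × X) (μ.prod μ)] :
    ∃ (m : ℕ) (P : Fin m → (Lp ℝ 2 μ →L[ℝ] Lp ℝ 2 μ)), (∀ i, P i ∈ markovCentralizer n μ) ∧
      ∀ Q : Lp ℝ 2 μ →L[ℝ] Lp ℝ 2 μ, Q ∈ markovCentralizer n μ ↔
        ∃ c : Fin m × Zn n → ℝ, (∀ p, 0 ≤ c p) ∧ HasSum c 1 ∧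
          HasSum (fun p => c p • (koopman μ p.2 ∘L P p.1)) Q := by
  obtain ⟨F, hF, hFerg, hFr⟩ := exists_finite_classes hkey
  have hcount := countable_isErgodicSelfJoining hF hFr
  have := hF.to_subtype
  obtain ⟨m, ⟨σ⟩⟩ := Finite.exists_equiv_fin F
  have hν : ∀ i, IsErgodicSelfJoining n μ (σ.symm i : Measure (X × X)) := fun i =>
    hFerg _ (σ.symm i).2
  choose P hPmem hPnorm hPrep using fun i => (hν i).isSelfJoining.exists_represents
  set T : Fin m × Zn n → (Lp ℝ 2 μ →L[ℝ] Lp ℝ 2 μ) := fun p => koopman μ p.2 ∘L P p.1 with hT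
  have hTrep : ∀ p, Represents μ (shift p.2 (σ.symm p.1 : Measure (X × X))) (T p) := fun p =>
    (hPrep p.1).shift (hPmem p.1) p.2
  have hTmem : ∀ p, T p ∈ markovCentralizer n μ ∧ ‖T p‖ ≤ 1 := fun p => by
    obtain ⟨P', h1, h2, h3⟩ := ((hν p.1).shift p.2).isSelfJoining.exists_represents
    rw [(hTrep p).eq h3]
    exact ⟨h1, h2⟩
  refine ⟨m, P, hPmem, fun Q => ⟨fun hQ => ?_, ?_⟩⟩
  · obtain ⟨ν, hνfin, hνrep⟩ := hQ.1.exists_represents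
    have hνj := hνrep.isSelfJoining hQ
    have hνprob := hνj.isProbabilityMeasure
    obtain ⟨c, hc⟩ := hνj.exists_eq_sum hkey hcount
    have := hcount.to_subtype
    have hr : ∀ e : {e : Measure (X × X) | IsErgodicSelfJoining n μ e}, ∃ p : Fin m × Zn n,
        (e : Measure (X × X)) = shift p.2 (σ.symm p.1 : Measure (X × X)) := fun e => by
      obtain ⟨ν', h1, z, h2⟩ := hFr e e.2
      exact ⟨(σ ⟨ν', h1⟩, z), by simpa using h2⟩
    choose r hr using hr
    -- Different pairs may name one joining, since `μ × μ` equals all its shifts. So `r` chooses one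
    -- name for each, and the coefficients are extended by zero to unused names.
    have hrinj : Function.Injective r := fun e e' h => Subtype.ext (by rw [hr e, hr e', h])
    have hprob : ∀ e : {e : Measure (X × X) | IsErgodicSelfJoining n μ e},
        IsProbabilityMeasure (e : Measure (X × X)) := fun e =>
      IsErgodicSelfJoining.isProbabilityMeasure (n := n) (μ := μ) e.2
    have hc1 : ∑' e, c e = 1 := by
      have h1 := congrArg (fun m : Measure (X × X) => m Set.univ) hc
      simpa [Measure.sum_apply] using h1.symm
    have hcsum : HasSum (fun e => (c e).toReal) 1 := by
      have h1 := ENNReal.hasSum_toReal (f := c) (by rw [hc1]; exact ENNReal.one_ne_top)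
      rwa [← ENNReal.tsum_toReal_eq (ENNReal.ne_top_of_tsum_ne_top
        (by rw [hc1]; exact ENNReal.one_ne_top)), hc1, ENNReal.toReal_one] at h1
    -- Convergence is in operator norm: the weights sum to one and all `T p` are contractions. The
    -- sum is `Q` because both operators represent `ν`.
    have hsummable : Summable fun e => (c e).toReal • T (r e) := by
      refine Summable.of_norm_bounded hcsum.summable fun e => ?_
      rw [norm_smul, Real.norm_of_nonneg ENNReal.toReal_nonneg]
      exact mul_le_of_le_one_right ENNReal.toReal_nonneg (hTmem _).2
    have hQsum : HasSum (fun e => (c e).toReal • T (r e)) Q := by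
      have h1 := hsummable.hasSum
      have h2 := represents_tsum (ν := fun e : {e : Measure (X × X) | IsErgodicSelfJoining n μ e} =>
        (e : Measure (X × X))) hc1 (fun e => by
          have h3 := hTrep (r e)
          rwa [← hr e] at h3) h1
      rw [← hc] at h2
      rwa [← hνrep.eq h2] at h1
    refine ⟨Function.extend r (fun e => (c e).toReal) 0, fun p => ?_, ?_, ?_⟩
    · by_cases hp : ∃ e, r e = p
      · obtain ⟨e, rfl⟩ := hp
        rw [hrinj.extend_apply]
        exact ENNReal.toReal_nonneg
      · rw [Function.extend_apply' _ _ _ hp]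
        rfl
    · exact (hasSum_extend_zero hrinj).2 hcsum
    · refine (hrinj.hasSum_iff fun p hp => ?_).1 ?_
      · rw [Function.extend_apply' _ _ _ hp]
        exact zero_smul _ _
      · simpa only [Function.comp_def, hrinj.extend_apply] using hQsum
  · rintro ⟨c, hc, hc1, hQ⟩
    exact mem_markovCentralizer_of_hasSum hc hc1 (fun p => (hTmem p).1) hQ

end Generators

/-! ### From the suprema to an actual mixing constant and actual towers -/

section Constants

set_option linter.unusedSectionVars false

variable {n : ℕ} {X : Type*} [MeasurableSpace X] [AddAction (Zn n) X]
  [MeasurableConstVAdd (Zn n) X]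

/-- Attainment of the suprema is not needed: `a` and `b` each lose less than half of the excess over
one. Positivity of `a` follows from `b ≤ 1`. -/
theorem exists_of_one_lt_mixingConstant_add_localRank {μ : Measure X} [IsProbabilityMeasure μ]
    (h : 1 < mixingConstant n μ + localRank n μ) :
    ∃ a b : ℝ, 0 < a ∧ a ≤ 1 ∧ PartiallyMixing n μ a ∧ 1 < a + b ∧
      ∃ ξ : ℕ → TowerPartition n X, Approximating μ ξ ∧
        Tendsto (fun j => μ.real (ξ j).tower) atTop (𝓝 b) := by
  set S := {a : ℝ | 0 ≤ a ∧ a ≤ 1 ∧ ∀ A B : Set X, MeasurableSet A → MeasurableSet B →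
    ENNReal.ofReal a * μ A * μ B ≤ liminf (fun z : Zn n => μ (A ∩ translate z B)) cofinite} with hS
  set R := {b : ℝ | ∃ ξ : ℕ → TowerPartition n X, Approximating μ ξ ∧
    Tendsto (fun j => μ.real (ξ j).tower) atTop (𝓝 b)} with hR
  have hSne : S.Nonempty := ⟨0, le_rfl, zero_le_one, fun A B _ _ => by simp⟩
  have hSle : sSup S ≤ 1 := csSup_le hSne fun a ha => ha.2.1
  have hRle : ∀ b ∈ R, b ≤ 1 := by
    rintro b ⟨ξ, -, hb⟩
    exact le_of_tendsto hb (Eventually.of_forall fun j => measureReal_le_one)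
  have h' : 1 < sSup S + sSup R := h
  -- The supremum of the empty set of reals is zero, so without towers the sum would be at most one.
  have hRne : R.Nonempty := by
    by_contra hne
    rw [Set.not_nonempty_iff_eq_empty] at hne
    rw [hne, Real.sSup_empty] at h'
    linarith
  obtain ⟨a, ha, ha'⟩ := exists_lt_of_lt_csSup hSne
    (show sSup S - (sSup S + sSup R - 1) / 2 < sSup S by linarith)
  obtain ⟨b, hb, hb'⟩ := exists_lt_of_lt_csSup hRne
    (show sSup R - (sSup S + sSup R - 1) / 2 < sSup R by linarith)
  have hab : 1 < a + b := by linarith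
  have hb1 := hRle b hb
  exact ⟨a, b, by linarith, ha.2.1, partiallyMixing_of_liminf ha.1 ha.2.2, hab, hb⟩

end Constants

end ZnAction

end

theorem theorem3 {n : ℕ} (hn : 1 ≤ n) {X : Type*} [MeasurableSpace X] [StandardBorelSpace X]
    [AddAction (ZnAction.Zn n) X] [MeasurableConstVAdd (ZnAction.Zn n) X]
    (μ : Measure X) [IsProbabilityMeasure μ] [VAddInvariantMeasure (ZnAction.Zn n) X μ]
    (h : 1 < ZnAction.mixingConstant n μ + ZnAction.localRank n μ) :
    -- finitely many classes of ergodic self-joinings up to the shifts `Id × T^z`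
    (∃ F : Set (Measure (X × X)), F.Finite ∧
      (∀ ν ∈ F, ZnAction.IsErgodicSelfJoining n μ ν) ∧
      ∀ ν, ZnAction.IsErgodicSelfJoining n μ ν →
        ∃ ν' ∈ F, ∃ z : ZnAction.Zn n, ν = ZnAction.shift z ν') ∧
    -- every nontrivial ergodic self-joining is the graph of a finite-valued map
    (∀ ν, ZnAction.IsErgodicSelfJoining n μ ν → ν ≠ μ.prod μ →
      ZnAction.IsFiniteValuedGraph μ ν) ∧
    -- finite joining rank
    ZnAction.HasFiniteJoiningRank n μ ∧
    -- the Markov centralizer consists of the (countable) convex combinations of the operators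
    -- `T^z P_i` for a finite collection of Markov operators `P_i`
    (∃ (m : ℕ) (P : Fin m → (Lp ℝ 2 μ →L[ℝ] Lp ℝ 2 μ)),
      (∀ i, P i ∈ ZnAction.markovCentralizer n μ) ∧
      ∀ Q : Lp ℝ 2 μ →L[ℝ] Lp ℝ 2 μ, Q ∈ ZnAction.markovCentralizer n μ ↔
        ∃ c : Fin m × ZnAction.Zn n → ℝ, (∀ p, 0 ≤ c p) ∧ HasSum c 1 ∧
          HasSum (fun p => c p • (ZnAction.koopman μ p.2 ∘L P p.1)) Q) := by
  obtain ⟨a, b, ha, ha1, hmix, hab, ξ, hξ, hb⟩ :=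
    ZnAction.exists_of_one_lt_mixingConstant_add_localRank h
  have herg := hmix.ergodic hn ha ha1
  have herg2 := hmix.ergodic_prod hn ha ha1
  obtain ⟨K₀, hkey⟩ : ∃ K₀, ZnAction.HasClosePairs n μ K₀ := by
    obtain ⟨K₀, hK₀⟩ := ZnAction.exists_not_mutuallySingular ha.le ha1 hmix hab hξ hb
    exact ⟨K₀, hK₀⟩
  -- `K₀ = 0` is impossible because `HasClosePairs` produces an index in `Fin K₀`; joining rank
  -- needs the form `r + 1`.
  obtain ⟨r, rfl⟩ : ∃ r, K₀ = r + 1 := by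
    refine Nat.exists_eq_succ_of_ne_zero ?_
    rintro rfl
    obtain ⟨i, -⟩ := hkey μ Fin.elim0 (fun i => i.elim0) (fun i => i.elim0) fun i => i.elim0
    exact i.elim0
  exact ⟨ZnAction.exists_finite_classes hkey,
    fun ν hν hne => hν.isFiniteValuedGraph hkey hne, ZnAction.hasFiniteJoiningRank hkey,
    ZnAction.exists_markovCentralizer_generators hkey⟩
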